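/- **Setting.** Let $\Bbbk$ be an algebraically closed field and let $A=\bigoplus_{i\ge 0}A_i$ be a positively graded $\Bbbk$-algebra: $\dim_\Bbbk A_i<\infty$ for all $i$ and $A_0=\bigoplus_{\lambda\in\Lambda}\Bbbk e_\lambda$, where $\Lambda$ is a nonempty finite set and the $e_\lambda$ are pairwise orthogonal nonzero idempotents. Let $A\text{-gmod}$ be the abelian category of $\mathbb Z$-graded left $A$-modules with finite dimensional homogeneous components, with homogeneous morphisms of degree $0$, and let $\mathrm{ext}^i_A$ denote extensions in it. Let $A^{\downarrow}\text{-gmod}$ be the full subcategory of those $M$ for which there is $n$ with $M_i=0$ for all $i<n$; set $\mathfrak b(M)=\min\{n: M_n\neq0\}$ for such $M\ne 0$, and $\mathfrak b(0)=+\infty$. Put $(M\langle i\rangle)_j=M_{i+j}$. Let $P(\lambda)=Ae_\lambda$, let $L(\lambda)$ be its simple graded quotient concentrated in degree $0$, and let $I(\lambda)$ be the graded injective envelope of $L(\lambda)$ (the graded dual of $e_\lambda A$). Let $\preceq$ be a preorder on $\Lambda$, and write $\lambda\prec\mu$ if $\lambda\preceq\mu$ and $\mu\not\preceq\lambda$.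 The standard module $\Delta(\lambda)$ is the quotient of $P(\lambda)$ by the submodule $K(\lambda)$ generated by the images of all morphisms $P(\mu)\langle i\rangle\to P(\lambda)$ with $\lambda\prec\mu$, $i\in\mathbb Z$. The proper costandard module $\overline\nabla(\lambda)$ is the intersection of the kernels of all morphisms $I(\lambda)\to I(\mu)\langle i\rangle$ with $\lambda\preceq\mu$, $i>0$. Assume that $A$ is standardly stratified, that is, for every $\lambda\in\Lambda$: all composition factors of $\Delta(\lambda)$ are of the form $L(\mu)\langle j\rangle$ with $\mu\preceq\lambda$ (this is automatic if $\preceq$ is total), and $K(\lambda)$ has a finite filtration whose subquotients are isomorphic, up to shift, to standard modules. For $S=\Delta$ or $S=\overline\nabla$, let $\mathcal C(S)$ be the class of all $M\in A^\downarrow\text{-gmod}$ admitting a finite or infinite filtration $M=M^{(0)}\supseteq M^{(1)}\supseteq\cdots$ by graded submodules, with every subquotient $M^{(i)}/M^{(i+1)}$ isomorphic up to shift to some $S(\lambda)$ and with $\lim_{i\to\infty}\mathfrak b(M^{(i)})=+\infty$ (a finite filtration is one that ends at $0$). Let $\mathcal F^\downarrow(S)$ be the class of all $M\in A^\downarrow\text{-gmod}$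 admitting a finite filtration with subquotients in $\mathcal C(S)$. **Theorem.** (i) $$\mathcal F^\downarrow(\Delta)=\{M\in A^\downarrow\text{-gmod}:\mathrm{ext}^i_A(M,\overline\nabla(\lambda)\langle j\rangle)=0\ \ \forall j\in\mathbb Z,\ i>0,\ \lambda\in\Lambda\}$$ $$=\{M\in A^\downarrow\text{-gmod}:\mathrm{ext}^1_A(M,\overline\nabla(\lambda)\langle j\rangle)=0\ \ \forall j\in\mathbb Z,\ \lambda\in\Lambda\}.$$ (ii) $$\mathcal F^\downarrow(\overline\nabla)=\{M\in A^\downarrow\text{-gmod}:\mathrm{ext}^i_A(\Delta(\lambda)\langle j\rangle,M)=0\ \ \forall j\in\mathbb Z,\ i>0,\ \lambda\in\Lambda\}$$ $$=\{M\in A^\downarrow\text{-gmod}:\mathrm{ext}^1_A(\Delta(\lambda)\langle j\rangle,M)=0\ \ \forall j\in\mathbb Z,\ \lambda\in\Lambda\}.$$ -/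

import Mathlib

open CategoryTheory CategoryTheory.Limits

universe u v

/-! ### Graded modules -/

/-- A locally finite dimensional `ℤ`-graded left module over the graded `k`-algebra `(A, 𝒜)`:
these are the objects of `A-gmod`. -/
structure GMod {k A : Type u} [Field k] [Ring A] [Algebra k A] (𝒜 : ℤ → Submodule k A) :
    Type (u + 1) where
  carrier : Type u
  [addCommGroup : AddCommGroup carrier]
  [moduleBase : Module k carrier]
  [module : Module A carrier]
  [isScalarTower : IsScalarTower k A carrier]
  /-- the homogeneous components -/
  gr : ℤ → Submodule k carrier
  isInternal : DirectSum.IsInternal gr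
  smul_mem : ∀ (i j : ℤ) (a : A) (x : carrier), a ∈ 𝒜 i → x ∈ gr j → a • x ∈ gr (i + j)
  finite : ∀ i, Module.Finite k (gr i)

namespace GMod

attribute [instance] GMod.addCommGroup GMod.moduleBase GMod.module GMod.isScalarTower

section Basic

variable {k A : Type u} [Field k] [Ring A] [Algebra k A] {𝒜 : ℤ → Submodule k A}

instance : CoeSort (GMod 𝒜) (Type u) := ⟨GMod.carrier⟩

/-- The canonical isomorphism from the direct sum of the homogeneous components. -/
noncomputable def equiv (M : GMod 𝒜) : DirectSum ℤ (fun i => M.gr i) ≃ₗ[k] M :=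
  LinearEquiv.ofBijective (DirectSum.coeLinearMap M.gr)
    (show Function.Bijective (DirectSum.coeLinearMap M.gr) from M.isInternal)

theorem equiv_lof (M : GMod 𝒜) (i : ℤ) (x : M.gr i) :
    M.equiv (DirectSum.lof k ℤ (fun i => M.gr i) i x) = x :=
  DirectSum.coeLinearMap_lof M.gr i x

/-- The projection onto the homogeneous component of degree `i`. -/
noncomputable def proj (M : GMod 𝒜) (i : ℤ) : M →ₗ[k] M :=
  (M.gr i).subtype ∘ₗ DirectSum.component k ℤ (fun i => M.gr i) i ∘ₗ
    M.equiv.symm.toLinearMap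

theorem proj_mem (M : GMod 𝒜) (i : ℤ) (x : M) : M.proj i x ∈ M.gr i := by
  simp [proj]

theorem symm_of_mem (M : GMod 𝒜) {i : ℤ} {x : M} (hx : x ∈ M.gr i) :
    M.equiv.symm x =
      DirectSum.lof k ℤ (fun i => M.gr i) i ⟨x, hx⟩ := by
  rw [LinearEquiv.symm_apply_eq, M.equiv_lof]

theorem proj_of_mem (M : GMod 𝒜) {i : ℤ} {x : M} (hx : x ∈ M.gr i) : M.proj i x = x := by
  simp [proj, M.symm_of_mem hx, DirectSum.component.lof_self]

theorem proj_of_ne (M : GMod 𝒜) {i j : ℤ} {x : M} (hx : x ∈ M.gr i) (hij : i ≠ j) :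
    M.proj j x = 0 := by
  simp [proj, M.symm_of_mem hx, DirectSum.component.of, hij]

theorem exists_sum_proj (M : GMod 𝒜) (x : M) : ∃ s : Finset ℤ, x = ∑ i ∈ s, M.proj i x := by
  classical
  let E := M.equiv
  refine ⟨(E.symm x).support, ?_⟩
  conv_lhs => rw [← E.apply_symm_apply x]
  change DirectSum.coeLinearMap M.gr (E.symm x) = _
  rw [DirectSum.coeLinearMap_eq_dfinsuppSum, DFinsupp.sum]
  rfl

theorem iSup_eq_top (M : GMod 𝒜) : ⨆ i, M.gr i = ⊤ := M.isInternal.submodule_iSup_eq_top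

/-- A criterion for a family of subspaces to be a grading. -/
theorem isInternal_of_proj {V : Type u} [AddCommGroup V] [Module k V] (gr : ℤ → Submodule k V)
    (p : ℤ → V →ₗ[k] V) (h1 : ∀ i x, x ∈ gr i → p i x = x)
    (h2 : ∀ i j x, x ∈ gr i → i ≠ j → p j x = 0) (h3 : ⨆ i, gr i = ⊤) :
    DirectSum.IsInternal gr := by
  classical
  refine ⟨?_, ?_⟩
  · refine (injective_iff_map_eq_zero (DirectSum.coeAddMonoidHom gr)).2 fun d hd => ?_
    ext j
    have key : ∀ d : DirectSum ℤ (fun i => gr i),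
        p j (DirectSum.coeLinearMap gr d) = (d j : V) := by
      intro d
      induction d using DirectSum.induction_on with
      | zero => simp
      | of i x =>
        rw [show DirectSum.of (fun i => gr i) i x = DirectSum.lof k ℤ (fun i => gr i) i x from rfl,
          DirectSum.coeLinearMap_lof]
        by_cases hij : i = j
        · subst hij
          rw [h1 _ _ x.2, DirectSum.lof_apply]
        · rw [h2 _ _ _ x.2 hij]
          change (0 : V) = ((DirectSum.of (fun i => gr i) i x) j : V)
          rw [DirectSum.of_eq_of_ne _ _ _ (Ne.symm hij)]
          rfl
      | add a b ha hb => simp [ha, hb]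
    have := key d
    rw [show DirectSum.coeLinearMap gr d = 0 from hd, map_zero] at this
    simpa using this.symm
  · have := DirectSum.range_coeLinearMap (A := gr) (R := k)
    rw [h3] at this
    exact LinearMap.range_eq_top.1 this

end Basic

section Submodules

variable {k A : Type u} [Field k] [Ring A] [Algebra k A] {𝒜 : ℤ → Submodule k A}

/-- A graded submodule. -/
@[ext]
structure GSub (M : GMod 𝒜) where
  toSubmodule : Submodule A M
  homogeneous : ∀ x ∈ toSubmodule, ∀ i, M.proj i x ∈ toSubmodule

instance (M : GMod 𝒜) : PartialOrder (GSub M) :=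
  PartialOrder.lift GSub.toSubmodule (fun _ _ h => GSub.ext h)

instance (M : GMod 𝒜) : OrderTop (GSub M) where
  top := ⟨⊤, fun _ _ _ => trivial⟩
  le_top _ _ _ := trivial

instance (M : GMod 𝒜) : OrderBot (GSub M) where
  bot := ⟨⊥, fun x hx i => by
    rw [Submodule.mem_bot] at hx ⊢
    rw [hx, map_zero]⟩
  bot_le N := (bot_le : (⊥ : Submodule A M) ≤ N.toSubmodule)

/-- A graded submodule, as a graded module: `N_i = N ∩ M_i`. -/
noncomputable def GSub.obj {M : GMod 𝒜} (N : GSub M) : GMod 𝒜 where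
  carrier := N.toSubmodule
  gr i := (M.gr i).comap (N.toSubmodule.subtype.restrictScalars k)
  isInternal := by
    let p : ℤ → N.toSubmodule →ₗ[k] N.toSubmodule := fun i =>
      ((M.proj i).comp (N.toSubmodule.subtype.restrictScalars k)).codRestrict
        (N.toSubmodule.restrictScalars k) (fun x => N.homogeneous _ x.2 i)
    refine isInternal_of_proj _ p ?_ ?_ ?_
    · intro i x hx
      exact Subtype.ext (M.proj_of_mem hx)
    · intro i j x hx hij
      exact Subtype.ext (M.proj_of_ne hx hij)
    · rw [eq_top_iff]
      rintro x -
      obtain ⟨s, hs⟩ := M.exists_sum_proj x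
      have hx : x = ∑ i ∈ s, p i x := by
        apply Subtype.ext
        rw [AddSubmonoidClass.coe_finsetSum]
        exact hs
      rw [hx]
      exact Submodule.sum_mem _ fun i _ =>
        Submodule.mem_iSup_of_mem i (M.proj_mem i (x : M))
  smul_mem i j a x ha hx := M.smul_mem i j a x ha hx
  finite i := by
    have := M.finite i
    refine Module.Finite.of_injective
      (((N.toSubmodule.subtype.restrictScalars k).comp (Submodule.subtype _)).codRestrict
        (M.gr i) (fun x => x.2)) ?_
    intro x y h
    exact Subtype.ext (Subtype.ext (congrArg (fun z : M.gr i => (z : M)) h))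

/-- The quotient by a graded submodule: `(M/N)_i` is the image of `M_i`. -/
noncomputable def GSub.quot {M : GMod 𝒜} (N : GSub M) : GMod 𝒜 where
  carrier := M ⧸ N.toSubmodule
  gr i := (M.gr i).map (N.toSubmodule.mkQ.restrictScalars k)
  isInternal := by
    let p : ℤ → (M ⧸ N.toSubmodule) →ₗ[k] (M ⧸ N.toSubmodule) := fun i =>
      (N.toSubmodule.restrictScalars k).mapQ (N.toSubmodule.restrictScalars k) (M.proj i)
        (fun x hx => N.homogeneous x hx i)
    have hp : ∀ i (x : M), p i (N.toSubmodule.mkQ x) = N.toSubmodule.mkQ (M.proj i x) :=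
      fun i x => rfl
    refine isInternal_of_proj _ p ?_ ?_ ?_
    · rintro i _ ⟨x, hx, rfl⟩
      exact (hp i x).trans (by rw [M.proj_of_mem hx]; rfl)
    · rintro i j _ ⟨x, hx, rfl⟩ hij
      exact (hp j x).trans (by rw [M.proj_of_ne hx hij, map_zero])
    · rw [← Submodule.map_iSup, M.iSup_eq_top, Submodule.map_top, LinearMap.range_eq_top]
      exact N.toSubmodule.mkQ_surjective
  smul_mem := by
    rintro i j a _ ha ⟨x, hx, rfl⟩
    exact ⟨a • x, M.smul_mem i j a x ha hx, rfl⟩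
  finite i := by
    have := M.finite i
    infer_instance

/-- For graded submodules `N' ⊆ N` of `M`, the graded module `N / N'`. -/
noncomputable def GSub.subquot {M : GMod 𝒜} (N N' : GSub M) : GMod 𝒜 :=
  GSub.quot (M := N.obj)
    { toSubmodule := N'.toSubmodule.comap N.toSubmodule.subtype
      homogeneous := by
        intro x hx i
        have h : ∀ y : N.obj, (N.obj.proj i y).1 = M.proj i y.1 := by
          intro y
          obtain ⟨s, hs⟩ := N.obj.exists_sum_proj y
          have hs' : y.1 = ∑ j ∈ s, (N.obj.proj j y).1 := by
            conv_lhs => rw [hs]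
            exact AddSubmonoidClass.coe_finsetSum _ _
          have hj : ∀ j, (N.obj.proj j y).1 ∈ M.gr j := fun j => N.obj.proj_mem j y
          rw [hs', map_sum]
          by_cases his : i ∈ s
          · rw [Finset.sum_eq_single_of_mem i his
              (fun j _ hji => M.proj_of_ne (hj j) hji), M.proj_of_mem (hj i)]
          · rw [Finset.sum_eq_zero
              (fun j hjs => M.proj_of_ne (hj j) (by rintro rfl; exact his hjs))]
            rw [hs, map_sum, Finset.sum_eq_zero]
            · rfl
            · intro j hjs
              exact N.obj.proj_of_ne (N.obj.proj_mem j y) (by rintro rfl; exact his hjs)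
        change (N.obj.proj i x).1 ∈ N'.toSubmodule
        rw [h x]
        exact N'.homogeneous _ hx i }

/-- The shift `M⟨i⟩`, with `(M⟨i⟩)_j = M_{i+j}`. -/
def shift (M : GMod 𝒜) (i : ℤ) : GMod 𝒜 where
  carrier := M
  gr j := M.gr (i + j)
  isInternal := by
    refine isInternal_of_proj _ (fun j => M.proj (i + j)) (fun j x hx => M.proj_of_mem hx)
      (fun j l x hx h => M.proj_of_ne hx (by omega)) ?_
    rw [eq_top_iff, ← M.iSup_eq_top]
    refine iSup_le fun j => ?_
    have h := le_iSup (fun j => M.gr (i + j)) (j - i)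
    simpa using h
  smul_mem p j a x ha hx := by
    have := M.smul_mem p (i + j) a x ha hx
    rwa [show p + (i + j) = i + (p + j) by ring] at this
  finite j := M.finite (i + j)

end Submodules

/-! ### The abelian category `A-gmod` -/

section Category

variable {k A : Type u} [Field k] [Ring A] [Algebra k A] {𝒜 : ℤ → Submodule k A}

/-- A morphism of `A-gmod`: a homogeneous `A`-linear map of degree zero. -/
@[ext]
structure Hom (M N : GMod 𝒜) where
  toLinearMap : M →ₗ[A] N
  map_mem : ∀ (i : ℤ) (x : M), x ∈ M.gr i → toLinearMap x ∈ N.gr i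

instance : Category (GMod 𝒜) where
  Hom M N := Hom M N
  id M := ⟨LinearMap.id, fun _ _ h => h⟩
  comp f g := ⟨g.toLinearMap ∘ₗ f.toLinearMap, fun i x h => g.map_mem i _ (f.map_mem i x h)⟩

/-- The underlying `A`-linear map of a morphism. -/
def lin {M N : GMod 𝒜} (f : M ⟶ N) : M →ₗ[A] N := Hom.toLinearMap f

theorem lin_mem {M N : GMod 𝒜} (f : M ⟶ N) {i : ℤ} {x : M} (hx : x ∈ M.gr i) :
    lin f x ∈ N.gr i := Hom.map_mem f i x hx

/-- Construct a morphism from a linear map. -/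
def mkHom {M N : GMod 𝒜} (f : M →ₗ[A] N) (h : ∀ (i : ℤ) (x : M), x ∈ M.gr i → f x ∈ N.gr i) :
    M ⟶ N := Hom.mk f h

@[simp] theorem lin_mkHom {M N : GMod 𝒜} (f : M →ₗ[A] N)
    (h : ∀ (i : ℤ) (x : M), x ∈ M.gr i → f x ∈ N.gr i) : lin (mkHom f h) = f := rfl

theorem hom_ext {M N : GMod 𝒜} {f g : M ⟶ N} (h : ∀ x, lin f x = lin g x) : f = g :=
  Hom.ext (LinearMap.ext h)

@[simp] theorem lin_id (M : GMod 𝒜) : lin (𝟙 M) = LinearMap.id := rfl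

@[simp] theorem lin_comp {M N P : GMod 𝒜} (f : M ⟶ N) (g : N ⟶ P) :
    lin (f ≫ g) = lin g ∘ₗ lin f := rfl

theorem lin_injective {M N : GMod 𝒜} : Function.Injective (lin : (M ⟶ N) → (M →ₗ[A] N)) :=
  fun _ _ h => Hom.ext h

theorem lin_proj {M N : GMod 𝒜} (f : M ⟶ N) (i : ℤ) (x : M) :
    lin f (M.proj i x) = N.proj i (lin f x) := by
  obtain ⟨s, hs⟩ := M.exists_sum_proj x
  have hj : ∀ j, lin f (M.proj j x) ∈ N.gr j := fun j => lin_mem f (M.proj_mem j x)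
  have hR : N.proj i (lin f x) = ∑ j ∈ s, N.proj i (lin f (M.proj j x)) := by
    conv_lhs => rw [hs]
    rw [map_sum, map_sum]
  rw [hR]
  by_cases his : i ∈ s
  · rw [Finset.sum_eq_single_of_mem i his (fun j _ hji => N.proj_of_ne (hj j) hji),
      N.proj_of_mem (hj i)]
  · rw [Finset.sum_eq_zero (fun j hjs => N.proj_of_ne (hj j) (by rintro rfl; exact his hjs))]
    have : M.proj i x = 0 := by
      rw [hs, map_sum, Finset.sum_eq_zero]
      intro j hjs
      exact M.proj_of_ne (M.proj_mem j x) (by rintro rfl; exact his hjs)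
    rw [this, map_zero]

instance (M N : GMod 𝒜) : Zero (M ⟶ N) := ⟨mkHom 0 (fun _ _ _ => Submodule.zero_mem _)⟩
instance (M N : GMod 𝒜) : Add (M ⟶ N) :=
  ⟨fun f g => mkHom (lin f + lin g)
    (fun _ _ h => Submodule.add_mem _ (lin_mem f h) (lin_mem g h))⟩
instance (M N : GMod 𝒜) : Neg (M ⟶ N) :=
  ⟨fun f => mkHom (-lin f) (fun _ _ h => Submodule.neg_mem _ (lin_mem f h))⟩
instance (M N : GMod 𝒜) : Sub (M ⟶ N) :=
  ⟨fun f g => mkHom (lin f - lin g)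
    (fun _ _ h => Submodule.sub_mem _ (lin_mem f h) (lin_mem g h))⟩
instance (M N : GMod 𝒜) : SMul ℕ (M ⟶ N) :=
  ⟨fun n f => mkHom (n • lin f) (fun _ _ h => Submodule.smul_of_tower_mem _ n (lin_mem f h))⟩
instance (M N : GMod 𝒜) : SMul ℤ (M ⟶ N) :=
  ⟨fun n f => mkHom (n • lin f) (fun _ _ h => Submodule.smul_of_tower_mem _ n (lin_mem f h))⟩

instance (M N : GMod 𝒜) : AddCommGroup (M ⟶ N) :=
  Function.Injective.addCommGroup lin lin_injective rfl (fun _ _ => rfl) (fun _ => rfl)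
    (fun _ _ => rfl) (fun _ _ => rfl) (fun _ _ => rfl)

@[simp] theorem lin_zero (M N : GMod 𝒜) : lin (0 : M ⟶ N) = 0 := rfl
@[simp] theorem lin_add {M N : GMod 𝒜} (f g : M ⟶ N) : lin (f + g) = lin f + lin g := rfl

instance : Preadditive (GMod 𝒜) where
  add_comp _ _ _ f f' g := by
    apply hom_ext; intro x; simp
  comp_add _ _ _ f g g' := by
    apply hom_ext; intro x; simp

/-- The kernel of a morphism. -/
def kerSub {M N : GMod 𝒜} (f : M ⟶ N) : GSub M where
  toSubmodule := LinearMap.ker (lin f)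
  homogeneous x hx i := by
    rw [LinearMap.mem_ker] at hx ⊢
    rw [lin_proj, hx, map_zero]

/-- The image of a morphism. -/
def rangeSub {M N : GMod 𝒜} (f : M ⟶ N) : GSub N where
  toSubmodule := LinearMap.range (lin f)
  homogeneous := by
    rintro _ ⟨x, rfl⟩ i
    exact ⟨M.proj i x, lin_proj f i x⟩

/-- The inclusion of a graded submodule. -/
noncomputable def GSub.incl {M : GMod 𝒜} (N : GSub M) : N.obj ⟶ M :=
  mkHom (M := N.obj) N.toSubmodule.subtype (fun _ _ h => h)

/-- The projection onto the quotient by a graded submodule. -/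
noncomputable def GSub.proj {M : GMod 𝒜} (N : GSub M) : M ⟶ N.quot :=
  mkHom (N := N.quot) N.toSubmodule.mkQ (fun _ x h => ⟨x, h, rfl⟩)

theorem GSub.lin_incl_injective {M : GMod 𝒜} (N : GSub M) : Function.Injective (lin N.incl) :=
  N.toSubmodule.injective_subtype

theorem GSub.lin_proj_surjective {M : GMod 𝒜} (N : GSub M) : Function.Surjective (lin N.proj) :=
  N.toSubmodule.mkQ_surjective

/-- Lift a morphism to a graded submodule containing its image. -/
noncomputable def GSub.lift {M X : GMod 𝒜} (N : GSub M) (g : X ⟶ M) (h : ∀ x, lin g x ∈ N.toSubmodule) :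
    X ⟶ N.obj :=
  mkHom (N := N.obj) ((lin g).codRestrict N.toSubmodule h) (fun _ _ hx => lin_mem g hx)

/-- Descend a morphism to the quotient by a graded submodule of its kernel. -/
noncomputable def GSub.desc {M X : GMod 𝒜} (N : GSub M) (g : M ⟶ X) (h : N.toSubmodule ≤ LinearMap.ker (lin g)) :
    N.quot ⟶ X :=
  mkHom (M := N.quot) (N.toSubmodule.liftQ (lin g) h) (by
    rintro i _ ⟨x, hx, rfl⟩
    exact lin_mem g hx)

theorem lin_apply_eq_zero_of_comp {X Y Z : GMod 𝒜} {f : X ⟶ Y} {g : Y ⟶ Z} (h : f ≫ g = 0)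
    (x : X) : lin g (lin f x) = 0 := by
  have := congrArg (fun t => lin t x) h
  simpa using this

theorem injective_of_mono {M N : GMod 𝒜} (f : M ⟶ N) [Mono f] : Function.Injective (lin f) := by
  have h : (kerSub f).incl ≫ f = 0 := hom_ext fun x => x.2
  have h0 : (kerSub f).incl = 0 := by rw [← cancel_mono f, h, zero_comp]
  refine (injective_iff_map_eq_zero (lin f)).2 fun x hx => ?_
  exact congrArg (fun t => lin t (⟨x, hx⟩ : (kerSub f).toSubmodule)) h0

theorem surjective_of_epi {M N : GMod 𝒜} (f : M ⟶ N) [Epi f] : Function.Surjective (lin f) := by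
  have h : f ≫ (rangeSub f).proj = 0 := by
    refine hom_ext fun x => ?_
    exact (Submodule.Quotient.mk_eq_zero _).2 ⟨x, rfl⟩
  have h0 : (rangeSub f).proj = 0 := by rw [← cancel_epi f, h, comp_zero]
  intro y
  have hy := congrArg (fun t => lin t y) h0
  exact (Submodule.Quotient.mk_eq_zero _).1 hy

instance : HasKernels (GMod 𝒜) where
  has_limit f := ⟨⟨⟨_, KernelFork.IsLimit.ofι (f := f) (kerSub f).incl
    (hom_ext fun x => x.2)
    (fun g hg => (kerSub f).lift g (fun x => lin_apply_eq_zero_of_comp hg x))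
    (fun _ _ => rfl)
    (fun _ _ _ hm => hom_ext fun x => (kerSub f).lin_incl_injective
      (congrArg (fun t => lin t x) hm))⟩⟩⟩

instance : HasCokernels (GMod 𝒜) where
  has_colimit f := ⟨⟨⟨_, CokernelCofork.IsColimit.ofπ (f := f) (rangeSub f).proj
    (hom_ext fun x => (Submodule.Quotient.mk_eq_zero _).2 ⟨x, rfl⟩)
    (fun g hg => (rangeSub f).desc g (by
      rintro _ ⟨x, rfl⟩
      exact lin_apply_eq_zero_of_comp hg x))
    (fun _ _ => hom_ext fun _ => rfl)
    (fun _ _ _ hm => hom_ext fun y => by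
      obtain ⟨x, rfl⟩ := (rangeSub f).lin_proj_surjective y
      exact congrArg (fun t => lin t x) hm)⟩⟩⟩

instance : IsNormalMonoCategory (GMod 𝒜) where
  normalMonoOfMono {M N} f _ := by
    have hf := injective_of_mono f
    have hker : ∀ {X : GMod 𝒜} (g : X ⟶ N), g ≫ (rangeSub f).proj = 0 →
        ∀ x, lin g x ∈ LinearMap.range (lin f) := fun g hg x =>
      (Submodule.Quotient.mk_eq_zero _).1 (lin_apply_eq_zero_of_comp hg x)
    refine ⟨⟨(rangeSub f).quot, (rangeSub f).proj,
      hom_ext fun x => (Submodule.Quotient.mk_eq_zero _).2 ⟨x, rfl⟩, ?_⟩⟩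
    have key : ∀ {X : GMod 𝒜} (g : X ⟶ N) (hg : g ≫ (rangeSub f).proj = 0) (x : X),
        lin f ((LinearEquiv.ofInjective (lin f) hf).symm ⟨lin g x, hker g hg x⟩) = lin g x :=
      fun g hg x => congrArg Subtype.val
        ((LinearEquiv.ofInjective (lin f) hf).apply_symm_apply ⟨lin g x, hker g hg x⟩)
    refine KernelFork.IsLimit.ofι _ _ (fun {X} g hg => mkHom
      ((LinearEquiv.ofInjective (lin f) hf).symm.toLinearMap ∘ₗ
        (lin g).codRestrict (LinearMap.range (lin f)) (hker g hg)) ?_) ?_ ?_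
    · intro i x hx
      set y : M := (LinearEquiv.ofInjective (lin f) hf).symm ⟨lin g x, hker g hg x⟩ with hy
      change y ∈ M.gr i
      have h1 : lin f (M.proj i y) = lin f y := by
        rw [lin_proj, key g hg x]
        exact N.proj_of_mem (lin_mem g hx)
      rw [← hf h1]
      exact M.proj_mem i y
    · intro X g hg
      exact hom_ext fun x => key g hg x
    · intro X g hg m hm
      refine hom_ext fun x => hf ?_
      refine (congrArg (fun t => lin t x) hm).trans (key g hg x).symm

instance : IsNormalEpiCategory (GMod 𝒜) where
  normalEpiOfEpi {M N} f _ := by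
    have hf := surjective_of_epi f
    refine ⟨⟨(kerSub f).obj, (kerSub f).incl, hom_ext fun x => x.2, ?_⟩⟩
    have hle : ∀ {X : GMod 𝒜} (g : M ⟶ X), (kerSub f).incl ≫ g = 0 →
        LinearMap.ker (lin f) ≤ LinearMap.ker (lin g) := fun g hg x hx =>
      lin_apply_eq_zero_of_comp hg (⟨x, hx⟩ : (kerSub f).toSubmodule)
    let E := (lin f).quotKerEquivOfSurjective hf
    have key : ∀ {X : GMod 𝒜} (g : M ⟶ X) (hg : (kerSub f).incl ≫ g = 0) (x : M),
        (LinearMap.ker (lin f)).liftQ (lin g) (hle g hg) (E.symm (lin f x)) = lin g x := by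
      intro X g hg x
      have : E.symm (lin f x) = (LinearMap.ker (lin f)).mkQ x := by
        rw [LinearEquiv.symm_apply_eq]
        rfl
      rw [this]
      rfl
    refine CokernelCofork.IsColimit.ofπ _ _ (fun {X} g hg => mkHom
      ((LinearMap.ker (lin f)).liftQ (lin g) (hle g hg) ∘ₗ E.symm.toLinearMap) ?_) ?_ ?_
    · intro i y hy
      obtain ⟨x, rfl⟩ := hf y
      have h1 : lin f (M.proj i x) = lin f x := by
        rw [lin_proj, N.proj_of_mem hy]
      change (LinearMap.ker (lin f)).liftQ (lin g) (hle g hg) (E.symm (lin f x)) ∈ X.gr i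
      rw [← h1, key g hg]
      exact lin_mem g (M.proj_mem i x)
    · intro X g hg
      exact hom_ext fun x => key g hg x
    · intro X g hg m hm
      refine hom_ext fun y => ?_
      obtain ⟨x, rfl⟩ := hf y
      exact (congrArg (fun t => lin t x) hm).trans (key g hg x).symm

/-- Finite direct products. -/
def pi {n : ℕ} (M : Fin n → GMod 𝒜) : GMod 𝒜 where
  carrier := ∀ i, M i
  gr j := Submodule.pi Set.univ (fun i => (M i).gr j)
  isInternal := by
    refine isInternal_of_proj _ (fun j => LinearMap.pi fun i => (M i).proj j ∘ₗ LinearMap.proj i)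
      ?_ ?_ ?_
    · intro j x hx
      funext i
      exact (M i).proj_of_mem (hx i trivial)
    · intro j l x hx h
      funext i
      exact (M i).proj_of_ne (hx i trivial) h
    · rw [eq_top_iff]
      rintro x -
      rw [← Finset.univ_sum_single x]
      refine Submodule.sum_mem _ fun i _ => ?_
      have hx : x i ∈ ⨆ j, (M i).gr j := by rw [(M i).iSup_eq_top]; trivial
      have hx' : (LinearMap.single k (fun i => (M i : Type u)) i) (x i) ∈
          (⨆ j, (M i).gr j).map (LinearMap.single k (fun i => (M i : Type u)) i) :=
        ⟨x i, hx, rfl⟩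
      rw [Submodule.map_iSup] at hx'
      have hle : ∀ j, ((M i).gr j).map (LinearMap.single k (fun i => (M i : Type u)) i) ≤
          Submodule.pi Set.univ (fun i => (M i).gr j) := by
        rintro j _ ⟨y, hy, rfl⟩ l -
        by_cases h : l = i
        · subst h; simpa using hy
        · simp [Pi.single_eq_of_ne h]
      exact (iSup_mono hle : _ ≤ _) hx'
  smul_mem i j a x ha hx := fun l _ => (M l).smul_mem i j a (x l) ha (hx l trivial)
  finite j := by
    have := fun i => (M i).finite j
    refine Module.Finite.of_injective
      (LinearMap.pi fun i => (((LinearMap.proj i : (∀ i, M i) →ₗ[k] M i).comp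
        (Submodule.subtype _)).codRestrict ((M i).gr j) (fun x => x.2 i trivial)) :
        (Submodule.pi Set.univ (fun i => (M i).gr j)) →ₗ[k] (∀ i, (M i).gr j)) ?_
    intro x y h
    apply Subtype.ext
    funext i
    exact congrArg Subtype.val (congrFun h i)

instance : HasFiniteProducts (GMod 𝒜) where
  out n := ⟨fun F => by
    have : HasProduct (fun i : Fin n => F.obj ⟨i⟩) := ⟨⟨⟨Fan.mk (pi fun i : Fin n => F.obj ⟨i⟩)
      (fun i => mkHom (M := pi fun i : Fin n => F.obj ⟨i⟩) (LinearMap.proj i)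
        (fun j x hx => hx i trivial)),
      Fan.IsLimit.mk _ (fun s => mkHom (N := pi fun i : Fin n => F.obj ⟨i⟩)
          (LinearMap.pi fun i => lin (s.proj i)) (fun j x hx i _ => lin_mem (s.proj i) hx))
        (fun _ _ => rfl)
        (fun _ _ hm => hom_ext fun x => funext fun i =>
          congrArg (fun t => lin t x) (hm i))⟩⟩⟩
    exact hasLimit_of_iso (Discrete.natIso (fun _ => Iso.refl _) :
      Discrete.functor (fun i : Fin n => F.obj ⟨i⟩) ≅ F)⟩

noncomputable instance : Abelian (GMod 𝒜) where

/-- The groups `ext^i` of `A-gmod` are the `Ext` groups of this abelian category. -/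
instance : HasExt.{u + 1} (GMod 𝒜) := HasExt.standard _

end Category

/-! ### Filtrations -/

section Filtrations

variable {k A : Type u} [Field k] [Ring A] [Algebra k A] {𝒜 : ℤ → Submodule k A}

/-- The sum of a set of graded submodules. -/
def GSub.sum {M : GMod 𝒜} (S : Set (GSub M)) : GSub M where
  toSubmodule := ⨆ N : S, N.1.toSubmodule
  homogeneous x hx i := by
    induction hx using Submodule.iSup_induction' with
    | mem N x hx => exact Submodule.mem_iSup_of_mem N (N.1.homogeneous x hx i)
    | zero => rw [map_zero]; exact Submodule.zero_mem _
    | add x y _ _ hx hy => rw [map_add]; exact Submodule.add_mem _ hx hy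

/-- The intersection of a set of graded submodules (the whole module if the set is empty). -/
def GSub.inter {M : GMod 𝒜} (S : Set (GSub M)) : GSub M where
  toSubmodule := ⨅ N : S, N.1.toSubmodule
  homogeneous x hx i := by
    rw [Submodule.mem_iInf] at hx ⊢
    exact fun N => N.1.homogeneous x (hx N) i

/-- `M` belongs to `A^↓-gmod`: there is `n` with `M_i = 0` for all `i < n`. -/
def IsBoundedBelow (M : GMod 𝒜) : Prop := ∃ n : ℤ, ∀ i < n, M.gr i = ⊥

/-- `M` is isomorphic, up to shift, to a member of the family `S`. -/
def IsShiftOf {Λ : Type v} (S : Λ → GMod 𝒜) (M : GMod 𝒜) : Prop :=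
  ∃ (l : Λ) (j : ℤ), Nonempty (M ≅ (S l).shift j)

/-- `M` has a finite filtration all of whose subquotients satisfy `Q`. -/
def HasFiniteFiltration (Q : GMod 𝒜 → Prop) (M : GMod 𝒜) : Prop :=
  ∃ (n : ℕ) (F : ℕ → GSub M), F 0 = ⊤ ∧ F n = ⊥ ∧
    ∀ i < n, F (i + 1) ≤ F i ∧ Q ((F i).subquot (F (i + 1)))

/-- The category `𝒞(S)`: modules `M` of `A^↓-gmod` with a (finite or infinite) filtration
`M = M⁽⁰⁾ ⊇ M⁽¹⁾ ⊇ M⁽²⁾ ⊇ ⋯` whose subquotients are isomorphic, up to shift, to members of `S`, such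
that the lowest degree of `M⁽ⁱ⁾` tends to `+∞`. A finite filtration is one that reaches `0` at some
step and stays there. -/
def InC {Λ : Type v} (S : Λ → GMod 𝒜) (M : GMod 𝒜) : Prop :=
  M.IsBoundedBelow ∧ ∃ F : ℕ → GSub M, F 0 = ⊤ ∧ (∀ i, F (i + 1) ≤ F i) ∧
    (∀ i, F i = ⊥ ∨ IsShiftOf S ((F i).subquot (F (i + 1)))) ∧
    ∀ n : ℤ, ∃ m : ℕ, ∀ i ≥ m, ∀ j ≤ n, (F i).obj.gr j = ⊥

/-- The category `ℱ^↓(S)`: modules of `A^↓-gmod` with a finite filtration with subquotients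
from `𝒞(S)`. -/
def InFDown {Λ : Type v} (S : Λ → GMod 𝒜) (M : GMod 𝒜) : Prop :=
  M.IsBoundedBelow ∧ HasFiniteFiltration (InC S) M

end Filtrations

end GMod

/-! ### Positively graded algebras and their structural modules -/

/-- The graded algebra `A = ⨁ 𝒜 i` is positively graded, with `e` the family of orthogonal
idempotents: `A` is concentrated in nonnegative degrees, locally finite, and `A_0 = ⨁ k e_λ` for
pairwise orthogonal nonzero idempotents `e_λ`. -/
structure IsPositivelyGraded {k A : Type u} [Field k] [Ring A] [Algebra k A]
    (𝒜 : ℤ → Submodule k A) {Λ : Type v} (e : Λ → A) : Prop where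
  eq_bot : ∀ i < 0, 𝒜 i = ⊥
  finite : ∀ i, Module.Finite k (𝒜 i)
  orthogonal : OrthogonalIdempotents e
  ne_zero : ∀ l, e l ≠ 0
  span_eq : Submodule.span k (Set.range e) = 𝒜 0

section GradedDual

variable {k A : Type u} [Field k] [Ring A] [Algebra k A]

/-- The graded dual of `A`: linear functionals vanishing on all but finitely many
homogeneous components. -/
def gradedDual (𝒜 : ℤ → Submodule k A) : Submodule k (A →ₗ[k] k) where
  carrier := {φ | ∃ s : Finset ℤ, ∀ i ∉ s, ∀ a ∈ 𝒜 i, φ a = 0}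
  zero_mem' := ⟨∅, fun _ _ _ _ => rfl⟩
  add_mem' := by
    classical
    rintro φ ψ ⟨s, hs⟩ ⟨t, ht⟩
    refine ⟨s ∪ t, fun i hi a ha => ?_⟩
    rw [Finset.mem_union, not_or] at hi
    simp [hs i hi.1 a ha, ht i hi.2 a ha]
  smul_mem' := by
    rintro c φ ⟨s, hs⟩
    exact ⟨s, fun i hi a ha => by simp [hs i hi a ha]⟩

/-- The graded dual of `A`, as a type carrying the left `A`-action `(b • φ)(a) = φ (a * b)`. -/
def GradedDual (𝒜 : ℤ → Submodule k A) : Type u := gradedDual 𝒜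

namespace GradedDual

variable (𝒜 : ℤ → Submodule k A)

instance : AddCommGroup (GradedDual 𝒜) := inferInstanceAs (AddCommGroup (gradedDual 𝒜))
instance : Module k (GradedDual 𝒜) := inferInstanceAs (Module k (gradedDual 𝒜))

variable {𝒜}

/-- The underlying functional. -/
def fn (φ : GradedDual 𝒜) : A →ₗ[k] k := φ.1

theorem fn_ext {φ ψ : GradedDual 𝒜} (h : ∀ a, fn φ a = fn ψ a) : φ = ψ :=
  Subtype.ext (LinearMap.ext h)

variable (𝒜) in
/-- Functionals supported on the component of degree `-n`. -/
def gr (n : ℤ) : Submodule k (GradedDual 𝒜) where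
  carrier := {φ | ∀ i ≠ -n, ∀ a ∈ 𝒜 i, fn φ a = 0}
  zero_mem' _ _ _ _ := rfl
  add_mem' {φ ψ} hφ hψ i hi a ha := by
    change fn φ a + fn ψ a = 0
    rw [hφ i hi a ha, hψ i hi a ha, add_zero]
  smul_mem' c φ hφ i hi a ha := by
    change c • fn φ a = 0
    rw [hφ i hi a ha, smul_zero]

@[simp] theorem fn_add (φ ψ : GradedDual 𝒜) (a : A) : fn (φ + ψ) a = fn φ a + fn ψ a := rfl
@[simp] theorem fn_zero (a : A) : fn (0 : GradedDual 𝒜) a = 0 := rfl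
@[simp] theorem fn_smul (c : k) (φ : GradedDual 𝒜) (a : A) : fn (c • φ) a = c • fn φ a := rfl

variable [GradedAlgebra 𝒜]

instance : SMul A (GradedDual 𝒜) where
  smul b φ := ⟨fn φ ∘ₗ LinearMap.mulRight k b, by
    classical
    obtain ⟨s, hs⟩ := φ.2
    refine ⟨(s ×ˢ (DirectSum.decompose 𝒜 b).support).image (fun p => p.1 - p.2),
      fun i hi a ha => ?_⟩
    change fn φ (a * b) = 0
    rw [← DirectSum.sum_support_decompose 𝒜 b, Finset.mul_sum, map_sum]
    refine Finset.sum_eq_zero fun j hj => hs (i + j) (fun h => hi ?_) _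
      (SetLike.mul_mem_graded ha (SetLike.coe_mem _))
    exact Finset.mem_image.2 ⟨(i + j, j), Finset.mem_product.2 ⟨h, hj⟩, by simp⟩⟩

@[simp] theorem fn_act (b : A) (φ : GradedDual 𝒜) (a : A) : fn (b • φ) a = fn φ (a * b) := rfl

instance : Module A (GradedDual 𝒜) where
  one_smul φ := fn_ext fun a => by simp
  mul_smul b c φ := fn_ext fun a => by simp [mul_assoc]
  smul_zero b := fn_ext fun a => by simp
  smul_add b φ ψ := fn_ext fun a => by simp
  add_smul b c φ := fn_ext fun a => by simp [mul_add]
  zero_smul φ := fn_ext fun a => by simp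

instance : IsScalarTower k A (GradedDual 𝒜) where
  smul_assoc c b φ := fn_ext fun a => by simp

/-- Projection onto degree `n`. -/
noncomputable def projDeg (n : ℤ) : GradedDual 𝒜 →ₗ[k] GradedDual 𝒜 where
  toFun φ := ⟨fn φ ∘ₗ GradedAlgebra.proj 𝒜 (-n), {-n}, fun i hi a ha => by
    have : i ≠ -n := by simpa using hi
    simp [GradedAlgebra.proj_apply, DirectSum.decompose_of_mem_ne 𝒜 ha this]⟩
  map_add' φ ψ := rfl
  map_smul' c φ := rfl

theorem fn_projDeg (n : ℤ) (φ : GradedDual 𝒜) (a : A) :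
    fn (projDeg n φ) a = fn φ (DirectSum.decompose 𝒜 a (-n)) := rfl

theorem ext_homogeneous {φ ψ : GradedDual 𝒜} (h : ∀ i, ∀ a ∈ 𝒜 i, fn φ a = fn ψ a) : φ = ψ := by
  classical
  refine fn_ext fun a => ?_
  rw [← DirectSum.sum_support_decompose 𝒜 a, map_sum, map_sum]
  exact Finset.sum_congr rfl fun i _ => h i _ (SetLike.coe_mem _)

theorem isInternal : DirectSum.IsInternal (gr 𝒜) := by
  refine GMod.isInternal_of_proj _ projDeg ?_ ?_ ?_
  · intro n φ hφ
    refine ext_homogeneous fun i a ha => ?_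
    rw [fn_projDeg]
    by_cases h : i = -n
    · subst h; rw [DirectSum.decompose_of_mem_same 𝒜 ha]
    · rw [DirectSum.decompose_of_mem_ne 𝒜 ha h, map_zero, hφ i h a ha]
  · intro n m φ hφ hnm
    refine fn_ext fun a => ?_
    rw [fn_projDeg, fn_zero]
    exact hφ (-m) (by omega) _ (SetLike.coe_mem _)
  · rw [eq_top_iff]
    rintro φ -
    obtain ⟨s, hs⟩ := φ.2
    have h : φ = ∑ i ∈ s, projDeg (-i) φ := by
      refine ext_homogeneous fun j a ha => ?_
      let ev : GradedDual 𝒜 →ₗ[k] k :=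
        { toFun := fun φ => fn φ a, map_add' := fun _ _ => rfl, map_smul' := fun _ _ => rfl }
      have hp : ∀ i, ev (projDeg (-i) φ) = fn φ (DirectSum.decompose 𝒜 a i) := fun i => by
        change fn (projDeg (-i) φ) a = _
        rw [fn_projDeg, neg_neg]
      change fn φ a = ev (∑ i ∈ s, projDeg (-i) φ)
      rw [map_sum]
      simp only [hp]
      by_cases hj : j ∈ s
      · rw [Finset.sum_eq_single_of_mem j hj fun i _ hij => by
          rw [DirectSum.decompose_of_mem_ne 𝒜 ha hij.symm, map_zero],
          DirectSum.decompose_of_mem_same 𝒜 ha]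
      · rw [Finset.sum_eq_zero fun i hi => by
          rw [DirectSum.decompose_of_mem_ne 𝒜 ha (by rintro rfl; exact hj hi), map_zero]]
        exact hs j hj a ha
    rw [h]
    refine Submodule.sum_mem _ fun i _ => Submodule.mem_iSup_of_mem (-i) ?_
    intro j hj a ha
    rw [fn_projDeg, DirectSum.decompose_of_mem_ne 𝒜 ha hj, map_zero]

end GradedDual

end GradedDual

namespace IsPositivelyGraded

open GMod

variable {k A : Type u} [Field k] [Ring A] [Algebra k A]
  {𝒜 : ℤ → Submodule k A} {Λ : Type v} {e : Λ → A}

theorem idem_mem (h : IsPositivelyGraded 𝒜 e) (l : Λ) : e l ∈ 𝒜 0 := by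
  rw [← h.span_eq]
  exact Submodule.subset_span ⟨l, rfl⟩

variable [GradedAlgebra 𝒜]

/-- The regular module `A`. -/
def regular (h : IsPositivelyGraded 𝒜 e) : GMod 𝒜 where
  carrier := A
  gr := 𝒜
  isInternal := DirectSum.Decomposition.isInternal 𝒜
  smul_mem _ _ _ _ ha hx := SetLike.mul_mem_graded ha hx
  finite := h.finite

/-- The indecomposable projective module `P(λ) = A e_λ`, as the image of the right
multiplication by `e_λ` on `A`. -/
noncomputable def P (h : IsPositivelyGraded 𝒜 e) (l : Λ) : GMod 𝒜 :=
  (rangeSub (M := h.regular) (N := h.regular)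
    (mkHom (M := h.regular) (N := h.regular) (LinearMap.toSpanSingleton A A (e l))
      (fun i x hx => by
        have hx' := SetLike.mul_mem_graded (A := 𝒜) hx (h.idem_mem l)
        rw [add_zero] at hx'
        exact hx'))).obj

/-- The graded dual `A^⊛` of the right regular module, a left module. -/
def dual (h : IsPositivelyGraded 𝒜 e) : GMod 𝒜 where
  carrier := GradedDual 𝒜
  gr := GradedDual.gr 𝒜
  isInternal := GradedDual.isInternal
  smul_mem i j b φ hb hφ := by
    intro l hl a ha
    rw [GradedDual.fn_act]
    exact hφ (l + i) (by omega) _ (SetLike.mul_mem_graded ha hb)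
  finite n := by
    have := h.finite (-n)
    refine Module.Finite.of_injective (N := 𝒜 (-n) →ₗ[k] k)
      ({ toFun := fun φ => GradedDual.fn φ.1 ∘ₗ (𝒜 (-n)).subtype
         map_add' := fun _ _ => rfl
         map_smul' := fun _ _ => rfl } :
        GradedDual.gr 𝒜 n →ₗ[k] (𝒜 (-n) →ₗ[k] k)) ?_
    intro φ ψ hφψ
    refine Subtype.ext (GradedDual.ext_homogeneous fun i a ha => ?_)
    by_cases hi : i = -n
    · subst hi
      exact congrArg (fun f : 𝒜 (-n) →ₗ[k] k => f ⟨a, ha⟩) hφψ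
    · rw [φ.2 i hi a ha, ψ.2 i hi a ha]

/-- The indecomposable injective module `I(λ)`, the injective envelope of the simple module
`L(λ)`: the graded dual of the right module `e_λ A`, realised inside the graded dual of `A` as the
image of the idempotent endomorphism `φ ↦ φ (e_λ * ·)`. -/
noncomputable def I (h : IsPositivelyGraded 𝒜 e) (l : Λ) : GMod 𝒜 :=
  (rangeSub (M := h.dual) (N := h.dual)
    (mkHom (M := h.dual) (N := h.dual)
      { toFun := fun φ : GradedDual 𝒜 =>
          (⟨GradedDual.fn φ ∘ₗ LinearMap.mulLeft k (e l), by
            obtain ⟨s, hs⟩ := φ.2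
            refine ⟨s, fun i hi a ha => hs i hi _ ?_⟩
            simpa using (SetLike.mul_mem_graded (h.idem_mem l) ha : e l * a ∈ 𝒜 (0 + i))⟩ :
              GradedDual 𝒜)
        map_add' := fun _ _ => rfl
        map_smul' := fun b φ => GradedDual.fn_ext fun a =>
          congrArg (GradedDual.fn φ) (mul_assoc (e l) a b) }
      (fun n φ hφ i hi a ha => hφ i hi (e l * a) (by
        simpa using (SetLike.mul_mem_graded (h.idem_mem l) ha : e l * a ∈ 𝒜 (0 + i)))))).obj

variable [Preorder Λ]

/-- The kernel `K(λ)` of `P(λ) ↠ Δ(λ)`: the submodule generated by the images of all morphisms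
`P(μ)⟨i⟩ ⟶ P(λ)` with `λ ≺ μ` and `i ∈ ℤ`. -/
noncomputable def K (h : IsPositivelyGraded 𝒜 e) (l : Λ) : GSub (h.P l) :=
  GSub.sum {N | ∃ (m : Λ) (i : ℤ) (f : (h.P m).shift i ⟶ h.P l), l < m ∧ N = rangeSub f}

/-- The standard module `Δ(λ)`. -/
noncomputable def standard (h : IsPositivelyGraded 𝒜 e) (l : Λ) : GMod 𝒜 := (h.K l).quot

/-- The proper costandard module, dual to the proper standard module: the intersection of the
kernels of all morphisms `I(λ) ⟶ I(μ)⟨i⟩` with `λ ⪯ μ` and `i > 0`. -/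
noncomputable def properCostandard (h : IsPositivelyGraded 𝒜 e) (l : Λ) : GMod 𝒜 :=
  (GSub.inter {N : GSub (h.I l) |
    ∃ (m : Λ) (i : ℤ) (f : h.I l ⟶ (h.I m).shift i), l ≤ m ∧ 0 < i ∧ N = kerSub f}).obj

/-- The positively graded algebra is standardly stratified with respect to the preorder on `Λ`. -/
structure IsStandardlyStratified (h : IsPositivelyGraded 𝒜 e) : Prop where
  /-- All composition factors of `Δ(λ)` are, up to shift, of the form `L(μ)` with `μ ⪯ λ`: the
  module `L(μ)⟨j⟩` occurs in `Δ(λ)` for some `j` if and only if `e_μ Δ(λ) ≠ 0`. This is automatic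
  if the preorder is total. -/
  le_of_compositionFactor : ∀ (l m : Λ), (∃ x : h.standard l, e m • x ≠ 0) → m ≤ l
  /-- `K(λ)` has a finite filtration by standard modules, up to shift. -/
  filtration : ∀ l, HasFiniteFiltration (IsShiftOf h.standard) (h.K l).obj

end IsPositivelyGraded

/-! The proof rests on the orthogonality of standard and proper costandard modules. Call `μ` a
weight of `M` if `e_μ M ≠ 0`. A morphism `M ⟶ ∇̄(λ)⟨j⟩` is the same as a functional on `e_λ M_{-j}`
that kills all products of an element of positive degree with a vector of weight `⪰ λ`
(`exists_lift_properCostandard'`, `hom_ext_ev`). This description shows that `Hom(Δ(λ)⟨i⟩,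
∇̄(μ)⟨j⟩)` vanishes unless `λ = μ` and `i = j` (`eq_of_hom_ne_zero`), and that morphisms `K(λ)⟨i⟩ ⟶
∇̄(μ)⟨j⟩` extend to `P(λ)⟨i⟩`, so that `ext¹` vanishes (`subsingleton_ext_one`). Since `K(λ)` is
filtered by standard modules, dimension shifting gives all higher `ext` (`RightOrthogonal.ext`).

Filtered modules are therefore orthogonal: long exact sequences handle finitely many layers, and the
tail of an infinite filtration lives in degrees too high to matter (`subsingleton_ext_of_degrees`,
`exists_forall_hom_K_eq_zero`).

Both converses go by induction on the number of weights, removing a maximal class of weights.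

For (ii), the lowest vector of that class gives a morphism `M ⟶ ∇̄(λ)⟨j⟩` along which every morphism
from a standard module lifts. It is surjective with right orthogonal kernel
(`RightOrthogonal.exists_hom`). Iterating, local finiteness makes the kernels stationary in each
degree; their intersection is right orthogonal and has lost the class
(`RightOrthogonal.exists_sub`).

For (i), minimal generators of the class give a sum `G` of standard modules and `f : G ⟶ M` through
which every `G ⟶ ∇̄(λ)⟨j⟩` factors (`exists_standard_cover`). Let `T` be the image of `f`. Then `M /
T` is again left orthogonal and is filtered by induction; hence `ext²(M / T, ∇̄) = 0`, which forces
`ext¹(T, ∇̄) = 0`. So each morphism from the kernel of `G ⟶ T` to a `∇̄` extends to `G`, factors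
through `M`, and is zero. A nonzero module bounded below always maps nontrivially to some `∇̄`; thus
the kernel is zero and `T ≅ G`. -/

namespace GMod

section General

variable {k A : Type u} [Field k] [Ring A] [Algebra k A] {𝒜 : ℤ → Submodule k A}

/-! ### Monomorphisms, epimorphisms and short exact sequences -/

theorem mono_of_injective {M N : GMod 𝒜} (f : M ⟶ N) (hf : Function.Injective (lin f)) :
    Mono f :=
  ⟨fun _ _ h => hom_ext fun x => hf (congrArg (fun t => lin t x) h)⟩

theorem epi_of_surjective {M N : GMod 𝒜} (f : M ⟶ N) (hf : Function.Surjective (lin f)) :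
    Epi f :=
  ⟨fun _ _ h => hom_ext fun y => by
    obtain ⟨x, rfl⟩ := hf y
    exact congrArg (fun t => lin t x) h⟩

/-- A bijective morphism is an isomorphism. -/
noncomputable def isoOfBijective {M N : GMod 𝒜} (f : M ⟶ N) (hf : Function.Bijective (lin f)) :
    M ≅ N :=
  have := mono_of_injective f hf.1
  have := epi_of_surjective f hf.2
  have := isIso_of_mono_of_epi f
  asIso f

@[simp] theorem lin_inv_hom {M N : GMod 𝒜} (i : M ≅ N) (x : M) :
    lin i.inv (lin i.hom x) = x :=
  congrArg (fun t => lin t x) i.hom_inv_id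

@[simp] theorem lin_hom_inv {M N : GMod 𝒜} (i : M ≅ N) (x : N) :
    lin i.hom (lin i.inv x) = x :=
  congrArg (fun t => lin t x) i.inv_hom_id

theorem lin_comp_apply {M N X : GMod 𝒜} (f : M ⟶ N) (g : N ⟶ X) (x : M) :
    lin (f ≫ g) x = lin g (lin f x) := rfl

/-- Exactness of `0 ⟶ X ⟶ Y ⟶ Z ⟶ 0`, elementwise. -/
structure IsSES {X Y Z : GMod 𝒜} (f : X ⟶ Y) (g : Y ⟶ Z) : Prop where
  injective : Function.Injective (lin f)
  surjective : Function.Surjective (lin g)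
  exact : ∀ y, lin g y = 0 ↔ ∃ x, lin f x = y

namespace IsSES

variable {X Y Z W : GMod 𝒜} {f : X ⟶ Y} {g : Y ⟶ Z}

theorem zero (h : IsSES f g) : f ≫ g = 0 :=
  hom_ext fun x => (h.exact _).2 ⟨x, rfl⟩

theorem exists_lift (h : IsSES f g) (t : W ⟶ Y) (ht : t ≫ g = 0) : ∃ s : W ⟶ X, s ≫ f = t := by
  have hr : ∀ w, lin t w ∈ LinearMap.range (lin f) := fun w =>
    (h.exact _).1 (lin_apply_eq_zero_of_comp ht w)
  have key : ∀ w, lin f ((LinearEquiv.ofInjective (lin f) h.injective).symm ⟨lin t w, hr w⟩) =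
      lin t w := fun w => congrArg Subtype.val
    ((LinearEquiv.ofInjective (lin f) h.injective).apply_symm_apply ⟨lin t w, hr w⟩)
  refine ⟨mkHom ((LinearEquiv.ofInjective (lin f) h.injective).symm.toLinearMap ∘ₗ
    (lin t).codRestrict (LinearMap.range (lin f)) hr) ?_, hom_ext key⟩
  intro i x hx
  set y : X := (LinearEquiv.ofInjective (lin f) h.injective).symm ⟨lin t x, hr x⟩
  change y ∈ X.gr i
  have h1 : lin f (X.proj i y) = lin f y := by
    rw [lin_proj, key x]
    exact Y.proj_of_mem (lin_mem t hx)
  rw [← h.injective h1]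
  exact X.proj_mem i y

theorem shortExact (h : IsSES f g) : (ShortComplex.mk f g h.zero).ShortExact := by
  have hf := mono_of_injective f h.injective
  have hg := epi_of_surjective g h.surjective
  refine ShortComplex.ShortExact.mk' (ShortComplex.exact_of_f_is_kernel _ ?_) hf hg
  refine KernelFork.IsLimit.ofι' _ _ fun t ht => ⟨(h.exists_lift t ht).choose, ?_⟩
  exact (h.exists_lift t ht).choose_spec

theorem exists_desc (h : IsSES f g) (t : Y ⟶ W) (ht : f ≫ t = 0) : ∃ s : Z ⟶ W, g ≫ s = t := by
  have := h.shortExact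
  have := this.epi_g
  exact ⟨h.shortExact.exact.desc t ht, h.shortExact.exact.g_desc t ht⟩

end IsSES

theorem GSub.isSES {M : GMod 𝒜} (N : GSub M) : IsSES N.incl N.proj where
  injective := N.lin_incl_injective
  surjective := N.lin_proj_surjective
  exact y := ⟨fun hy => ⟨(⟨y, (Submodule.Quotient.mk_eq_zero _).1 hy⟩ : N.toSubmodule), rfl⟩, by
    rintro ⟨x, rfl⟩
    exact (Submodule.Quotient.mk_eq_zero _).2 x.2⟩

theorem isSES_kerSub {M N : GMod 𝒜} (f : M ⟶ N) (hf : Function.Surjective (lin f)) :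
    IsSES (kerSub f).incl f where
  injective := (kerSub f).lin_incl_injective
  surjective := hf
  exact y := ⟨fun hy => ⟨(⟨y, hy⟩ : (kerSub f).toSubmodule), rfl⟩, by
    rintro ⟨x, rfl⟩
    exact x.2⟩

/-- The inclusion between graded submodules. -/
noncomputable def GSub.inclusion {M : GMod 𝒜} {N' N : GSub M} (h : N' ≤ N) : N'.obj ⟶ N.obj :=
  N.lift N'.incl fun x => h x.2

/-- The projection `N ⟶ N / N'`. -/
noncomputable def GSub.subquotProj {M : GMod 𝒜} (N N' : GSub M) : N.obj ⟶ N.subquot N' :=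
  GSub.proj _

theorem GSub.subquotProj_surjective {M : GMod 𝒜} (N N' : GSub M) :
    Function.Surjective (lin (N.subquotProj N')) := GSub.lin_proj_surjective _

theorem GSub.subquotProj_eq_zero {M : GMod 𝒜} (N N' : GSub M) (x : N.toSubmodule) :
    lin (N.subquotProj N') (show N.obj from x) = 0 ↔ x.1 ∈ N'.toSubmodule :=
  Submodule.Quotient.mk_eq_zero _

theorem GSub.isSES_subquot {M : GMod 𝒜} {N' N : GSub M} (h : N' ≤ N) :
    IsSES (GSub.inclusion h) (N.subquotProj N') where
  injective x y hxy := Subtype.ext (congrArg (fun z : N.toSubmodule => z.1) hxy)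
  surjective := N.subquotProj_surjective N'
  exact y := by
    refine (GSub.subquotProj_eq_zero N N' y).trans ⟨fun hy => ⟨(⟨y.1, hy⟩ : N'.toSubmodule), rfl⟩, ?_⟩
    rintro ⟨x, rfl⟩
    exact x.2

/-- Two surjections with the same kernel have isomorphic targets. -/
theorem nonempty_iso_of_ker_eq {M X Y : GMod 𝒜} (f : M ⟶ X) (g : M ⟶ Y)
    (hf : Function.Surjective (lin f)) (hg : Function.Surjective (lin g))
    (h : ∀ x, lin f x = 0 ↔ lin g x = 0) : Nonempty (X ≅ Y) := by
  obtain ⟨s, hs⟩ := (isSES_kerSub f hf).exists_desc g (hom_ext fun x => (h _).1 x.2)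
  have hs' : ∀ x, lin s (lin f x) = lin g x := fun x => congrArg (fun t => lin t x) hs
  refine ⟨isoOfBijective s ⟨?_, fun y => ?_⟩⟩
  · refine (injective_iff_map_eq_zero (lin s)).2 fun y hy => ?_
    obtain ⟨x, rfl⟩ := hf y
    rw [hs'] at hy
    exact (h x).2 hy
  · obtain ⟨x, rfl⟩ := hg y
    exact ⟨lin f x, hs' x⟩

/-- The isomorphism of the whole module, as a graded submodule, with the module. -/
theorem nonempty_top_iso (M : GMod 𝒜) : Nonempty ((⊤ : GSub M).obj ≅ M) :=
  ⟨isoOfBijective (⊤ : GSub M).incl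
    ⟨(⊤ : GSub M).lin_incl_injective, fun x => ⟨(⟨x, trivial⟩ : (⊤ : Submodule A M)), rfl⟩⟩⟩

/-! ### Shifts -/

/-- The identity map, as an isomorphism of the underlying modules of `M` and `M⟨j⟩`. -/
def sh (M : GMod 𝒜) (j : ℤ) : M ≃ₗ[A] M.shift j := LinearEquiv.refl A M

theorem sh_mem {M : GMod 𝒜} {i j : ℤ} {x : M} :
    M.sh j x ∈ (M.shift j).gr i ↔ x ∈ M.gr (j + i) := Iff.rfl

/-- The shift of a morphism. -/
def shiftHom {M N : GMod 𝒜} (f : M ⟶ N) (j : ℤ) : M.shift j ⟶ N.shift j :=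
  mkHom (M := M.shift j) (N := N.shift j) (lin f : M →ₗ[A] N) (fun _ _ hx => lin_mem f hx)

theorem IsSES.shift {X Y Z : GMod 𝒜} {f : X ⟶ Y} {g : Y ⟶ Z} (h : IsSES f g) (j : ℤ) :
    IsSES (shiftHom f j) (shiftHom g j) where
  injective := h.injective
  surjective := h.surjective
  exact := h.exact

/-- The shift of an isomorphism. -/
def shiftIso {M N : GMod 𝒜} (i : M ≅ N) (j : ℤ) : M.shift j ≅ N.shift j where
  hom := shiftHom i.hom j
  inv := shiftHom i.inv j
  hom_inv_id := hom_ext fun x => lin_inv_hom i x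
  inv_hom_id := hom_ext fun x => lin_hom_inv i x

/-- `M⟨i⟩⟨j⟩ = M⟨i + j⟩`. -/
def shiftShiftIso (M : GMod 𝒜) (i j : ℤ) : (M.shift i).shift j ≅ M.shift (i + j) where
  hom := mkHom (M := (M.shift i).shift j) (N := M.shift (i + j)) LinearMap.id
    (fun n x (hx : x ∈ M.gr (i + (j + n))) => show x ∈ M.gr (i + j + n) by rwa [add_assoc])
  inv := mkHom (M := M.shift (i + j)) (N := (M.shift i).shift j) LinearMap.id
    (fun n x (hx : x ∈ M.gr (i + j + n)) => show x ∈ M.gr (i + (j + n)) by rwa [← add_assoc])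
  hom_inv_id := rfl
  inv_hom_id := rfl

/-! ### Vanishing of `Ext` -/

open Abelian

theorem subsingleton_ext_of_iso_left {X X' Y : GMod 𝒜} (i : X ≅ X') {n : ℕ}
    (h : Subsingleton (Ext X Y n)) : Subsingleton (Ext X' Y n) := by
  refine subsingleton_of_forall_eq 0 fun x => ?_
  have : x = (Ext.mk₀ i.inv).comp ((Ext.mk₀ i.hom).comp x (zero_add n)) (zero_add n) := by simp
  rw [this, Subsingleton.elim ((Ext.mk₀ i.hom).comp x (zero_add n)) 0, Ext.comp_zero]

theorem subsingleton_ext_of_iso_right {X Y Y' : GMod 𝒜} (i : Y ≅ Y') {n : ℕ}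
    (h : Subsingleton (Ext X Y n)) : Subsingleton (Ext X Y' n) := by
  refine subsingleton_of_forall_eq 0 fun x => ?_
  have : x = (x.comp (Ext.mk₀ i.inv) (add_zero n)).comp (Ext.mk₀ i.hom) (add_zero n) := by simp
  rw [this, Subsingleton.elim (x.comp (Ext.mk₀ i.inv) (add_zero n)) 0, Ext.zero_comp]

theorem isZero_of_subsingleton (X : GMod 𝒜) (h : ∀ x : X, x = 0) : IsZero X := by
  rw [IsZero.iff_id_eq_zero]
  exact hom_ext fun x => by simp [h x]

theorem subsingleton_ext_of_isZero_left {X Y : GMod 𝒜} (hX : IsZero X) (n : ℕ) :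
    Subsingleton (Ext X Y n) := by
  refine subsingleton_of_forall_eq 0 fun x => ?_
  rw [← Ext.mk₀_id_comp x, hX.eq_of_src (𝟙 X) 0, Ext.mk₀_zero, Ext.zero_comp]

theorem subsingleton_ext_of_isZero_right {X Y : GMod 𝒜} (hY : IsZero Y) (n : ℕ) :
    Subsingleton (Ext X Y n) := by
  refine subsingleton_of_forall_eq 0 fun x => ?_
  rw [← Ext.comp_mk₀_id x, hY.eq_of_src (𝟙 Y) 0, Ext.mk₀_zero, Ext.comp_zero]

theorem subsingleton_ext_zero {X Y : GMod 𝒜} (h : ∀ f : X ⟶ Y, f = 0) :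
    Subsingleton (Ext X Y 0) := by
  refine subsingleton_of_forall_eq 0 fun x => ?_
  obtain ⟨f, rfl⟩ := (Ext.mk₀_bijective X Y).2 x
  rw [h f, Ext.mk₀_zero]

namespace IsSES

variable {X Y Z W : GMod 𝒜} {f : X ⟶ Y} {g : Y ⟶ Z} {n : ℕ}

theorem ext_mid_left (h : IsSES f g) (h1 : Subsingleton (Ext X W n))
    (h3 : Subsingleton (Ext Z W n)) : Subsingleton (Ext Y W n) := by
  refine subsingleton_of_forall_eq 0 fun x => ?_
  obtain ⟨y, hy⟩ := Ext.contravariant_sequence_exact₂ h.shortExact W x (Subsingleton.elim _ _)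
  rw [← hy, Subsingleton.elim y 0, Ext.comp_zero]

theorem ext_mid_right (h : IsSES f g) (h1 : Subsingleton (Ext W X n))
    (h3 : Subsingleton (Ext W Z n)) : Subsingleton (Ext W Y n) := by
  refine subsingleton_of_forall_eq 0 fun x => ?_
  obtain ⟨y, hy⟩ := Ext.covariant_sequence_exact₂ W h.shortExact x (Subsingleton.elim _ _)
  rw [← hy, Subsingleton.elim y 0, Ext.zero_comp]

theorem ext_sub_left (h : IsSES f g) (h2 : Subsingleton (Ext Y W n))
    (h3 : Subsingleton (Ext Z W (n + 1))) : Subsingleton (Ext X W n) := by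
  refine subsingleton_of_forall_eq 0 fun x => ?_
  obtain ⟨y, hy⟩ := Ext.contravariant_sequence_exact₁ h.shortExact W x (add_comm 1 n)
    (Subsingleton.elim _ _)
  rw [← hy, Subsingleton.elim y 0, Ext.comp_zero]

theorem ext_quot_left (h : IsSES f g) (h1 : Subsingleton (Ext X W n))
    (h2 : Subsingleton (Ext Y W (n + 1))) : Subsingleton (Ext Z W (n + 1)) := by
  refine subsingleton_of_forall_eq 0 fun x => ?_
  obtain ⟨y, hy⟩ := Ext.contravariant_sequence_exact₃ h.shortExact W x
    (Subsingleton.elim _ _) (add_comm 1 n)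
  rw [← hy, Subsingleton.elim y 0, Ext.comp_zero]

/-- Extending all morphisms makes the connecting map `Hom(X, W) → ext¹(Z, W)` zero, while exactness
makes it surjective once `ext¹(Y, W)` vanishes. -/
theorem ext_one_quot_left (h : IsSES f g) (h1 : ∀ t : X ⟶ W, ∃ s : Y ⟶ W, f ≫ s = t)
    (h2 : Subsingleton (Ext Y W 1)) : Subsingleton (Ext Z W 1) := by
  refine subsingleton_of_forall_eq 0 fun x => ?_
  obtain ⟨y, hy⟩ := Ext.contravariant_sequence_exact₃ h.shortExact W x
    (Subsingleton.elim _ _) (add_comm 1 0)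
  obtain ⟨t, rfl⟩ := (Ext.mk₀_bijective _ _).2 y
  obtain ⟨s, rfl⟩ := h1 t
  rw [← hy, ← Ext.mk₀_comp_mk₀]
  exact h.shortExact.extClass_comp_assoc _

/-- The dual argument: the connecting map `Hom(W, Z) → ext¹(W, X)` is both zero and surjective. -/
theorem ext_one_sub_right (h : IsSES f g) (h1 : ∀ t : W ⟶ Z, ∃ s : W ⟶ Y, s ≫ g = t)
    (h2 : Subsingleton (Ext W Y 1)) : Subsingleton (Ext W X 1) := by
  refine subsingleton_of_forall_eq 0 fun x => ?_
  obtain ⟨y, hy⟩ := Ext.covariant_sequence_exact₁ W h.shortExact x (Subsingleton.elim _ _)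
    (zero_add 1)
  obtain ⟨t, rfl⟩ := (Ext.mk₀_bijective _ _).2 y
  obtain ⟨s, rfl⟩ := h1 t
  rw [← hy, ← Ext.mk₀_comp_mk₀, Ext.comp_assoc_of_second_deg_zero]
  exact (congrArg (fun z => (Ext.mk₀ s).comp z (zero_add 1)) h.shortExact.comp_extClass).trans
    (Ext.comp_zero _ _ _ _ _)

theorem exists_extension (h : IsSES f g) (h1 : Subsingleton (Ext Z W 1)) (t : X ⟶ W) :
    ∃ s : Y ⟶ W, f ≫ s = t := by
  obtain ⟨y, hy⟩ := Ext.contravariant_sequence_exact₁ h.shortExact W (Ext.mk₀ t) (add_comm 1 0)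
    (Subsingleton.elim _ _)
  obtain ⟨s, rfl⟩ := (Ext.mk₀_bijective _ _).2 y
  exact ⟨s, (Ext.mk₀_bijective _ _).1 (by rw [← hy, ← Ext.mk₀_comp_mk₀])⟩

theorem exists_lifting (h : IsSES f g) (h1 : Subsingleton (Ext W X 1)) (t : W ⟶ Z) :
    ∃ s : W ⟶ Y, s ≫ g = t := by
  obtain ⟨y, hy⟩ := Ext.covariant_sequence_exact₃ W h.shortExact (Ext.mk₀ t) (zero_add 1)
    (Subsingleton.elim _ _)
  obtain ⟨s, rfl⟩ := (Ext.mk₀_bijective _ _).2 y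
  exact ⟨s, (Ext.mk₀_bijective _ _).1 (by rw [← hy, ← Ext.mk₀_comp_mk₀])⟩

end IsSES

/-! ### Induction along filtrations -/

theorem eq_zero_of_bot {M : GMod 𝒜} (x : (⊥ : GSub M).obj) : x = 0 :=
  Subtype.ext ((Submodule.mem_bot A).1 x.2)

/-- Induction along a finite filtration, for a property stable under extensions. -/
theorem filtration_induction {R : GMod 𝒜 → Prop}
    (hext : ∀ (X Y Z : GMod 𝒜) (f : X ⟶ Y) (g : Y ⟶ Z), IsSES f g → R X → R Z → R Y)
    {M : GMod 𝒜} (F : ℕ → GSub M) (n : ℕ)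
    (hF : ∀ i < n, F (i + 1) ≤ F i ∧ R ((F i).subquot (F (i + 1)))) (hn : R (F n).obj) :
    R (F 0).obj := by
  have : ∀ i ≤ n, R (F (n - i)).obj := by
    intro i
    induction i with
    | zero => intro _; exact hn
    | succ i ih =>
      intro hi
      have h1 := hF (n - (i + 1)) (by omega)
      have e : n - (i + 1) + 1 = n - i := by omega
      rw [e] at h1
      exact hext _ _ _ _ _ (GSub.isSES_subquot h1.1) (ih (by omega)) h1.2
  simpa using this n le_rfl

theorem HasFiniteFiltration.induction {Q R : GMod 𝒜 → Prop}
    (h0 : ∀ X : GMod 𝒜, (∀ x : X, x = 0) → R X)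
    (hext : ∀ (X Y Z : GMod 𝒜) (f : X ⟶ Y) (g : Y ⟶ Z), IsSES f g → R X → R Z → R Y)
    (hQ : ∀ X, Q X → R X) {M : GMod 𝒜} (hM : HasFiniteFiltration Q M) : R M := by
  obtain ⟨n, F, hF0, hFn, hF⟩ := hM
  have h1 := filtration_induction hext F n (fun i hi => ⟨(hF i hi).1, hQ _ (hF i hi).2⟩)
    (by rw [hFn]; exact h0 _ eq_zero_of_bot)
  rw [hF0] at h1
  -- `R` is not assumed invariant under isomorphism. The passage from `⊤` to `M` is instead an
  -- extension by zero.
  have h2 : IsSES (X := (⊤ : GSub M).obj) (Z := (⊥ : GSub M).obj) (⊤ : GSub M).incl 0 :=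
    { injective := (⊤ : GSub M).lin_incl_injective
      surjective := fun y => ⟨0, by rw [eq_zero_of_bot y, map_zero]⟩
      exact := fun y => ⟨fun _ => ⟨(⟨y, trivial⟩ : (⊤ : Submodule A M)), rfl⟩, fun _ => rfl⟩ }
  exact hext _ _ _ _ _ h2 h1 (h0 _ eq_zero_of_bot)

end General

end GMod

/-! ### Homogeneous elements and factorization of morphisms -/

namespace GMod

section General

variable {k A : Type u} [Field k] [Ring A] [Algebra k A] {𝒜 : ℤ → Submodule k A}

/-- Induction on the homogeneous components. -/
theorem induction_on (M : GMod 𝒜) {p : M → Prop} (x : M)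
    (hom : ∀ i, ∀ x ∈ M.gr i, p x) (zero : p 0) (add : ∀ x y, p x → p y → p (x + y)) : p x := by
  have hx : x ∈ ⨆ i, M.gr i := by rw [M.iSup_eq_top]; trivial
  induction hx using Submodule.iSup_induction' with
  | mem i x hx => exact hom i x hx
  | zero => exact zero
  | add x y _ _ hx hy => exact add x y hx hy

theorem proj_smul (M : GMod 𝒜) {i : ℤ} {a : A} (ha : a ∈ 𝒜 i) (n : ℤ) (x : M) :
    M.proj (i + n) (a • x) = a • M.proj n x := by
  induction x using M.induction_on with
  | hom d x hx =>
    by_cases hd : d = n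
    · subst hd
      rw [M.proj_of_mem hx, M.proj_of_mem (M.smul_mem _ _ _ _ ha hx)]
    · rw [M.proj_of_ne hx hd, M.proj_of_ne (M.smul_mem _ _ _ _ ha hx) (by omega), smul_zero]
  | zero => simp
  | add x y hx hy => rw [smul_add, map_add, map_add, smul_add, hx, hy]

theorem exists_homogeneous_preimage {M N : GMod 𝒜} (f : M ⟶ N)
    (hf : Function.Surjective (lin f)) {i : ℤ} {y : N} (hy : y ∈ N.gr i) :
    ∃ x ∈ M.gr i, lin f x = y := by
  obtain ⟨x, rfl⟩ := hf y
  exact ⟨M.proj i x, M.proj_mem i x, by rw [lin_proj, N.proj_of_mem hy]⟩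

theorem eq_zero_of_proj (M : GMod 𝒜) {x : M} (h : ∀ i, M.proj i x = 0) : x = 0 := by
  obtain ⟨s, hs⟩ := M.exists_sum_proj x
  rw [hs]
  exact Finset.sum_eq_zero fun i _ => h i

theorem lin_base_smul {M N : GMod 𝒜} (f : M ⟶ N) (c : k) (x : M) :
    lin f (c • x) = c • lin f x := by
  rw [← algebraMap_smul A c x, map_smul, algebraMap_smul]

/-- Factorization of a morphism through a monomorphism containing its image. -/
theorem exists_factor {M N X : GMod 𝒜} (i : N ⟶ X) (hi : Function.Injective (lin i)) (F : M ⟶ X)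
    (hF : ∀ x, ∃ z, lin i z = lin F x) : ∃ G : M ⟶ N, G ≫ i = F := by
  have hS : IsSES i (rangeSub i).proj :=
    { injective := hi
      surjective := (rangeSub i).lin_proj_surjective
      exact := fun y => Submodule.Quotient.mk_eq_zero _ }
  exact hS.exists_lift F (hom_ext fun x => (Submodule.Quotient.mk_eq_zero _).2 (hF x))

end General

end GMod

namespace IsPositivelyGraded

open GMod

variable {k A : Type u} [Field k] [Ring A] [Algebra k A]
  {𝒜 : ℤ → Submodule k A} {Λ : Type v} {e : Λ → A}

/-! ### The idempotents -/

theorem idem_mul_self (h : IsPositivelyGraded 𝒜 e) (l : Λ) : e l * e l = e l :=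
  h.orthogonal.idem l

theorem idem_mul_of_ne (h : IsPositivelyGraded 𝒜 e) {l m : Λ} (hlm : l ≠ m) : e l * e m = 0 :=
  h.orthogonal.ortho hlm

theorem idem_smul_self (h : IsPositivelyGraded 𝒜 e) {M : GMod 𝒜} (l : Λ) (x : M) :
    e l • e l • x = e l • x := by
  rw [smul_smul, h.idem_mul_self]

theorem idem_smul_of_ne (h : IsPositivelyGraded 𝒜 e) {M : GMod 𝒜} {l m : Λ} (hlm : l ≠ m)
    (x : M) : e l • e m • x = 0 := by
  rw [smul_smul, h.idem_mul_of_ne hlm, zero_smul]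

theorem idem_smul_mem (h : IsPositivelyGraded 𝒜 e) {M : GMod 𝒜} (l : Λ) {i : ℤ} {x : M}
    (hx : x ∈ M.gr i) : e l • x ∈ M.gr i := by
  simpa using M.smul_mem 0 i _ x (h.idem_mem l) hx

theorem proj_idem_smul (h : IsPositivelyGraded 𝒜 e) {M : GMod 𝒜} (l : Λ) (i : ℤ) (x : M) :
    M.proj i (e l • x) = e l • M.proj i x := by
  simpa using M.proj_smul (h.idem_mem l) i x

theorem lin_idem {M N : GMod 𝒜} (f : M ⟶ N) (l : Λ) (x : M) (hx : e l • x = x) :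
    e l • lin f x = lin f x := by
  rw [← map_smul, hx]

variable [GradedAlgebra 𝒜]

theorem sum_idem [Fintype Λ] (h : IsPositivelyGraded 𝒜 e) : ∑ l, e l = 1 := by
  classical
  have h1 : (1 : A) ∈ Submodule.span k (Set.range e) := by
    rw [h.span_eq]; exact SetLike.one_mem_graded 𝒜
  obtain ⟨c, hc⟩ := (Submodule.mem_span_range_iff_exists_fun k).1 h1
  rw [← hc]
  refine Finset.sum_congr rfl fun l _ => ?_
  have h2 : e l * ∑ i, c i • e i = e l := by rw [hc, mul_one]
  rw [Finset.mul_sum, Finset.sum_eq_single l] at h2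
  · rw [mul_smul_comm, h.idem_mul_self] at h2
    exact h2.symm
  · intro m _ hm
    rw [mul_smul_comm, h.idem_mul_of_ne hm.symm, smul_zero]
  · simp

theorem mem_of_idem_smul_mem [Finite Λ] (h : IsPositivelyGraded 𝒜 e) {M : GMod 𝒜}
    (S : AddSubmonoid M) {x : M} (hx : ∀ l, e l • x ∈ S) : x ∈ S := by
  cases nonempty_fintype Λ
  rw [← one_smul A x, ← h.sum_idem, Finset.sum_smul]
  exact sum_mem fun l _ => hx l

theorem eq_zero_of_idem_smul [Finite Λ] (h : IsPositivelyGraded 𝒜 e) {M : GMod 𝒜} {x : M}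
    (hx : ∀ l, e l • x = 0) : x = 0 :=
  h.mem_of_idem_smul_mem (⊥ : AddSubmonoid M) hx

theorem induction_homogeneous {p : A → Prop} (a : A)
    (hom : ∀ i, ∀ a ∈ 𝒜 i, p a) (zero : p 0) (add : ∀ a b, p a → p b → p (a + b)) : p a := by
  classical
  rw [← DirectSum.sum_support_decompose 𝒜 a]
  exact Finset.sum_induction _ p add zero fun i _ => hom i _ (SetLike.coe_mem _)

/-- To check an additive property of `a`, it suffices to treat the idempotents and the homogeneous
elements of positive degree. -/
theorem induction_algebra (h : IsPositivelyGraded 𝒜 e) {p : A → Prop} (a : A)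
    (pos : ∀ i > 0, ∀ a ∈ 𝒜 i, p a) (idem : ∀ (c : k) l, p (c • e l)) (zero : p 0)
    (add : ∀ a b, p a → p b → p (a + b)) : p a := by
  induction a using induction_homogeneous (𝒜 := 𝒜) with
  | hom i a ha =>
    rcases lt_trichotomy i 0 with hi | rfl | hi
    · rw [h.eq_bot i hi, Submodule.mem_bot] at ha
      rw [ha]; exact zero
    · rw [← h.span_eq] at ha
      induction ha using Submodule.span_induction with
      | mem x hx =>
        obtain ⟨l, rfl⟩ := hx
        simpa using idem 1 l
      | zero => exact zero
      | add x y _ _ hx hy => exact add x y hx hy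
      | smul c x hx hpx =>
        obtain ⟨f, rfl⟩ := (Finsupp.mem_span_range_iff_exists_finsupp).1 hx
        rw [Finsupp.smul_sum]
        exact Finset.sum_induction _ p add zero fun l _ => by
          change p (c • f l • e l)
          rw [smul_smul]
          exact idem _ l
    · exact pos i hi a ha
  | zero => exact zero
  | add a b ha hb => exact add a b ha hb

/-! ### The projective modules -/

/-- The generator `e_λ` of `P(λ)`. -/
def gen (h : IsPositivelyGraded 𝒜 e) (l : Λ) : h.P l :=
  (⟨e l, ⟨(1 : A), one_mul (e l)⟩⟩ : LinearMap.range (LinearMap.toSpanSingleton A A (e l)))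

/-- The underlying element of `A`. -/
def coeff (h : IsPositivelyGraded 𝒜 e) {l : Λ} (y : h.P l) : A :=
  (show LinearMap.range (LinearMap.toSpanSingleton A A (e l)) from y).1

theorem coeff_smul_gen (h : IsPositivelyGraded 𝒜 e) {l : Λ} (y : h.P l) :
    h.coeff y • h.gen l = y := by
  obtain ⟨_, a, rfl⟩ := y
  refine Subtype.ext ?_
  let b : A := a
  change b * e l * e l = b * e l
  rw [mul_assoc, h.idem_mul_self]

theorem gen_mem (h : IsPositivelyGraded 𝒜 e) (l : Λ) : h.gen l ∈ (h.P l).gr 0 :=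
  h.idem_mem l

theorem idem_smul_gen (h : IsPositivelyGraded 𝒜 e) (l : Λ) : e l • h.gen l = h.gen l :=
  Subtype.ext (h.idem_mul_self l)

theorem coeff_mem (h : IsPositivelyGraded 𝒜 e) {l : Λ} {i : ℤ} {y : h.P l}
    (hy : y ∈ (h.P l).gr i) : h.coeff y ∈ 𝒜 i := hy

/-- The morphism `P(λ)⟨j⟩ ⟶ M` sending the generator to `e_λ x`. -/
noncomputable def liftP (h : IsPositivelyGraded 𝒜 e) (l : Λ) {M : GMod 𝒜} {j : ℤ} (x : M)
    (hx : x ∈ M.gr (-j)) : (h.P l).shift j ⟶ M :=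
  mkHom (M := (h.P l).shift j)
    ((LinearMap.toSpanSingleton A M x).comp
      (LinearMap.range (LinearMap.toSpanSingleton A A (e l))).subtype)
    (fun i y hy => by
      have := M.smul_mem _ _ _ _ (show h.coeff y ∈ 𝒜 (j + i) from hy) hx
      rwa [show j + i + -j = i by ring] at this)

/-- The generator of `P(λ)⟨j⟩`. -/
noncomputable def genP (h : IsPositivelyGraded 𝒜 e) (l : Λ) (j : ℤ) : (h.P l).shift j := (h.P l).sh j (h.gen l)

theorem genP_mem (h : IsPositivelyGraded 𝒜 e) (l : Λ) (j : ℤ) :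
    h.genP l j ∈ ((h.P l).shift j).gr (-j) := by
  rw [genP, sh_mem, add_neg_cancel]
  exact h.gen_mem l

theorem idem_smul_genP (h : IsPositivelyGraded 𝒜 e) (l : Λ) (j : ℤ) :
    e l • h.genP l j = h.genP l j := by
  rw [genP, ← map_smul, h.idem_smul_gen]

theorem exists_smul_genP (h : IsPositivelyGraded 𝒜 e) {l : Λ} {j : ℤ} (y : (h.P l).shift j) :
    ∃ a : A, a • h.genP l j = y :=
  ⟨h.coeff (((h.P l).sh j).symm y), h.coeff_smul_gen (((h.P l).sh j).symm y)⟩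

theorem liftP_genP (h : IsPositivelyGraded 𝒜 e) (l : Λ) {M : GMod 𝒜} {j : ℤ} (x : M)
    (hx : x ∈ M.gr (-j)) : lin (h.liftP l x hx) (h.genP l j) = e l • x := rfl

theorem hom_P_ext (h : IsPositivelyGraded 𝒜 e) {l : Λ} {M : GMod 𝒜} {j : ℤ}
    {f g : (h.P l).shift j ⟶ M} (hfg : lin f (h.genP l j) = lin g (h.genP l j)) : f = g :=
  hom_ext fun y => by
    obtain ⟨a, rfl⟩ := h.exists_smul_genP y
    rw [map_smul, map_smul, hfg]

theorem hom_P_gen_mem (h : IsPositivelyGraded 𝒜 e) {l : Λ} {M : GMod 𝒜} {j : ℤ}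
    (f : (h.P l).shift j ⟶ M) : lin f (h.genP l j) ∈ M.gr (-j) :=
  lin_mem f (h.genP_mem l j)

theorem hom_P_gen_idem (h : IsPositivelyGraded 𝒜 e) {l : Λ} {M : GMod 𝒜} {j : ℤ}
    (f : (h.P l).shift j ⟶ M) : e l • lin f (h.genP l j) = lin f (h.genP l j) :=
  lin_idem f l _ (h.idem_smul_genP l j)

instance projective_P (h : IsPositivelyGraded 𝒜 e) (l : Λ) (j : ℤ) :
    Projective ((h.P l).shift j) where
  factors {E X} f g _ := by
    obtain ⟨x, hx, hxy⟩ := exists_homogeneous_preimage g (surjective_of_epi g) (h.hom_P_gen_mem f)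
    refine ⟨h.liftP l x hx, h.hom_P_ext ?_⟩
    rw [lin_comp_apply, liftP_genP, map_smul, hxy, hom_P_gen_idem]

/-- Each homogeneous vector `e_λ y` is the image of the generator of some `P(λ)⟨j⟩`, and such
vectors span because the idempotents sum to `1`. -/
theorem surjective_of_lift_P [Finite Λ] (h : IsPositivelyGraded 𝒜 e) {M N : GMod 𝒜} (f : M ⟶ N)
    (hf : ∀ (l : Λ) (j : ℤ) (g : (h.P l).shift j ⟶ N), ∃ g', g' ≫ f = g) :
    Function.Surjective (lin f) := by
  intro y
  change y ∈ (LinearMap.range (lin f)).toAddSubmonoid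
  refine h.mem_of_idem_smul_mem _ fun l => ?_
  induction y using N.induction_on with
  | hom i y hy =>
    obtain ⟨g', hg'⟩ := hf l (-i) (h.liftP l y (by rwa [neg_neg]))
    refine ⟨lin g' (h.genP l (-i)), ?_⟩
    rw [← lin_comp_apply, hg', liftP_genP]
  | zero => rw [smul_zero]; exact zero_mem _
  | add x y hx hy => rw [smul_add]; exact add_mem hx hy

/-! ### Standard modules -/

variable [Preorder Λ]

theorem idem_smul_mem_K (h : IsPositivelyGraded 𝒜 e) {l m : Λ} (hlm : l < m) (y : h.P l) :
    e m • y ∈ (h.K l).toSubmodule := by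
  induction y using (h.P l).induction_on with
  | hom i y hy =>
    have : (rangeSub (h.liftP m (j := -i) y (by rwa [neg_neg]))).toSubmodule ≤
        (h.K l).toSubmodule := by
      refine le_iSup_of_le ⟨_, m, -i, _, hlm, rfl⟩ le_rfl
    exact this ⟨h.genP m (-i), h.liftP_genP m _ _⟩
  | zero => rw [smul_zero]; exact zero_mem _
  | add x y hx hy => rw [smul_add]; exact add_mem hx hy

/-- A morphism out of `P(m)⟨i⟩` is determined by one vector of weight `m`. Hence the trace defining
`K(l)` is generated by the vectors of weight `m ≻ l`, a description without morphisms that later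
arguments use. -/
theorem K_le (h : IsPositivelyGraded 𝒜 e) {l : Λ} {N : Submodule A (h.P l)}
    (hN : ∀ m, l < m → ∀ y : h.P l, e m • y ∈ N) : (h.K l).toSubmodule ≤ N := by
  refine iSup_le ?_
  rintro ⟨_, m, i, f, hlm, rfl⟩ _ ⟨y, rfl⟩
  obtain ⟨a, rfl⟩ := h.exists_smul_genP (l := m) (j := i) y
  rw [map_smul, ← h.hom_P_gen_idem f]
  exact N.smul_mem _ (hN m hlm _)

/-- The projection `P(λ) ⟶ Δ(λ)`. -/
noncomputable def toStandard (h : IsPositivelyGraded 𝒜 e) (l : Λ) : h.P l ⟶ h.standard l :=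
  (h.K l).proj

theorem toStandard_surjective (h : IsPositivelyGraded 𝒜 e) (l : Λ) :
    Function.Surjective (lin (h.toStandard l)) := (h.K l).lin_proj_surjective

theorem toStandard_eq_zero (h : IsPositivelyGraded 𝒜 e) {l : Λ} (x : h.P l) :
    lin (h.toStandard l) x = 0 ↔ x ∈ (h.K l).toSubmodule := Submodule.Quotient.mk_eq_zero _

/-- The sequence `0 ⟶ K(λ)⟨j⟩ ⟶ P(λ)⟨j⟩ ⟶ Δ(λ)⟨j⟩ ⟶ 0`. -/
theorem isSES_standard (h : IsPositivelyGraded 𝒜 e) (l : Λ) (j : ℤ) :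
    IsSES (shiftHom (h.K l).incl j) (shiftHom (h.toStandard l) j) :=
  IsSES.shift (g := h.toStandard l) (h.K l).isSES j

/-- The generator of `Δ(λ)⟨j⟩`. -/
noncomputable def genΔ (h : IsPositivelyGraded 𝒜 e) (l : Λ) (j : ℤ) : (h.standard l).shift j :=
  lin (shiftHom (h.toStandard l) j) (h.genP l j)

theorem genΔ_mem (h : IsPositivelyGraded 𝒜 e) (l : Λ) (j : ℤ) :
    h.genΔ l j ∈ ((h.standard l).shift j).gr (-j) :=
  lin_mem _ (h.genP_mem l j)

theorem idem_smul_genΔ (h : IsPositivelyGraded 𝒜 e) (l : Λ) (j : ℤ) :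
    e l • h.genΔ l j = h.genΔ l j :=
  lin_idem _ l _ (h.idem_smul_genP l j)

theorem exists_smul_genΔ (h : IsPositivelyGraded 𝒜 e) {l : Λ} {j : ℤ}
    (y : (h.standard l).shift j) : ∃ a : A, a • h.genΔ l j = y := by
  obtain ⟨x, rfl⟩ := (h.isSES_standard l j).surjective y
  obtain ⟨a, rfl⟩ := h.exists_smul_genP x
  exact ⟨a, by rw [genΔ, ← map_smul]⟩

theorem idem_smul_standard (h : IsPositivelyGraded 𝒜 e) {l m : Λ} (hlm : l < m) {j : ℤ}
    (y : (h.standard l).shift j) : e m • y = 0 := by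
  obtain ⟨x, rfl⟩ := (h.isSES_standard l j).surjective y
  exact (Submodule.Quotient.mk_eq_zero _).2 (h.idem_smul_mem_K hlm x)

theorem hom_standard_ext (h : IsPositivelyGraded 𝒜 e) {l : Λ} {M : GMod 𝒜} {j : ℤ}
    {f g : (h.standard l).shift j ⟶ M} (hfg : lin f (h.genΔ l j) = lin g (h.genΔ l j)) : f = g :=
  hom_ext fun y => by
    obtain ⟨a, rfl⟩ := h.exists_smul_genΔ y
    rw [map_smul, map_smul, hfg]

theorem hom_standard_gen_mem (h : IsPositivelyGraded 𝒜 e) {l : Λ} {M : GMod 𝒜} {j : ℤ}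
    (f : (h.standard l).shift j ⟶ M) : lin f (h.genΔ l j) ∈ M.gr (-j) :=
  lin_mem f (h.genΔ_mem l j)

theorem hom_standard_gen_idem (h : IsPositivelyGraded 𝒜 e) {l : Λ} {M : GMod 𝒜} {j : ℤ}
    (f : (h.standard l).shift j ⟶ M) : e l • lin f (h.genΔ l j) = lin f (h.genΔ l j) :=
  lin_idem f l _ (h.idem_smul_genΔ l j)

/-- If `M` has no weight above `l`, the morphism from `P(l)⟨j⟩` kills the generators of `K(l)`, so
it descends. -/
theorem exists_lift_standard (h : IsPositivelyGraded 𝒜 e) (l : Λ) {M : GMod 𝒜} {j : ℤ} (x : M)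
    (hx : x ∈ M.gr (-j)) (hl : e l • x = x) (hM : ∀ m, l < m → ∀ y : M, e m • y = 0) :
    ∃ f : (h.standard l).shift j ⟶ M, lin f (h.genΔ l j) = x := by
  obtain ⟨f, hf⟩ := (h.isSES_standard l j).exists_desc (h.liftP l x hx) (by
    refine hom_ext fun y => ?_
    have : (h.K l).toSubmodule ≤
        LinearMap.ker (lin (h.liftP l x hx) ∘ₗ ((h.P l).sh j).toLinearMap) :=
      h.K_le fun m hlm z => by
        rw [LinearMap.mem_ker, map_smul]
        exact hM m hlm _
    exact this y.2)
  refine ⟨f, ?_⟩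
  rw [genΔ, ← lin_comp_apply, hf, liftP_genP, hl]

end IsPositivelyGraded

namespace IsPositivelyGraded

open GMod

variable {k A : Type u} [Field k] [Ring A] [Algebra k A]
  {𝒜 : ℤ → Submodule k A} {Λ : Type v} {e : Λ → A}
variable [GradedAlgebra 𝒜]

/-! ### Injective and proper costandard modules -/

/-- The functional on `A` underlying an element of `I(λ)`. -/
def fnI (h : IsPositivelyGraded 𝒜 e) {l : Λ} (y : h.I l) : A →ₗ[k] k :=
  GradedDual.fn (show GradedDual 𝒜 from y.1)

theorem fnI_ext (h : IsPositivelyGraded 𝒜 e) {l : Λ} {y z : h.I l}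
    (hyz : ∀ a, h.fnI y a = h.fnI z a) : y = z :=
  Subtype.ext (GradedDual.fn_ext hyz)

theorem fnI_smul (h : IsPositivelyGraded 𝒜 e) {l : Λ} (y : h.I l) (a b : A) :
    h.fnI (a • y) b = h.fnI y (b * a) := rfl

theorem fnI_idem_mul (h : IsPositivelyGraded 𝒜 e) {l : Λ} (y : h.I l) (a : A) :
    h.fnI y (e l * a) = h.fnI y a := by
  obtain ⟨_, φ, rfl⟩ := y
  let ψ : GradedDual 𝒜 := φ
  change GradedDual.fn ψ (e l * (e l * a)) = GradedDual.fn ψ (e l * a)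
  rw [← mul_assoc, h.idem_mul_self]

theorem fnI_of_mem (h : IsPositivelyGraded 𝒜 e) {l : Λ} {n : ℤ} {y : h.I l}
    (hy : y ∈ (h.I l).gr n) {i : ℤ} (hi : i ≠ -n) {a : A} (ha : a ∈ 𝒜 i) : h.fnI y a = 0 :=
  (show (show GradedDual 𝒜 from y.1) ∈ GradedDual.gr 𝒜 n from hy) i hi a ha

/-- The morphism `M ⟶ I(λ)⟨j⟩` attached to a functional on `M_{-j}`. -/
theorem exists_lift_I (h : IsPositivelyGraded 𝒜 e) (l : Λ) {M : GMod 𝒜} (j : ℤ) (φ : M →ₗ[k] k)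
    (hφ : ∀ d ≠ -j, ∀ x ∈ M.gr d, φ x = 0) :
    ∃ f : M ⟶ (h.I l).shift j, ∀ x a,
      h.fnI (((h.I l).sh j).symm (lin f x)) a = φ (e l • a • x) := by
  classical
  -- The functional `a ↦ φ (a • x)` lies in the graded dual: for homogeneous `x` only one degree of
  -- `a` reaches degree `-j`.
  have hsupp : ∀ x : M, ∃ s : Finset ℤ, ∀ i ∉ s, ∀ a ∈ 𝒜 i, φ (a • x) = 0 := by
    intro x
    induction x using M.induction_on with
    | hom d x hx =>
      refine ⟨{-j - d}, fun i hi a ha => hφ (i + d) ?_ _ (M.smul_mem _ _ _ _ ha hx)⟩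
      rw [Finset.mem_singleton] at hi
      omega
    | zero => exact ⟨∅, fun i _ a _ => by rw [smul_zero, map_zero]⟩
    | add x y hx hy =>
      obtain ⟨s, hs⟩ := hx
      obtain ⟨t, ht⟩ := hy
      refine ⟨s ∪ t, fun i hi a ha => ?_⟩
      rw [Finset.mem_union, not_or] at hi
      rw [smul_add, map_add, hs i hi.1 a ha, ht i hi.2 a ha, add_zero]
  let T : M →ₗ[A] GradedDual 𝒜 :=
    { toFun := fun x => ⟨φ ∘ₗ (LinearMap.toSpanSingleton A M x).restrictScalars k, hsupp x⟩
      map_add' := fun x y => GradedDual.fn_ext fun a => by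
        change φ (a • (x + y)) = φ (a • x) + φ (a • y)
        rw [smul_add, map_add]
      map_smul' := fun b x => GradedDual.fn_ext fun a => by
        change φ (a • b • x) = φ ((a * b) • x)
        rw [smul_smul] }
  -- The idempotent endomorphism whose image defines `I(l)`, repeated so that the codomain agrees
  -- definitionally.
  let E : h.dual ⟶ h.dual := mkHom (M := h.dual) (N := h.dual)
      { toFun := fun φ : GradedDual 𝒜 =>
          (⟨GradedDual.fn φ ∘ₗ LinearMap.mulLeft k (e l), by
            obtain ⟨s, hs⟩ := φ.2
            refine ⟨s, fun i hi a ha => hs i hi _ ?_⟩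
            simpa using (SetLike.mul_mem_graded (h.idem_mem l) ha : e l * a ∈ 𝒜 (0 + i))⟩ :
              GradedDual 𝒜)
        map_add' := fun _ _ => rfl
        map_smul' := fun b φ => GradedDual.fn_ext fun a =>
          congrArg (GradedDual.fn φ) (mul_assoc (e l) a b) }
      (fun n φ hφ i hi a ha => hφ i hi (e l * a) (by
        simpa using (SetLike.mul_mem_graded (h.idem_mem l) ha : e l * a ∈ 𝒜 (0 + i))))
  let T' : M →ₗ[A] h.I l := (lin E).rangeRestrict ∘ₗ T
  refine ⟨mkHom (N := (h.I l).shift j) (((h.I l).sh j).toLinearMap ∘ₗ T') ?_, fun x a => ?_⟩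
  · intro d x hx
    change T' x ∈ (h.I l).gr (j + d)
    intro i hi a ha
    change φ ((e l * a) • x) = 0
    refine hφ (i + d) (by omega) _ (M.smul_mem _ _ _ _ ?_ hx)
    simpa using (SetLike.mul_mem_graded (h.idem_mem l) ha : e l * a ∈ 𝒜 (0 + i))
  · change φ ((e l * a) • x) = φ (e l • a • x)
    rw [mul_smul]

variable [Preorder Λ]

/-- The inclusion of the proper costandard module into the injective module. -/
noncomputable def toI (h : IsPositivelyGraded 𝒜 e) (l : Λ) : h.properCostandard l ⟶ h.I l :=
  GSub.incl _

theorem toI_injective (h : IsPositivelyGraded 𝒜 e) (l : Λ) :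
    Function.Injective (lin (h.toI l)) := GSub.lin_incl_injective _

theorem lin_toI_eq_zero (h : IsPositivelyGraded 𝒜 e) {l m : Λ} (hlm : l ≤ m) {i : ℤ} (hi : 0 < i)
    (f : h.I l ⟶ (h.I m).shift i) (y : h.properCostandard l) : lin f (lin (h.toI l) y) = 0 := by
  have := (Submodule.mem_iInf _).1 y.2 ⟨kerSub f, m, i, f, hlm, hi, rfl⟩
  exact this

theorem exists_toI (h : IsPositivelyGraded 𝒜 e) {l : Λ} {y : h.I l}
    (hy : ∀ m, l ≤ m → ∀ i > 0, ∀ f : h.I l ⟶ (h.I m).shift i, lin f y = 0) :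
    ∃ z, lin (h.toI l) z = y := by
  refine ⟨(⟨y, ?_⟩ : (GSub.inter {N : GSub (h.I l) | ∃ (m : Λ) (i : ℤ)
    (f : h.I l ⟶ (h.I m).shift i), l ≤ m ∧ 0 < i ∧ N = kerSub f}).toSubmodule), rfl⟩
  refine (Submodule.mem_iInf _).2 ?_
  rintro ⟨_, m, i, f, hlm, hi, rfl⟩
  exact hy m hlm i hi f

/-- The functional on `∇̄(λ)⟨j⟩` given by the coordinate on the socle. -/
noncomputable def ev (h : IsPositivelyGraded 𝒜 e) (l : Λ) (j : ℤ) :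
    (h.properCostandard l).shift j →ₗ[k] k where
  toFun y := h.fnI (((h.I l).sh j).symm (lin (shiftHom (h.toI l) j) y)) 1
  map_add' _ _ := rfl
  map_smul' _ _ := by
    rw [lin_base_smul]
    rfl

theorem ev_smul (h : IsPositivelyGraded 𝒜 e) {l : Λ} {j : ℤ} (a : A)
    (y : (h.properCostandard l).shift j) :
    h.ev l j (a • y) = h.fnI (((h.I l).sh j).symm (lin (shiftHom (h.toI l) j) y)) a := by
  change h.fnI (((h.I l).sh j).symm (lin (shiftHom (h.toI l) j) (a • y))) 1 = _
  rw [map_smul, map_smul, fnI_smul, one_mul]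

/-- An element of `I(l)` is a functional on `A`, and its value at `a` is the socle coordinate of `a
• y`. So the socle coordinate detects every nonzero submodule. -/
theorem eq_zero_of_ev_smul (h : IsPositivelyGraded 𝒜 e) {l : Λ} {j : ℤ}
    {y : (h.properCostandard l).shift j} (hy : ∀ a : A, h.ev l j (a • y) = 0) : y = 0 := by
  apply h.toI_injective l
  refine (h.fnI_ext fun a => ?_ : _ = (0 : h.I l)).trans (map_zero (lin (h.toI l))).symm
  exact (h.ev_smul a y).symm.trans (hy a)

theorem ev_idem (h : IsPositivelyGraded 𝒜 e) {l : Λ} {j : ℤ}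
    (y : (h.properCostandard l).shift j) : h.ev l j (e l • y) = h.ev l j y := by
  rw [ev_smul, ← mul_one (e l), fnI_idem_mul, ← h.ev_smul 1 y, one_smul]

theorem ev_of_mem (h : IsPositivelyGraded 𝒜 e) {l : Λ} {j n : ℤ} (hn : n ≠ -j)
    {y : (h.properCostandard l).shift j} (hy : y ∈ ((h.properCostandard l).shift j).gr n) :
    h.ev l j y = 0 := by
  refine h.fnI_of_mem (n := j + n) (lin_mem (h.toI l) hy) (i := 0) (by omega) ?_
  exact SetLike.one_mem_graded 𝒜

/-- The socle sits in degree `-j` and `A` never lowers degrees, so a vector above degree `-j` cannot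
be carried to the socle. -/
theorem mem_gr_eq_zero (h : IsPositivelyGraded 𝒜 e) {l : Λ} {j n : ℤ} (hn : -j < n)
    {y : (h.properCostandard l).shift j} (hy : y ∈ ((h.properCostandard l).shift j).gr n) :
    y = 0 := by
  refine h.eq_zero_of_ev_smul fun a => ?_
  induction a using induction_homogeneous (𝒜 := 𝒜) with
  | hom i a ha =>
    rcases lt_or_ge i 0 with hi | hi
    · rw [h.eq_bot i hi, Submodule.mem_bot] at ha
      rw [ha, zero_smul, map_zero]
    · exact h.ev_of_mem (n := i + n) (by omega) (GMod.smul_mem _ _ _ _ _ ha hy)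
  | zero => rw [zero_smul, map_zero]
  | add a b ha hb => rw [add_smul, map_add, ha, hb, add_zero]

/-- Below the socle, `∇̄(λ)` has no composition factors `L(μ)` with `λ ⪯ μ`. -/
theorem idem_smul_properCostandard (h : IsPositivelyGraded 𝒜 e) {l m : Λ} (hlm : l ≤ m) {j n : ℤ}
    (hn : n < -j) {y : (h.properCostandard l).shift j}
    (hy : y ∈ ((h.properCostandard l).shift j).gr n) : e m • y = 0 := by
  by_contra hne
  set z : h.I l := lin (h.toI l) (((h.properCostandard l).sh j).symm (e m • y)) with hz
  have hz0 : z ≠ 0 := fun h0 => hne (h.toI_injective l (h0.trans (map_zero _).symm))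
  have hzm : z ∈ (h.I l).gr (j + n) := lin_mem (h.toI l) (h.idem_smul_mem m hy)
  have hem : e m • z = z := by rw [hz, ← map_smul, ← map_smul, h.idem_smul_self]
  obtain ⟨φ, hφ⟩ := not_forall.1 (mt (Module.forall_dual_apply_eq_zero_iff k z).1 hz0)
  -- In `I(l)` the vector `z` has degree `j + n < 0`. A functional nonzero on `z` yields a morphism
  -- to `I(m)` shifted by `-(j + n) > 0`, one of those that must vanish on the proper costandard
  -- module.
  obtain ⟨f, hf⟩ := h.exists_lift_I m (-(j + n)) (φ ∘ₗ (h.I l).proj (j + n)) (by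
    intro d hd x hx
    rw [LinearMap.comp_apply, (h.I l).proj_of_ne hx (by omega), map_zero])
  apply hφ
  have h1 := hf z 1
  rw [one_smul, hem, LinearMap.comp_apply, (h.I l).proj_of_mem hzm,
    h.lin_toI_eq_zero hlm (by omega)] at h1
  rw [← h1, map_zero]
  rfl

/-- Components of `y` below degree `-j` have no part of weight `m`. The others are pushed above
degree `-j` by `a`, where the socle coordinate is zero. -/
theorem ev_smul_idem (h : IsPositivelyGraded 𝒜 e) {l m : Λ} (hlm : l ≤ m) {i j : ℤ} (hi : 0 < i)
    {a : A} (ha : a ∈ 𝒜 i) (y : (h.properCostandard l).shift j) :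
    h.ev l j (a • e m • y) = 0 := by
  induction y using GMod.induction_on with
  | hom n y hy =>
    rcases lt_or_ge n (-j) with hn | hn
    · rw [h.idem_smul_properCostandard hlm hn hy, smul_zero, map_zero]
    · exact h.ev_of_mem (n := i + n) (by omega)
        (GMod.smul_mem _ _ _ _ _ ha (h.idem_smul_mem m hy))
  | zero => rw [smul_zero, smul_zero, map_zero]
  | add x y hx hy => rw [smul_add, smul_add, map_add, hx, hy, add_zero]

/-- For a vector of weight `⪰ l`, elements of positive degree contribute nothing to the socle
coordinate. Only the idempotents remain, and they return the coordinate of `y` itself or zero. -/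
theorem eq_zero_of_ev (h : IsPositivelyGraded 𝒜 e) {l m : Λ} (hlm : l ≤ m) {j : ℤ}
    {y : (h.properCostandard l).shift j} (hm : e m • y = y) (hy : h.ev l j y = 0) : y = 0 := by
  refine h.eq_zero_of_ev_smul fun a => ?_
  induction a using h.induction_algebra with
  | pos i hi a ha => rw [← hm, h.ev_smul_idem hlm hi ha]
  | idem c l' =>
    rw [smul_assoc, map_smul, ← hm]
    rcases eq_or_ne l' m with rfl | hl
    · rw [h.idem_smul_self, hm, hy, smul_zero]
    · rw [h.idem_smul_of_ne hl, map_zero, smul_zero]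
  | zero => rw [zero_smul, map_zero]
  | add a b ha hb => rw [add_smul, map_add, ha, hb, add_zero]

/-- The morphism `M ⟶ ∇̄(λ)⟨j⟩` attached to a suitable functional on `M_{-j}`. -/
theorem exists_lift_properCostandard (h : IsPositivelyGraded 𝒜 e) (l : Λ) {M : GMod 𝒜} (j : ℤ)
    (φ : M →ₗ[k] k) (hφ : ∀ d ≠ -j, ∀ x ∈ M.gr d, φ x = 0)
    (hφ' : ∀ i > 0, ∀ a ∈ 𝒜 i, ∀ m, l ≤ m → ∀ x : M, φ (e l • a • e m • x) = 0) :
    ∃ f : M ⟶ (h.properCostandard l).shift j, ∀ x, h.ev l j (lin f x) = φ (e l • x) := by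
  obtain ⟨F, hF⟩ := h.exists_lift_I l j φ hφ
  -- `F (e m • x)` is the functional `a ↦ φ (e l • a • e m • x)`. For `x` in degree `-j - i` only
  -- `a` of degree `i` could contribute, and `hφ'` excludes these.
  have key : ∀ m, l ≤ m → ∀ i > 0, ∀ x ∈ M.gr (-j - i), lin F (e m • x) = 0 := by
    intro m hlm i hi x hx
    apply ((h.I l).sh j).symm.injective
    rw [map_zero]
    refine h.fnI_ext fun a => ?_
    rw [hF]
    change φ (e l • a • e m • x) = 0
    induction a using induction_homogeneous (𝒜 := 𝒜) with
    | hom i' a ha =>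
      by_cases hii : i' = i
      · subst hii; exact hφ' i' hi a ha m hlm x
      · exact hφ (i' + (-j - i)) (by omega) _
          (h.idem_smul_mem l (M.smul_mem _ _ _ _ ha (h.idem_smul_mem m hx)))
    | zero => rw [zero_smul, smul_zero, map_zero]
    | add a b ha hb => rw [add_smul, smul_add, map_add, ha, hb, add_zero]
  have hmem : ∀ x, ∃ z, lin (h.toI l) z = ((h.I l).sh j).symm (lin F x) := by
    intro x
    refine h.exists_toI fun m hlm i hi f => ?_
    apply ((h.I m).sh i).symm.injective
    rw [map_zero]
    refine h.fnI_ext fun b => ?_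
    -- Moving `b` and `e m` into the argument reduces the vanishing of a whole functional to its
    -- value at `1`.
    have h1 : h.fnI (((h.I m).sh i).symm (lin f (((h.I l).sh j).symm (lin F x)))) b =
        h.fnI (((h.I m).sh i).symm (lin f (((h.I l).sh j).symm (lin F (e m • b • x))))) 1 := by
      simp only [map_smul, fnI_smul, one_mul, fnI_idem_mul]
    rw [h1]
    change _ = (0 : k)
    generalize b • x = x'
    induction x' using M.induction_on with
    | hom d x hx =>
      -- A value at `1` sees only degree `0`. Counting the two shifts, `i + j + d = 0` is the single
      -- degree left, and there `key` applies.
      by_cases hd : d = -j - i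
      · subst hd
        rw [key m hlm i hi x hx, map_zero, map_zero, map_zero]; rfl
      · have h2 : lin F (e m • x) ∈ ((h.I l).shift j).gr d := lin_mem F (h.idem_smul_mem m hx)
        have h3 : lin f (((h.I l).sh j).symm (lin F (e m • x))) ∈ ((h.I m).shift i).gr (j + d) :=
          lin_mem f h2
        exact h.fnI_of_mem (n := i + (j + d)) h3 (i := 0) (by omega) (SetLike.one_mem_graded 𝒜)
    | zero => simp only [smul_zero, map_zero]; rfl
    | add x y hx hy =>
      simp only [smul_add, map_add]
      exact (congrArg₂ (· + ·) hx hy).trans (add_zero 0)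
  obtain ⟨G, hG⟩ := exists_factor (shiftHom (h.toI l) j) (h.toI_injective l) F hmem
  refine ⟨G, fun x => ?_⟩
  have h1 := hF x 1
  rw [one_smul, ← hG] at h1
  exact h1

end IsPositivelyGraded

/-! ### Extending functionals; shifts and zero subquotients -/

namespace GMod

section General

variable {k A : Type u} [Field k] [Ring A] [Algebra k A] {𝒜 : ℤ → Submodule k A}

theorem exists_extend_functional {X Y : GMod 𝒜} (f : X ⟶ Y) (hf : Function.Injective (lin f))
    (φ : X →ₗ[k] k) : ∃ ψ : Y →ₗ[k] k, ∀ x, ψ (lin f x) = φ x := by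
  obtain ⟨g, hg⟩ := LinearMap.exists_leftInverse_of_injective ((lin f).restrictScalars k)
    (LinearMap.ker_eq_bot.2 hf)
  refine ⟨φ ∘ₗ g, fun x => ?_⟩
  exact congrArg φ (congrArg (fun t => t x) hg)

theorem IsShiftOf.shift {Λ : Type v} {S : Λ → GMod 𝒜} {M : GMod 𝒜} (hM : IsShiftOf S M) (j : ℤ) :
    IsShiftOf S (M.shift j) := by
  obtain ⟨l, i, ⟨f⟩⟩ := hM
  exact ⟨l, i + j, ⟨shiftIso f j ≪≫ shiftShiftIso _ _ _⟩⟩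

theorem subquot_eq_zero {M : GMod 𝒜} {N N' : GSub M} (h : N = ⊥) (x : N.subquot N') : x = 0 := by
  obtain ⟨y, rfl⟩ := N.subquotProj_surjective N' x
  subst h
  rw [eq_zero_of_bot y, map_zero]

theorem eq_zero_of_mem_gr {M : GMod 𝒜} {n : ℤ} (hM : ∀ d ≤ n, M.gr d = ⊥) {d : ℤ} (hd : d ≤ n)
    {x : M} (hx : x ∈ M.gr d) : x = 0 := by
  rwa [hM d hd, Submodule.mem_bot] at hx

end General

end GMod

namespace IsPositivelyGraded

open GMod Abelian

variable {k A : Type u} [Field k] [Ring A] [Algebra k A]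
  {𝒜 : ℤ → Submodule k A} {Λ : Type v} {e : Λ → A}
variable [GradedAlgebra 𝒜] [Preorder Λ]

/-! ### Morphisms and extensions between standard and proper costandard modules -/

theorem hom_ext_ev (h : IsPositivelyGraded 𝒜 e) {l : Λ} {j : ℤ} {M : GMod 𝒜}
    {f g : M ⟶ (h.properCostandard l).shift j}
    (hfg : ∀ x, h.ev l j (lin f x) = h.ev l j (lin g x)) : f = g := by
  refine hom_ext fun x => sub_eq_zero.1 (h.eq_zero_of_ev_smul fun a => ?_)
  rw [smul_sub, ← map_smul, ← map_smul, map_sub, hfg, sub_self]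

theorem ev_proj (h : IsPositivelyGraded 𝒜 e) {l : Λ} {j : ℤ} {M : GMod 𝒜}
    (f : M ⟶ (h.properCostandard l).shift j) (x : M) :
    h.ev l j (lin f (M.proj (-j) x)) = h.ev l j (lin f x) := by
  induction x using M.induction_on with
  | hom d x hx =>
    by_cases hd : d = -j
    · subst hd; rw [M.proj_of_mem hx]
    · rw [M.proj_of_ne hx hd, map_zero, map_zero, h.ev_of_mem hd (lin_mem f hx)]
  | zero => simp
  | add x y hx hy => simp only [map_add, hx, hy]

/-- Composing `φ` with the projection to degree `-j` makes the support condition automatic and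
leaves only products landing in degree `-j` to be checked. -/
theorem exists_lift_properCostandard' (h : IsPositivelyGraded 𝒜 e) (l : Λ) {M : GMod 𝒜} (j : ℤ)
    (φ : M →ₗ[k] k) (hφ : ∀ i > 0, ∀ a ∈ 𝒜 i, ∀ m, l ≤ m → ∀ x ∈ M.gr (-j - i),
      φ (e l • a • e m • x) = 0) :
    ∃ f : M ⟶ (h.properCostandard l).shift j,
      ∀ x, h.ev l j (lin f x) = φ (M.proj (-j) (e l • x)) := by
  refine h.exists_lift_properCostandard l j (φ ∘ₗ M.proj (-j)) (fun d hd x hx => ?_)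
    (fun i hi a ha m hlm x => ?_)
  · rw [LinearMap.comp_apply, M.proj_of_ne hx hd, map_zero]
  · rw [LinearMap.comp_apply, h.proj_idem_smul]
    have h1 := M.proj_smul ha (-j - i) (e m • x)
    rw [show i + (-j - i) = -j by ring, h.proj_idem_smul] at h1
    rw [h1]
    exact hφ i hi a ha m hlm _ (M.proj_mem _ _)

theorem idem_smul_properCostandard_of_lt (h : IsPositivelyGraded 𝒜 e) {l m : Λ} (hlm : l < m)
    {j : ℤ} (y : (h.properCostandard l).shift j) : e m • y = 0 := by
  refine h.eq_zero_of_ev hlm.le (h.idem_smul_self m y) ?_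
  rw [← h.ev_idem, h.idem_smul_of_ne hlm.ne, map_zero]

theorem le_of_idem_smul_ne_zero {h : IsPositivelyGraded 𝒜 e} (hs : h.IsStandardlyStratified)
    {l m : Λ} {j : ℤ} {x : (h.standard l).shift j} (hx : e m • x ≠ 0) : m ≤ l :=
  hs.le_of_compositionFactor l m ⟨x, hx⟩

/-- The image `y` of the generator has weight `l`. Since `y` generates a submodule meeting the socle
of weight `m`, stratification gives `m ⪯ l`. A nonzero vector of weight `⪰ m` must have nonzero
socle coordinate, which fixes both its weight and its degree. -/
theorem eq_of_hom_ne_zero {h : IsPositivelyGraded 𝒜 e} (hs : h.IsStandardlyStratified)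
    {l m : Λ} {i j : ℤ} {f : (h.standard l).shift i ⟶ (h.properCostandard m).shift j}
    (hf : f ≠ 0) : l = m ∧ i = j := by
  set y := lin f (h.genΔ l i) with hy
  have hy0 : y ≠ 0 := fun h0 => hf (h.hom_standard_ext (by rw [← hy, h0]; rfl))
  have hly : e l • y = y := h.hom_standard_gen_idem f
  have hym := h.hom_standard_gen_mem f
  have hml : m ≤ l := by
    by_contra hml
    refine hy0 (h.eq_zero_of_ev_smul fun a => ?_)
    rw [← h.ev_idem, hy, ← map_smul, ← map_smul]
    have : e m • a • h.genΔ l i = 0 := by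
      by_contra h0
      exact hml (le_of_idem_smul_ne_zero hs h0)
    rw [this, map_zero, map_zero]
  constructor
  · by_contra hne
    refine hy0 (h.eq_zero_of_ev hml hly ?_)
    rw [← h.ev_idem, ← hly, h.idem_smul_of_ne (Ne.symm hne), map_zero]
  · rcases lt_trichotomy i j with hij | hij | hij
    · exact absurd (h.mem_gr_eq_zero (by omega) hym) hy0
    · exact hij
    · have := h.idem_smul_properCostandard hml (by omega) hym
      exact absurd (hly.symm.trans this) hy0

/-- With `P(l)⟨i⟩` projective, it suffices to extend morphisms from `K(l)⟨i⟩` to `P(l)⟨i⟩`. If `m ⪯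
l`, there are no nonzero ones, because `K(l)` is generated in weights above `l`, absent from
`∇̄(m)`. Otherwise all vectors of weight `⪰ m` of `P(l)` already lie in `K(l)`, so any linear
extension of the functional satisfies the required condition. -/
theorem subsingleton_ext_one {h : IsPositivelyGraded 𝒜 e} (hs : h.IsStandardlyStratified)
    (l m : Λ) (i j : ℤ) :
    Subsingleton (Ext ((h.standard l).shift i) ((h.properCostandard m).shift j) 1) := by
  refine (h.isSES_standard l i).ext_one_quot_left (fun t => ?_)
    (Ext.subsingleton_of_projective _ _ 0)
  have hS := h.isSES_standard l i
  set f := shiftHom (h.K l).incl i with hf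
  by_cases hml : m ≤ l
  · refine ⟨0, hom_ext fun y => ?_⟩
    rw [comp_zero]
    symm
    -- The kernel of `t`, moved into `P(l)` so that it can be compared with the generators of
    -- `K(l)`.
    let N : Submodule A (h.P l) :=
      ((LinearMap.ker (lin t)).map (lin f)).comap ((h.P l).sh i).toLinearMap
    have hN : (h.K l).toSubmodule ≤ N := h.K_le fun v hlv x => by
      have hx : lin (shiftHom (h.toStandard l) i) ((h.P l).sh i (e v • x)) = 0 := by
        rw [map_smul, map_smul]
        exact h.idem_smul_standard hlv _
      obtain ⟨z, hz⟩ := (hS.exact _).1 hx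
      refine ⟨e v • z, ?_, ?_⟩
      · change lin t (e v • z) = 0
        rw [map_smul]
        exact h.idem_smul_properCostandard_of_lt (hml.trans_lt hlv) _
      · rw [map_smul, hz, ← map_smul, h.idem_smul_self]
        rfl
    have hy : (((h.P l).sh i).symm (lin f y)) ∈ N := hN (by
      rw [← h.toStandard_eq_zero]
      exact (hS.exact _).2 ⟨y, rfl⟩)
    obtain ⟨z, hz, hzy⟩ := hy
    rw [← hS.injective hzy]
    exact hz
  -- The extension `ψ` is merely `k`-linear. It induces a morphism because `Δ(l)` has no weight `v ⪰
  -- m`, so `e v • x` comes from `K(l)`, where `ψ` is given by `t`.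
  · obtain ⟨ψ, hψ⟩ := exists_extend_functional f hS.injective
      (h.ev m j ∘ₗ (lin t).restrictScalars k)
    have hψ' : ∀ x, ψ (lin f x) = h.ev m j (lin t x) := hψ
    obtain ⟨G, hG⟩ := h.exists_lift_properCostandard' m j ψ (by
      intro d hd a ha v hmv x _
      have hx : lin (shiftHom (h.toStandard l) i) (e v • x) = 0 := by
        rw [map_smul]
        by_contra h0
        exact hml (hmv.trans (le_of_idem_smul_ne_zero hs h0))
      obtain ⟨z, hz⟩ := (hS.exact _).1 hx
      have hz' : lin f (e m • a • e v • z) = e m • a • e v • x := by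
        rw [map_smul, map_smul, map_smul, hz, h.idem_smul_self]
      rw [← hz', hψ', map_smul (lin t), map_smul (lin t), map_smul (lin t), h.ev_idem, h.ev_smul_idem hmv hd ha])
    refine ⟨G, h.hom_ext_ev fun x => ?_⟩
    rw [lin_comp_apply, hG, ← map_smul, ← lin_proj, hψ', h.ev_proj, map_smul, h.ev_idem]

/-- To prove a property stable under extensions for `K(λ)⟨j⟩`, it suffices to prove it for shifts
of standard modules. -/
theorem K_induction {h : IsPositivelyGraded 𝒜 e} (hs : h.IsStandardlyStratified)
    {R : GMod 𝒜 → Prop} (h0 : ∀ X : GMod 𝒜, (∀ x : X, x = 0) → R X)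
    (hiso : ∀ X Y : GMod 𝒜, (X ≅ Y) → R X → R Y)
    (hext : ∀ (X Y Z : GMod 𝒜) (f : X ⟶ Y) (g : Y ⟶ Z), IsSES f g → R X → R Z → R Y)
    (hΔ : ∀ l j, R ((h.standard l).shift j)) (l : Λ) (j : ℤ) : R ((h.K l).obj.shift j) := by
  refine (hs.filtration l).induction (R := fun X => R (X.shift j)) (fun X hX => h0 _ hX)
    (fun _ _ _ _ _ hfg => hext _ _ _ _ _ (hfg.shift j)) (fun X hX => ?_)
  obtain ⟨l', j', ⟨f⟩⟩ := hX.shift j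
  exact hiso _ _ f.symm (hΔ l' j')

/-- `M` satisfies `ext¹(Δ(λ)⟨j⟩, M) = 0` for all `λ` and `j`. -/
def RightOrthogonal (h : IsPositivelyGraded 𝒜 e) (M : GMod 𝒜) : Prop :=
  ∀ (j : ℤ) (l : Λ), Subsingleton (Ext ((h.standard l).shift j) M 1)

/-- Dimension shift along `K(l) ⟶ P(l) ⟶ Δ(l)`: the induction hypothesis for standard modules passes
to `K(l)` through its filtration. -/
theorem RightOrthogonal.ext {h : IsPositivelyGraded 𝒜 e} (hs : h.IsStandardlyStratified)
    {M : GMod 𝒜} (hM : h.RightOrthogonal M) (n : ℕ) (j : ℤ) (l : Λ) :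
    Subsingleton (Ext ((h.standard l).shift j) M (n + 1)) := by
  induction n generalizing j l with
  | zero => exact hM j l
  | succ n ih =>
    refine (h.isSES_standard l j).ext_quot_left ?_ (Ext.subsingleton_of_projective _ _ _)
    exact K_induction hs (R := fun X => Subsingleton (Ext X M (n + 1)))
      (fun X hX => subsingleton_ext_of_isZero_left (isZero_of_subsingleton X hX) _)
      (fun _ _ f => subsingleton_ext_of_iso_left f)
      (fun _ _ _ _ _ hfg => hfg.ext_mid_left) (fun l j => ih j l) l j

theorem subsingleton_ext_standard_properCostandard {h : IsPositivelyGraded 𝒜 e}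
    (hs : h.IsStandardlyStratified) (l m : Λ) (i j : ℤ) (n : ℕ) :
    Subsingleton (Ext ((h.standard l).shift i) ((h.properCostandard m).shift j) (n + 1)) :=
  RightOrthogonal.ext hs (fun i l => subsingleton_ext_one hs l m i j) n i l

/-- A morphism from a right orthogonal module along which all morphisms from standard modules lift
is surjective. -/
theorem RightOrthogonal.surjective [Finite Λ] {h : IsPositivelyGraded 𝒜 e}
    (hs : h.IsStandardlyStratified) {M X : GMod 𝒜} (hM : h.RightOrthogonal M) (f : M ⟶ X)
    (hf : ∀ l j (g : (h.standard l).shift j ⟶ X), ∃ g', g' ≫ f = g) :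
    Function.Surjective (lin f) := by
  -- Lifting alone is not visibly stable under extensions. Together with `ext¹(Y, M) = 0` it is: a
  -- lift on the submodule extends to the middle term, and the remaining error factors through the
  -- quotient.
  let R : GMod 𝒜 → Prop := fun Y =>
    Subsingleton (Ext Y M 1) ∧ ∀ g : Y ⟶ X, ∃ g', g' ≫ f = g
  have hext : ∀ (X Y Z : GMod 𝒜) (s : X ⟶ Y) (t : Y ⟶ Z), IsSES s t → R X → R Z → R Y := by
    intro U V W s t hst hU hW
    refine ⟨hst.ext_mid_left hU.1 hW.1, fun g => ?_⟩
    obtain ⟨g₁, hg₁⟩ := hU.2 (s ≫ g)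
    obtain ⟨g₂, hg₂⟩ := hst.exists_extension hW.1 g₁
    obtain ⟨g₃, hg₃⟩ := hst.exists_desc (g - g₂ ≫ f) (by
      rw [Preadditive.comp_sub, ← Category.assoc, hg₂, hg₁, sub_self])
    obtain ⟨g₄, hg₄⟩ := hW.2 g₃
    refine ⟨g₂ + t ≫ g₄, ?_⟩
    rw [Preadditive.add_comp, Category.assoc, hg₄, hg₃, add_sub_cancel]
  have hΔ : ∀ l j, R ((h.standard l).shift j) := fun l j => ⟨hM j l, hf l j⟩
  refine h.surjective_of_lift_P f fun l j g => ?_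
  refine (hext _ _ _ _ _ (h.isSES_standard l j) ?_ (hΔ l j)).2 g
  refine K_induction hs (R := R) (fun Y hY => ?_) (fun Y Z i hY => ?_) hext hΔ l j
  · have := isZero_of_subsingleton Y hY
    exact ⟨subsingleton_ext_of_isZero_left this _, fun g => ⟨0, this.eq_of_src _ _⟩⟩
  · refine ⟨subsingleton_ext_of_iso_left i hY.1, fun g => ?_⟩
    obtain ⟨g', hg'⟩ := hY.2 (i.hom ≫ g)
    exact ⟨i.inv ≫ g', by rw [Category.assoc, hg', Iso.inv_hom_id_assoc]⟩

theorem RightOrthogonal.ker [Finite Λ] {h : IsPositivelyGraded 𝒜 e}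
    (hs : h.IsStandardlyStratified) {M X : GMod 𝒜} (hM : h.RightOrthogonal M) (f : M ⟶ X)
    (hf : ∀ l j (g : (h.standard l).shift j ⟶ X), ∃ g', g' ≫ f = g) :
    h.RightOrthogonal (kerSub f).obj := fun j l =>
  (isSES_kerSub f (hM.surjective hs f hf)).ext_one_sub_right (hf l j) (hM j l)

/-! ### Modules with a proper costandard filtration are right orthogonal -/

/-- `K(l)⟨j⟩` has finitely many standard layers, each generated by one vector in one degree; a
target that vanishes up to the largest of these degrees receives only zero. -/
theorem exists_forall_hom_K_eq_zero {h : IsPositivelyGraded 𝒜 e} (hs : h.IsStandardlyStratified)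
    (l : Λ) (j : ℤ) : ∃ n : ℤ, ∀ X : GMod 𝒜, (∀ d ≤ n, X.gr d = ⊥) →
      ∀ f : (h.K l).obj.shift j ⟶ X, f = 0 := by
  refine K_induction hs (R := fun Y => ∃ n : ℤ, ∀ X : GMod 𝒜, (∀ d ≤ n, X.gr d = ⊥) →
    ∀ f : Y ⟶ X, f = 0) (fun Y hY => ?_) (fun Y Z i hY => ?_) ?_ (fun l j => ?_) l j
  · exact ⟨0, fun X _ f => (isZero_of_subsingleton Y hY).eq_of_src _ _⟩
  · obtain ⟨n, hn⟩ := hY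
    exact ⟨n, fun X hX f => by rw [← i.inv_hom_id_assoc f, hn X hX (i.hom ≫ f), comp_zero]⟩
  · rintro U V W s t hst ⟨n₁, h₁⟩ ⟨n₂, h₂⟩
    refine ⟨max n₁ n₂, fun X hX f => ?_⟩
    obtain ⟨g, rfl⟩ := hst.exists_desc f
      (h₁ X (fun d hd => hX d (hd.trans (le_max_left _ _))) _)
    rw [h₂ X (fun d hd => hX d (hd.trans (le_max_right _ _))) g, comp_zero]
  · refine ⟨-j, fun X hX f => h.hom_standard_ext ?_⟩
    exact eq_zero_of_mem_gr hX le_rfl (h.hom_standard_gen_mem f)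

/-- Far enough down, the term `F N` receives no nonzero morphism from `K(l)⟨j⟩`, so `ext¹(Δ(l)⟨j⟩, F
N) = 0`. Only the finitely many layers above it remain. -/
theorem RightOrthogonal.of_inC {h : IsPositivelyGraded 𝒜 e} (hs : h.IsStandardlyStratified)
    {M : GMod 𝒜} (hM : InC h.properCostandard M) : h.RightOrthogonal M := by
  intro j l
  obtain ⟨-, F, hF0, hF1, hF2, hF3⟩ := hM
  obtain ⟨n, hn⟩ := exists_forall_hom_K_eq_zero hs l j
  obtain ⟨N, hN⟩ := hF3 n
  have key := filtration_induction (R := fun X => Subsingleton (Ext ((h.standard l).shift j) X 1))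
    (fun _ _ _ _ _ hfg => hfg.ext_mid_right) F N (fun i _ => ⟨hF1 i, ?_⟩)
    ((h.isSES_standard l j).ext_one_quot_left (fun t => ⟨0, ?_⟩)
      (Ext.subsingleton_of_projective _ _ _))
  · rw [hF0] at key
    exact subsingleton_ext_of_iso_right (nonempty_top_iso M).some key
  · rcases hF2 i with hi | ⟨m, i', ⟨f⟩⟩
    · exact subsingleton_ext_of_isZero_right (isZero_of_subsingleton _ (subquot_eq_zero hi)) _
    · exact subsingleton_ext_of_iso_right f.symm (subsingleton_ext_one hs l m j i')
  · rw [hn _ (hN N le_rfl) t, comp_zero]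

theorem RightOrthogonal.of_inFDown {h : IsPositivelyGraded 𝒜 e} (hs : h.IsStandardlyStratified)
    {M : GMod 𝒜} (hM : InFDown h.properCostandard M) : h.RightOrthogonal M := fun j l =>
  hM.2.induction (R := fun X => Subsingleton (Ext ((h.standard l).shift j) X 1))
    (fun X hX => subsingleton_ext_of_isZero_right (isZero_of_subsingleton X hX) _)
    (fun _ _ _ _ _ hfg => hfg.ext_mid_right)
    (fun _ hX => RightOrthogonal.of_inC hs hX j l)

end IsPositivelyGraded

namespace GMod

section General

variable {k A : Type u} [Field k] [Ring A] [Algebra k A] {𝒜 : ℤ → Submodule k A}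

/-! ### Images and preimages of graded submodules -/

/-- The image of a graded submodule. -/
def GSub.map {M N : GMod 𝒜} (f : M ⟶ N) (L : GSub M) : GSub N where
  toSubmodule := L.toSubmodule.map (lin f)
  homogeneous := by
    rintro _ ⟨x, hx, rfl⟩ i
    exact ⟨M.proj i x, L.homogeneous x hx i, lin_proj f i x⟩

/-- The preimage of a graded submodule. -/
def GSub.comap {M N : GMod 𝒜} (f : M ⟶ N) (L : GSub N) : GSub M where
  toSubmodule := L.toSubmodule.comap (lin f)
  homogeneous x hx i := by
    rw [Submodule.mem_comap] at hx ⊢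
    rw [lin_proj]
    exact L.homogeneous _ hx i

theorem GSub.obj_gr_eq_bot {M : GMod 𝒜} (N : GSub M) (i : ℤ) :
    N.obj.gr i = ⊥ ↔ ∀ x ∈ N.toSubmodule, x ∈ M.gr i → x = 0 := by
  rw [eq_bot_iff]
  constructor
  · intro h x hx hxi
    have h1 := h (show (show N.obj from (⟨x, hx⟩ : N.toSubmodule)) ∈ N.obj.gr i from hxi)
    exact congrArg Subtype.val ((Submodule.mem_bot (M := N.obj) k).1 h1)
  · intro h x hx
    exact (Submodule.mem_bot (M := N.obj) k).2 (Subtype.ext (h x.1 x.2 hx))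

/-- The hypothesis puts the kernel of `f` on `L` inside `L'`, so `L ⟶ f(L) / f(L')` has kernel
exactly `L'`. -/
theorem GSub.subquot_map_iso {M N : GMod 𝒜} (f : M ⟶ N) {L L' : GSub M} (hL : L' ≤ L)
    (h : ∀ x ∈ L.toSubmodule, lin f x = 0 → x ∈ L'.toSubmodule) :
    Nonempty (L.subquot L' ≅ (L.map f).subquot (L'.map f)) := by
  refine nonempty_iso_of_ker_eq (L.subquotProj L')
    ((L.map f).lift (L.incl ≫ f) (fun x => ⟨x.1, x.2, rfl⟩) ≫ (L.map f).subquotProj (L'.map f))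
    (L.subquotProj_surjective L') ?_ fun x => ?_
  · refine ((L.map f).subquotProj_surjective (L'.map f)).comp ?_
    rintro ⟨_, x, hx, rfl⟩
    exact ⟨(⟨x, hx⟩ : L.toSubmodule), rfl⟩
  · rw [lin_comp_apply]
    refine (L.subquotProj_eq_zero L' x).trans (Iff.trans ?_
      ((L.map f).subquotProj_eq_zero (L'.map f) ⟨lin f x.1, x.1, x.2, rfl⟩).symm)
    constructor
    · intro hx
      exact ⟨x.1, hx, rfl⟩
    · rintro ⟨y, hy, hyx⟩
      have := h (x.1 - y) (sub_mem x.2 (hL hy)) (by rw [map_sub, hyx, sub_self])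
      simpa using add_mem this hy

theorem GSub.subquot_comap_iso {M N : GMod 𝒜} (f : M ⟶ N) (hf : Function.Surjective (lin f))
    (L L' : GSub N) : Nonempty ((L.comap f).subquot (L'.comap f) ≅ L.subquot L') := by
  refine nonempty_iso_of_ker_eq ((L.comap f).subquotProj (L'.comap f))
    (L.lift ((L.comap f).incl ≫ f) (fun x => x.2) ≫ L.subquotProj L')
    (GSub.subquotProj_surjective _ _) ?_ fun x => ?_
  · refine (L.subquotProj_surjective L').comp ?_
    rintro ⟨y, hy⟩
    obtain ⟨x, rfl⟩ := hf y
    exact ⟨(⟨x, hy⟩ : (L.comap f).toSubmodule), rfl⟩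
  · rw [lin_comp_apply]
    exact ((L.comap f).subquotProj_eq_zero (L'.comap f) x).trans
      (L.subquotProj_eq_zero L' ⟨lin f x.1, x.2⟩).symm

theorem GSub.subquot_bot_iso {M : GMod 𝒜} (L : GSub M) : Nonempty (L.obj ≅ L.subquot ⊥) := by
  refine nonempty_iso_of_ker_eq (𝟙 L.obj) (L.subquotProj ⊥) (fun x => ⟨x, rfl⟩)
    (GSub.subquotProj_surjective _ _) fun x => ?_
  refine Iff.trans ?_ (L.subquotProj_eq_zero ⊥ x).symm
  exact ⟨fun hx => (Submodule.mem_bot A).2 (congrArg Subtype.val (show x = 0 from hx)),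
    fun hx => Subtype.ext ((Submodule.mem_bot A).1 hx)⟩

theorem GSub.map_mono {M N : GMod 𝒜} (f : M ⟶ N) {L L' : GSub M} (h : L' ≤ L) :
    L'.map f ≤ L.map f := Submodule.map_mono h

theorem GSub.comap_mono {M N : GMod 𝒜} (f : M ⟶ N) {L L' : GSub N} (h : L' ≤ L) :
    L'.comap f ≤ L.comap f := Submodule.comap_mono h

theorem GSub.map_bot {M N : GMod 𝒜} (f : M ⟶ N) : (⊥ : GSub M).map f = ⊥ :=
  GSub.ext (Submodule.map_bot _)

theorem GSub.map_top {M N : GMod 𝒜} (f : M ⟶ N) (hf : Function.Surjective (lin f)) :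
    (⊤ : GSub M).map f = ⊤ :=
  GSub.ext ((Submodule.map_top _).trans (LinearMap.range_eq_top.2 hf))

theorem GSub.map_incl_top {M : GMod 𝒜} (N : GSub M) : (⊤ : GSub N.obj).map N.incl = N :=
  GSub.ext ((Submodule.map_top _).trans (Submodule.range_subtype _))

theorem GSub.comap_proj_bot {M : GMod 𝒜} (N : GSub M) : (⊥ : GSub N.quot).comap N.proj = N :=
  GSub.ext (Submodule.ker_mkQ _)

/-- Graded submodules of `N` are isomorphic to their images in `M`. -/
theorem GSub.obj_map_incl_iso {M : GMod 𝒜} (N : GSub M) (L : GSub N.obj) :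
    Nonempty (L.obj ≅ (L.map N.incl).obj) := by
  refine ⟨isoOfBijective ((L.map N.incl).lift (L.incl ≫ N.incl) fun x => ⟨x.1, x.2, rfl⟩) ⟨?_, ?_⟩⟩
  · intro x y hxy
    exact Subtype.ext (Subtype.ext (congrArg (fun z : (L.map N.incl).toSubmodule => z.1) hxy))
  · rintro ⟨_, x, hx, rfl⟩
    exact ⟨(⟨x, hx⟩ : L.toSubmodule), rfl⟩

theorem GSub.quot_iso_subquot_map_incl {M : GMod 𝒜} (N : GSub M) (L : GSub N.obj) :
    Nonempty (N.subquot (L.map N.incl) ≅ L.quot) := by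
  refine nonempty_iso_of_ker_eq (N.subquotProj (L.map N.incl)) L.proj
    (GSub.subquotProj_surjective _ _) L.lin_proj_surjective fun x => ?_
  refine (N.subquotProj_eq_zero _ x).trans (Iff.trans ?_ (Submodule.Quotient.mk_eq_zero _).symm)
  constructor
  · rintro ⟨y, hy, hyx⟩
    have : y = x := Subtype.ext hyx
    rwa [← this]
  · intro hx
    exact ⟨x, hx, rfl⟩

/-! ### Boundedness -/

theorem IsBoundedBelow.of_injective {M N : GMod 𝒜} (f : M ⟶ N) (hf : Function.Injective (lin f))
    (hN : N.IsBoundedBelow) : M.IsBoundedBelow := by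
  obtain ⟨n, hn⟩ := hN
  refine ⟨n, fun i hi => (Submodule.eq_bot_iff _).2 fun x hx => hf ?_⟩
  rw [map_zero, ← Submodule.mem_bot k, ← hn i hi]
  exact lin_mem f hx

theorem IsBoundedBelow.of_surjective {M N : GMod 𝒜} (f : M ⟶ N)
    (hf : Function.Surjective (lin f)) (hM : M.IsBoundedBelow) : N.IsBoundedBelow := by
  obtain ⟨n, hn⟩ := hM
  refine ⟨n, fun i hi => (Submodule.eq_bot_iff _).2 fun y hy => ?_⟩
  obtain ⟨x, hx, rfl⟩ := exists_homogeneous_preimage f hf hy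
  rw [hn i hi, Submodule.mem_bot] at hx
  rw [hx, map_zero]

theorem IsBoundedBelow.sub {M : GMod 𝒜} (hM : M.IsBoundedBelow) (N : GSub M) :
    N.obj.IsBoundedBelow := hM.of_injective _ N.lin_incl_injective

theorem IsBoundedBelow.quot {M : GMod 𝒜} (hM : M.IsBoundedBelow) (N : GSub M) :
    N.quot.IsBoundedBelow := hM.of_surjective _ N.lin_proj_surjective

/-- A descending sequence of graded submodules of a module bounded below is stationary in degrees
at most `n`. -/
theorem exists_stationary {M : GMod 𝒜} (hM : M.IsBoundedBelow) (F : ℕ → GSub M)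
    (hF : ∀ i, F (i + 1) ≤ F i) (n : ℤ) :
    ∃ m, ∀ i ≥ m, ∀ d ≤ n, ∀ x ∈ M.gr d, x ∈ (F m).toSubmodule → x ∈ (F i).toSubmodule := by
  classical
  have hanti : Antitone F := antitone_nat_of_succ_le hF
  have h1 : ∀ d, ∃ m, ∀ i ≥ m, ∀ x ∈ M.gr d, x ∈ (F m).toSubmodule → x ∈ (F i).toSubmodule := by
    intro d
    have := M.finite d
    let f : ℕ →o (Submodule k (M.gr d))ᵒᵈ :=
      { toFun := fun i => OrderDual.toDual
          (((F i).toSubmodule.restrictScalars k).comap (M.gr d).subtype)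
        monotone' := fun i j hij x hx => hanti hij hx }
    obtain ⟨m, hm⟩ := IsArtinian.monotone_stabilizes f
    refine ⟨m, fun i hi x hx hxm => ?_⟩
    have h2 : (⟨x, hx⟩ : M.gr d) ∈ OrderDual.ofDual (f m) := hxm
    rw [hm i hi] at h2
    exact h2
  choose m hm using h1
  obtain ⟨b, hb⟩ := hM
  refine ⟨(Finset.Icc b n).sup m, fun i hi d hd x hx hxm => ?_⟩
  by_cases hbd : b ≤ d
  · have hle : m d ≤ (Finset.Icc b n).sup m := Finset.le_sup (Finset.mem_Icc.2 ⟨hbd, hd⟩)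
    exact hm d i (hle.trans hi) x hx (hanti hle hxm)
  · rw [hb d (by omega), Submodule.mem_bot] at hx
    rw [hx]
    exact zero_mem _

/-! ### Transport and concatenation of filtrations -/

theorem InC.of_iso {Λ : Type v} {S : Λ → GMod 𝒜} {M N : GMod 𝒜} (f : M ≅ N) (hM : InC S M) :
    InC S N := by
  have hinj : Function.Injective (lin f.hom) := fun x y hxy => by
    rw [← lin_inv_hom f x, hxy, lin_inv_hom]
  have hsurj : Function.Surjective (lin f.hom) := fun y => ⟨_, lin_hom_inv f y⟩
  obtain ⟨hb, F, hF0, hF1, hF2, hF3⟩ := hM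
  refine ⟨hb.of_surjective f.hom hsurj, fun i => (F i).map f.hom, ?_, fun i => GSub.map_mono _ (hF1 i),
    fun i => ?_, fun n => ?_⟩
  · change (F 0).map f.hom = ⊤
    rw [hF0, GSub.map_top _ hsurj]
  · refine (hF2 i).imp (fun h => (congrArg _ h).trans (GSub.map_bot _)) ?_
    rintro ⟨l, j, ⟨g⟩⟩
    obtain ⟨t⟩ := GSub.subquot_map_iso f.hom (hF1 i) fun x _ hx => by
      rw [hinj (hx.trans (map_zero _).symm)]
      exact zero_mem _
    exact ⟨l, j, ⟨t.symm ≪≫ g⟩⟩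
  · obtain ⟨m, hm⟩ := hF3 n
    refine ⟨m, fun i hi j hj => (GSub.obj_gr_eq_bot _ _).2 ?_⟩
    rintro _ ⟨x, hx, rfl⟩ hxj
    have h1 := lin_mem f.inv hxj
    rw [lin_inv_hom] at h1
    rw [(GSub.obj_gr_eq_bot _ _).1 (hm i hi j hj) x hx h1, map_zero]

theorem HasFiniteFiltration.of_forall_eq_zero {Q : GMod 𝒜 → Prop} {M : GMod 𝒜}
    (hM : ∀ x : M, x = 0) : HasFiniteFiltration Q M := by
  refine ⟨0, fun _ => ⊤, rfl, ?_, fun i hi => absurd hi (Nat.not_lt_zero i)⟩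
  refine GSub.ext (eq_bot_iff.2 fun x _ => ?_)
  rw [hM x]
  exact zero_mem _

theorem HasFiniteFiltration.of_sub_of_quot {Q : GMod 𝒜 → Prop}
    (hQ : ∀ X Y : GMod 𝒜, (X ≅ Y) → Q X → Q Y) {M : GMod 𝒜} (N : GSub M)
    (hN : HasFiniteFiltration Q N.obj) (hN' : HasFiniteFiltration Q N.quot) :
    HasFiniteFiltration Q M := by
  obtain ⟨n, F, hF0, hFn, hF⟩ := hN
  obtain ⟨m, G, hG0, hGm, hG⟩ := hN'
  have e1 : (G m).comap N.proj = (F 0).map N.incl := by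
    rw [hF0, hGm, GSub.map_incl_top, GSub.comap_proj_bot]
  -- Preimages of the filtration of the quotient, followed by the filtration of `N`. At index `m`
  -- both formulas give `N`, so either may be used there.
  let H : ℕ → GSub M := fun i => if i < m then (G i).comap N.proj else (F (i - m)).map N.incl
  have hlow : ∀ i ≤ m, H i = (G i).comap N.proj := by
    intro i hi
    rcases hi.lt_or_eq with hi | rfl
    · exact if_pos hi
    · simp only [H, lt_irrefl, if_false, Nat.sub_self, e1]
  have hhigh : ∀ i, H (m + i) = (F i).map N.incl := fun i => by
    simp only [H, if_neg (Nat.not_lt.2 (Nat.le_add_right m i)), Nat.add_sub_cancel_left]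
  refine ⟨m + n, H, ?_, ?_, fun i hi => ?_⟩
  · rw [hlow 0 (Nat.zero_le _), hG0]
    exact GSub.ext (Submodule.comap_top _)
  · rw [hhigh, hFn, GSub.map_bot]
  · rcases lt_or_ge i m with him | him
    · rw [hlow i him.le, hlow (i + 1) him]
      obtain ⟨h1, h2⟩ := hG i him
      obtain ⟨t⟩ := GSub.subquot_comap_iso N.proj N.lin_proj_surjective (G i) (G (i + 1))
      exact ⟨GSub.comap_mono _ h1, hQ _ _ t.symm h2⟩
    · obtain ⟨i, rfl⟩ := Nat.exists_eq_add_of_le him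
      rw [add_assoc, hhigh, hhigh]
      obtain ⟨h1, h2⟩ := hF i (by omega)
      obtain ⟨t⟩ := GSub.subquot_map_iso N.incl h1 fun x _ hx => by
        rw [N.lin_incl_injective (hx.trans (map_zero _).symm)]
        exact zero_mem _
      exact ⟨GSub.map_mono _ h1, hQ _ _ t h2⟩

theorem HasFiniteFiltration.single {Q : GMod 𝒜 → Prop}
    (hQ : ∀ X Y : GMod 𝒜, (X ≅ Y) → Q X → Q Y) {M : GMod 𝒜} (hM : Q M) :
    HasFiniteFiltration Q M := by
  refine ⟨1, fun i => if i = 0 then ⊤ else ⊥, rfl, rfl, fun i hi => ?_⟩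
  obtain rfl : i = 0 := by omega
  obtain ⟨t⟩ := (⊤ : GSub M).subquot_bot_iso
  exact ⟨bot_le, hQ _ _ ((nonempty_top_iso M).some.symm ≪≫ t) hM⟩

end General

end GMod

namespace IsPositivelyGraded

open GMod Abelian

variable {k A : Type u} [Field k] [Ring A] [Algebra k A]
  {𝒜 : ℤ → Submodule k A} {Λ : Type v} {e : Λ → A}
variable [GradedAlgebra 𝒜] [Preorder Λ]

/-! ### Right orthogonal modules have a proper costandard filtration -/

/-- A nonzero map to a proper costandard module, attached to a maximal class of weights. -/
theorem exists_hom_properCostandard (h : IsPositivelyGraded 𝒜 e) {M : GMod 𝒜}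
    (hM : M.IsBoundedBelow) {l₀ : Λ} (hne : ∃ m, l₀ ≤ m ∧ ∃ x : M, e m • x ≠ 0) :
    ∃ (l : Λ) (j : ℤ) (f : M ⟶ (h.properCostandard l).shift j) (x : M), l₀ ≤ l ∧
      x ∈ M.gr (-j) ∧ e l • x = x ∧ h.ev l j (lin f x) ≠ 0 ∧
      ∀ m, l₀ ≤ m → ∀ d < -j, ∀ y ∈ M.gr d, e m • y = 0 := by
  have h1 : ∃ d : ℤ, ∃ m, l₀ ≤ m ∧ ∃ x ∈ M.gr d, e m • x ≠ 0 := by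
    obtain ⟨m, hm, x, hx⟩ := hne
    obtain ⟨i, hi⟩ := not_forall.1 (mt (eq_zero_of_proj M) hx)
    rw [h.proj_idem_smul] at hi
    exact ⟨i, m, hm, _, M.proj_mem i x, hi⟩
  obtain ⟨b, hb⟩ := hM
  -- The least degree containing a weight `⪰ l₀`. Nothing of weight `⪰ l` lies below it, so any
  -- functional in this degree defines a morphism to the proper costandard module.
  obtain ⟨d, ⟨l, hl, x, hxd, hx⟩, hmin⟩ := Int.exists_least_of_bdd ⟨b, fun z hz => by
    obtain ⟨m, -, x, hxz, hx⟩ := hz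
    by_contra hbz
    rw [hb z (by omega), Submodule.mem_bot] at hxz
    exact hx (by rw [hxz, smul_zero])⟩ h1
  have hlow : ∀ m, l₀ ≤ m → ∀ d' < d, ∀ y ∈ M.gr d', e m • y = 0 := by
    intro m hm d' hd' y hy
    by_contra hne
    exact absurd (hmin d' ⟨m, hm, y, hy, hne⟩) (by omega)
  obtain ⟨φ, hφ⟩ := not_forall.1 (mt (Module.forall_dual_apply_eq_zero_iff k (e l • x)).1 hx)
  obtain ⟨f, hf⟩ := h.exists_lift_properCostandard' l (-d) φ (fun i hi a ha m hm y hy => by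
    rw [hlow m (hl.trans hm) _ (by omega) y hy, smul_zero, smul_zero, map_zero])
  have hxd' := h.idem_smul_mem l hxd
  refine ⟨l, -d, f, e l • x, hl, by rwa [neg_neg], h.idem_smul_self l x, ?_, by rwa [neg_neg]⟩
  rw [hf, h.idem_smul_self, neg_neg, M.proj_of_mem hxd']
  exact hφ

/-- Splitting off one proper costandard quotient. -/
theorem RightOrthogonal.exists_hom [Finite Λ] {h : IsPositivelyGraded 𝒜 e}
    (hs : h.IsStandardlyStratified) {M : GMod 𝒜} (hM : M.IsBoundedBelow)
    (hR : h.RightOrthogonal M) {l₀ : Λ} (hmax : ∀ m, l₀ < m → ∀ x : M, e m • x = 0)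
    (hne : ∃ m, l₀ ≤ m ∧ ∃ x : M, e m • x ≠ 0) :
    ∃ (l : Λ) (j : ℤ) (f : M ⟶ (h.properCostandard l).shift j),
      Function.Surjective (lin f) ∧ h.RightOrthogonal (kerSub f).obj ∧
      (∃ x ∈ M.gr (-j), lin f x ≠ 0) ∧
      ∀ m, l₀ ≤ m → ∀ d < -j, ∀ y ∈ M.gr d, e m • y = 0 := by
  obtain ⟨l, j, f, x, hl, hxj, hlx, hfx, hlow⟩ := h.exists_hom_properCostandard hM hne
  have hlift : ∀ l' j' (g : (h.standard l').shift j' ⟶ (h.properCostandard l).shift j),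
      ∃ g', g' ≫ f = g := by
    intro l' j' g
    by_cases hg : g = 0
    · exact ⟨0, by rw [hg, zero_comp]⟩
    obtain ⟨rfl, rfl⟩ := eq_of_hom_ne_zero hs hg
    set z := lin g (h.genΔ l' j') with hz
    -- Chosen so that `f` maps `c • x` to a vector with the socle coordinate of `z`. For vectors of
    -- weight `l'` this coordinate decides equality.
    set c : k := h.ev l' j' z / h.ev l' j' (lin f x) with hc
    have hcx : c • x ∈ M.gr (-j') := (M.gr (-j')).smul_mem c hxj
    obtain ⟨g', hg'⟩ := h.exists_lift_standard l' (e l' • c • x) (h.idem_smul_mem l' hcx)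
      (h.idem_smul_self _ _) fun m hm => hmax m (hl.trans_lt hm)
    refine ⟨g', h.hom_standard_ext (sub_eq_zero.1 (h.eq_zero_of_ev le_rfl (m := l') ?_ ?_))⟩
    · rw [smul_sub, h.hom_standard_gen_idem, h.hom_standard_gen_idem]
    · rw [lin_comp_apply, hg', map_smul (lin f), ← hz, map_sub, h.ev_idem, lin_base_smul, map_smul,
        smul_eq_mul, div_mul_cancel₀ _ hfx, sub_self]
  refine ⟨l, j, f, hR.surjective hs f hlift, hR.ker hs f hlift, ⟨x, hxj, fun h0 => hfx ?_⟩, hlow⟩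
  rw [h0, map_zero]

/-- The set of weights of a module. -/
def weights (e : Λ → A) (M : GMod 𝒜) : Set Λ := {l | ∃ x : M, e l • x ≠ 0}

/-- One step of an iteration inside the fixed module `M`. The degree `n` measures progress: a vector
is lost in the lowest degree where the class still occurs, so by finite dimensionality the class is
eventually exhausted degree by degree. -/
theorem RightOrthogonal.exists_step [Finite Λ] {h : IsPositivelyGraded 𝒜 e}
    (hs : h.IsStandardlyStratified) {M : GMod 𝒜} (hM : M.IsBoundedBelow) {l₀ : Λ}
    (hmax : ∀ m, l₀ < m → ∀ x : M, e m • x = 0) (N : GSub M) (hN : h.RightOrthogonal N.obj) :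
    ∃ N' ≤ N, h.RightOrthogonal N'.obj ∧
      ((∀ m, l₀ ≤ m → ∀ x ∈ N.toSubmodule, e m • x = 0) → N' = N) ∧
      ((∃ m, l₀ ≤ m ∧ ∃ x ∈ N.toSubmodule, e m • x ≠ 0) →
        IsShiftOf h.properCostandard (N.subquot N') ∧
        ∃ n, (∃ x ∈ M.gr n, x ∈ N.toSubmodule ∧ x ∉ N'.toSubmodule) ∧
          ∀ m, l₀ ≤ m → ∀ d < n, ∀ y ∈ M.gr d, y ∈ N.toSubmodule → e m • y = 0) := by
  by_cases hne : ∃ m, l₀ ≤ m ∧ ∃ x ∈ N.toSubmodule, e m • x ≠ 0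
  · obtain ⟨l, j, f, hf, hR, ⟨x, hxj, hfx⟩, hlow⟩ := hN.exists_hom hs (hM.sub N) (l₀ := l₀)
      (fun m hm x => N.lin_incl_injective (by
        rw [map_smul, map_zero]
        exact hmax m hm _)) (by
        obtain ⟨m, hm, x, hx, hne⟩ := hne
        exact ⟨m, hm, (⟨x, hx⟩ : N.toSubmodule), fun h0 => hne (congrArg Subtype.val h0)⟩)
    have hmem : ∀ y : N.obj, lin N.incl y ∈ ((kerSub f).map N.incl).toSubmodule →
        lin f y = 0 := by
      rintro y ⟨z, hz, hzy⟩
      rw [← N.lin_incl_injective hzy]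
      exact hz
    refine ⟨(kerSub f).map N.incl, ?_, ?_, ?_, fun _ => ⟨?_, -j, ⟨lin N.incl x, hxj, x.2, ?_⟩, ?_⟩⟩
    · rintro _ ⟨y, -, rfl⟩
      exact y.2
    · obtain ⟨t⟩ := N.obj_map_incl_iso (kerSub f)
      exact fun j l => subsingleton_ext_of_iso_right t (hR j l)
    · intro h0
      obtain ⟨m, hm, x, hx, hne⟩ := hne
      exact absurd (h0 m hm x hx) hne
    · obtain ⟨t⟩ := N.quot_iso_subquot_map_incl (kerSub f)
      obtain ⟨s⟩ := nonempty_iso_of_ker_eq (kerSub f).proj f (kerSub f).lin_proj_surjective hf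
        fun x => Submodule.Quotient.mk_eq_zero _
      exact ⟨l, j, ⟨t ≪≫ s⟩⟩
    · exact fun h0 => hfx (hmem x h0)
    · intro m hm d hd y hy hyN
      exact congrArg Subtype.val (hlow m hm d hd (⟨y, hyN⟩ : N.toSubmodule) hy)
  -- Once the class is exhausted the iteration stays put, which allows finite filtrations.
  · exact ⟨N, le_rfl, hN, fun _ => rfl, fun h0 => absurd h0 hne⟩

/-- A right orthogonal module has a right orthogonal submodule without composition factors in a
given maximal class of weights, with quotient in `𝒞(∇̄)`. -/
theorem RightOrthogonal.exists_sub [Finite Λ] {h : IsPositivelyGraded 𝒜 e}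
    (hs : h.IsStandardlyStratified) {M : GMod 𝒜} (hM : M.IsBoundedBelow)
    (hR : h.RightOrthogonal M) {l₀ : Λ} (hmax : ∀ m, l₀ < m → ∀ x : M, e m • x = 0) :
    ∃ N : GSub M, h.RightOrthogonal N.obj ∧ InC h.properCostandard N.quot ∧
      ∀ m, l₀ ≤ m → ∀ x ∈ N.toSubmodule, e m • x = 0 := by
  choose step hle hstep h0 h1 using
    fun N : GSub M => RightOrthogonal.exists_step (N := N) hs hM hmax
  have hRtop : h.RightOrthogonal (⊤ : GSub M).obj := fun j l =>
    subsingleton_ext_of_iso_right (nonempty_top_iso M).some.symm (hR j l)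
  -- Orthogonality is carried along with the submodule, since the next step needs it.
  let F' : ℕ → {N : GSub M // h.RightOrthogonal N.obj} := fun i =>
    Nat.rec ⟨⊤, hRtop⟩ (fun _ N => ⟨step N.1 N.2, hstep N.1 N.2⟩) i
  let F : ℕ → GSub M := fun i => (F' i).1
  have hFR : ∀ i, h.RightOrthogonal (F i).obj := fun i => (F' i).2
  have hFs : ∀ i, F (i + 1) = step (F i) (hFR i) := fun i => rfl
  have hF0 : F 0 = ⊤ := rfl
  have hFle : ∀ i, F (i + 1) ≤ F i := fun i => hle _ _
  have hanti : Antitone F := antitone_nat_of_succ_le hFle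
  let N : GSub M := GSub.inter (Set.range F)
  have hmemN : ∀ x, x ∈ N.toSubmodule ↔ ∀ i, x ∈ (F i).toSubmodule := by
    intro x
    refine (Submodule.mem_iInf _).trans ⟨fun hx i => hx ⟨F i, i, rfl⟩, ?_⟩
    rintro hx ⟨_, i, rfl⟩
    exact hx i
  have hstat : ∀ n : ℤ, ∃ m, ∀ d ≤ n, ∀ x ∈ M.gr d, x ∈ (F m).toSubmodule →
      x ∈ N.toSubmodule := by
    intro n
    obtain ⟨m, hm⟩ := exists_stationary hM F hFle n
    refine ⟨m, fun d hd x hx hxm => (hmemN x).2 fun i => ?_⟩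
    rcases le_total m i with hi | hi
    · exact hm i hi d hd x hx hxm
    · exact hanti hi hxm
  have hproj : ∀ x : M, lin N.proj x = 0 ↔ x ∈ N.toSubmodule := fun x =>
    Submodule.Quotient.mk_eq_zero _
  have hdone : ∀ i, (∀ m, l₀ ≤ m → ∀ x ∈ (F i).toSubmodule, e m • x = 0) →
      ∀ x ∈ (F i).toSubmodule, x ∈ N.toSubmodule := by
    intro i hi x hx
    have : ∀ i' ≥ i, F i' = F i := by
      intro i' hi'
      induction i', hi' using Nat.le_induction with
      | base => rfl
      | succ n _ ih =>
        rw [hFs, h0 (F n) (hFR n) (by rwa [ih]), ih]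
    refine (hmemN x).2 fun i' => ?_
    rcases le_total i i' with hii | hii
    · rwa [this i' hii]
    · exact hanti hii hx
  have hkill : ∀ m, l₀ ≤ m → ∀ x ∈ N.toSubmodule, e m • x = 0 := by
    intro m hm x hx
    by_contra hne
    obtain ⟨d, hd⟩ := not_forall.1 (mt (eq_zero_of_proj M) hne)
    rw [h.proj_idem_smul] at hd
    obtain ⟨i, hi⟩ := hstat d
    -- If the class still occurred in degree `d` of `N`, the next step would remove some `y` of
    -- degree `n ≤ d` from `F i`. But `F i` agrees with `N` up to degree `d`, so `y` can never be
    -- removed.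
    obtain ⟨-, n, ⟨y, hyn, hy, hy'⟩, hlow⟩ := h1 (F i) (hFR i)
      ⟨m, hm, x, (hmemN x).1 hx i, hne⟩
    have hnd : n ≤ d := by
      by_contra hnd
      exact hd (hlow m hm d (by omega) _ (M.proj_mem d x)
        ((F i).homogeneous x ((hmemN x).1 hx i) d))
    exact hy' ((hmemN y).1 (hi n hnd y hyn hy) (i + 1))
  refine ⟨N, ?_, ⟨hM.quot N, fun i => (F i).map N.proj, ?_, fun i => GSub.map_mono _ (hFle i),
    fun i => ?_, fun n => ?_⟩, hkill⟩
  · intro j l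
    refine N.isSES.ext_one_sub_right (fun g => ?_) (hR j l)
    -- The generator of the standard module has degree `-j`, where `F m` and `N` agree. A lift of
    -- `g` modulo `F m`, available because `F m` is right orthogonal, is therefore already a lift
    -- modulo `N`.
    obtain ⟨m, hm⟩ := hstat (-j)
    obtain ⟨t, ht⟩ := N.isSES.exists_desc (F m).proj (hom_ext fun x =>
      (Submodule.Quotient.mk_eq_zero _).2 ((hmemN x.1).1 x.2 m))
    obtain ⟨s, hs'⟩ := (F m).isSES.exists_lifting (hFR m j l) (g ≫ t)
    refine ⟨s, h.hom_standard_ext (sub_eq_zero.1 ?_)⟩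
    obtain ⟨x, hx, hxg⟩ := exists_homogeneous_preimage N.proj N.lin_proj_surjective
      (h.hom_standard_gen_mem (s ≫ N.proj - g))
    have hsub : lin (s ≫ N.proj - g) (h.genΔ l j) =
        lin (s ≫ N.proj) (h.genΔ l j) - lin g (h.genΔ l j) := rfl
    rw [← hsub, ← hxg, hproj]
    refine hm _ le_rfl x hx ((Submodule.Quotient.mk_eq_zero _).1 ?_)
    change lin (F m).proj x = 0
    rw [← ht, lin_comp_apply, hxg, ← lin_comp_apply, Preadditive.sub_comp, Category.assoc, ht, hs',
      sub_self]
    rfl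
  · change (F 0).map N.proj = ⊤
    rw [hF0, GSub.map_top _ N.lin_proj_surjective]
  · by_cases hne : ∃ m, l₀ ≤ m ∧ ∃ x ∈ (F i).toSubmodule, e m • x ≠ 0
    · right
      obtain ⟨⟨l, j, ⟨f⟩⟩, -⟩ := h1 (F i) (hFR i) hne
      obtain ⟨t⟩ := GSub.subquot_map_iso N.proj (hFle i) fun x _ hx =>
        (hmemN x).1 ((hproj x).1 hx) (i + 1)
      exact ⟨l, j, ⟨t.symm ≪≫ f⟩⟩
    · left
      push Not at hne
      refine GSub.ext (eq_bot_iff.2 ?_)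
      rintro _ ⟨x, hx, rfl⟩
      exact (Submodule.mem_bot A).2 ((hproj x).2 (hdone i hne x hx))
  · obtain ⟨m, hm⟩ := hstat n
    refine ⟨m, fun i hi d hd => (GSub.obj_gr_eq_bot _ _).2 ?_⟩
    rintro _ ⟨x, hx, rfl⟩ hxd
    rw [← N.quot.proj_of_mem hxd, ← lin_proj, hproj]
    exact hm d hd _ (M.proj_mem d x) (hanti hi ((F i).homogeneous x hx d))

/-- Induction on the set of weights. -/
theorem weights_induction [Finite Λ] (h : IsPositivelyGraded 𝒜 e) {R : GMod 𝒜 → Prop}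
    (h0 : ∀ M : GMod 𝒜, (∀ x : M, x = 0) → R M)
    (hR : ∀ (M : GMod 𝒜) (l₀ : Λ), (∀ m, l₀ < m → ∀ x : M, e m • x = 0) →
      (∀ N : GMod 𝒜, (∀ l, (∀ x : M, e l • x = 0) → ∀ x : N, e l • x = 0) →
        (∀ x : N, e l₀ • x = 0) → R N) → R M) (M : GMod 𝒜) : R M := by
  induction hn : (weights e M).ncard using Nat.strong_induction_on generalizing M with
  | _ n ih =>
    subst hn
    by_cases hM : (weights e M).Nonempty
    · obtain ⟨l₀, hl₀⟩ := (Set.toFinite (weights e M)).exists_maximal hM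
      refine hR M l₀ (fun m hm x => ?_) fun N hN hN' => ih _ ?_ N rfl
      · by_contra hne
        exact hm.not_ge (hl₀.2 ⟨x, hne⟩ hm.le)
      · refine Set.ncard_lt_ncard ⟨fun l hl => ?_, fun hsub => ?_⟩ (Set.toFinite _)
        · obtain ⟨x, hx⟩ := hl
          by_contra hl
          exact hx (hN l (fun y => by
            by_contra hy
            exact hl ⟨y, hy⟩) x)
        · obtain ⟨x, hx⟩ := hsub hl₀.1
          exact hx (hN' x)
    · refine h0 M fun x => h.eq_zero_of_idem_smul fun l => ?_
      by_contra hx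
      exact hM ⟨l, x, hx⟩

theorem RightOrthogonal.inFDown [Finite Λ] {h : IsPositivelyGraded 𝒜 e}
    (hs : h.IsStandardlyStratified) {M : GMod 𝒜} (hM : M.IsBoundedBelow)
    (hR : h.RightOrthogonal M) : InFDown h.properCostandard M := by
  refine ⟨hM, ?_⟩
  revert hM hR
  refine h.weights_induction (R := fun M => M.IsBoundedBelow → h.RightOrthogonal M →
    HasFiniteFiltration (InC h.properCostandard) M) (fun M h0 _ _ => .of_forall_eq_zero h0)
    (fun M l₀ hmax ih hM hR => ?_) M
  obtain ⟨N, hN, hQ, hkill⟩ := hR.exists_sub hs hM hmax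
  refine .of_sub_of_quot (fun X Y f => InC.of_iso f) N ?_
    (.single (fun X Y f => InC.of_iso f) hQ)
  refine ih N.obj (fun l hl x => Subtype.ext (hl x.1)) (fun x => Subtype.ext ?_) (hM.sub N) hN
  exact hkill l₀ le_rfl x.1 x.2

end IsPositivelyGraded

namespace GMod

section DirectSums

variable {k A : Type u} [Field k] [Ring A] [Algebra k A] {𝒜 : ℤ → Submodule k A}

/-! ### Locally finite direct sums -/

open Classical in
/-- The direct sum of a family of graded modules, only finitely many of which are nonzero in each
degree. -/
def dsum {B : Type} (N : B → GMod 𝒜) (hN : ∀ d, {b | (N b).gr d ≠ ⊥}.Finite) : GMod 𝒜 where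
  carrier := Π₀ b, N b
  gr d :=
    { carrier := {x | ∀ b, x b ∈ (N b).gr d}
      zero_mem' := fun b => zero_mem _
      add_mem' := fun hx hy b => add_mem (hx b) (hy b)
      smul_mem' := fun c x hx b => ((N b).gr d).smul_mem c (hx b) }
  isInternal := by
    refine isInternal_of_proj _ (fun d => DFinsupp.mapRange.linearMap fun b => (N b).proj d)
      ?_ ?_ ?_
    · intro d x hx
      ext b
      exact (N b).proj_of_mem (hx b)
    · intro i j x hx hij
      ext b
      exact (N b).proj_of_ne (hx b) hij
    · rw [eq_top_iff]
      rintro x -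
      induction x using DFinsupp.induction with
      | h0 => exact zero_mem _
      | ha b y f _ hy hf =>
        refine add_mem ?_ hf
        clear hy
        induction y using (N b).induction_on with
        | hom d y hy =>
          refine Submodule.mem_iSup_of_mem d fun b' => ?_
          rcases eq_or_ne b b' with rfl | hb
          · rwa [DFinsupp.single_eq_same]
          · rw [DFinsupp.single_eq_of_ne hb.symm]
            exact zero_mem _
        | zero => rw [DFinsupp.single_zero]; exact zero_mem _
        | add y z hy hz => rw [DFinsupp.single_add]; exact add_mem hy hz
  smul_mem i j a x ha hx b := (N b).smul_mem i j a _ ha (hx b)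
  finite d := by
    have := (hN d).to_subtype
    have := fun b => (N b).finite d
    let p : Submodule k (Π₀ b, N b) :=
      { carrier := {x | ∀ b, x b ∈ (N b).gr d}
        zero_mem' := fun b => zero_mem _
        add_mem' := fun hx hy b => add_mem (hx b) (hy b)
        smul_mem' := fun c x hx b => ((N b).gr d).smul_mem c (hx b) }
    let f : p →ₗ[k] (∀ b : {b | (N b).gr d ≠ ⊥}, (N b).gr d) :=
      { toFun := fun x b => ⟨_, x.2 b.1⟩
        map_add' := fun x y => rfl
        map_smul' := fun c x => rfl }
    refine Module.Finite.of_injective f ?_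
    intro x y hxy
    refine Subtype.ext (DFinsupp.ext fun b => ?_)
    by_cases hb : (N b).gr d = ⊥
    · have hx := x.2 b
      have hy := y.2 b
      rw [hb, Submodule.mem_bot] at hx hy
      rw [hx, hy]
    · exact congrArg Subtype.val (congrFun hxy ⟨b, hb⟩)

variable {B : Type} {N : B → GMod 𝒜} (hN : ∀ d, {b | (N b).gr d ≠ ⊥}.Finite)

open Classical in
/-- The inclusion of a summand. -/
noncomputable def dsumι (b : B) : N b ⟶ dsum N hN :=
  mkHom (N := dsum N hN) (DFinsupp.lsingle (R := A) (M := fun b => (N b).carrier) b) (fun i x hx b' => by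
    change (DFinsupp.single (β := fun b => (N b).carrier) b x) b' ∈ (N b').gr i
    rcases eq_or_ne b b' with rfl | hb
    · rwa [DFinsupp.single_eq_same]
    · rw [DFinsupp.single_eq_of_ne hb.symm]
      exact zero_mem _)

/-- The projection to a summand. -/
def dsumπ (b : B) : dsum N hN ⟶ N b :=
  mkHom (M := dsum N hN) (DFinsupp.lapply (R := A) (M := fun b => (N b).carrier) b) (fun _ _ hx => hx b)

theorem dsum_ext {x y : dsum N hN} (h : ∀ b, lin (dsumπ hN b) x = lin (dsumπ hN b) y) : x = y :=
  DFinsupp.ext h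

theorem dsumπ_ι_self (b : B) (x : N b) : lin (dsumπ hN b) (lin (dsumι hN b) x) = x := by
  classical
  exact DFinsupp.single_eq_same (β := fun b => N b)

theorem dsumπ_ι_of_ne {b b' : B} (hb : b ≠ b') (x : N b) :
    lin (dsumπ hN b') (lin (dsumι hN b) x) = 0 := by
  classical
  exact DFinsupp.single_eq_of_ne (β := fun b => N b) hb.symm

theorem dsum_induction {p : dsum N hN → Prop} (x : dsum N hN) (zero : p 0)
    (ι : ∀ b (y : N b), p (lin (dsumι hN b) y)) (add : ∀ x y, p x → p y → p (x + y)) : p x := by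
  classical
  have key : ∀ x : Π₀ b, N b, p x := by
    intro x
    induction x using DFinsupp.induction with
    | h0 => exact zero
    | ha b y f _ _ hf => exact add _ _ (ι b y) hf
  exact key x

theorem dsum_hom_ext {X : GMod 𝒜} {f g : dsum N hN ⟶ X}
    (h : ∀ b, dsumι hN b ≫ f = dsumι hN b ≫ g) : f = g :=
  hom_ext fun x => by
    induction x using dsum_induction hN with
    | zero => simp
    | ι b y => exact congrArg (fun t => lin t y) (h b)
    | add x y hx hy => rw [map_add, map_add, hx, hy]

theorem exists_dsum_desc {X : GMod 𝒜} (f : ∀ b, N b ⟶ X) :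
    ∃ g : dsum N hN ⟶ X, ∀ b, dsumι hN b ≫ g = f b := by
  classical
  let T : (Π₀ b, N b) →ₗ[A] X := DFinsupp.lsum ℕ fun b => lin (f b)
  refine ⟨mkHom (M := dsum N hN) T ?_, fun b => hom_ext fun x => ?_⟩
  · intro d x hx
    let y : Π₀ b, N b := x
    change T y ∈ X.gr d
    rw [DFinsupp.lsum_apply_apply, DFinsupp.sumAddHom_apply]
    exact Submodule.sum_mem _ fun b _ => lin_mem (f b) (hx b)
  · exact DFinsupp.lsum_single (R := A) ℕ (M := fun b => (N b).carrier) (fun b => lin (f b)) b x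

theorem dsum_gr_eq_bot {d : ℤ} (h : ∀ b, (N b).gr d = ⊥) : (dsum N hN).gr d = ⊥ := by
  refine (Submodule.eq_bot_iff _).2 fun x hx => dsum_ext hN fun b => ?_
  have h1 := lin_mem (dsumπ hN b) hx
  rw [h b, Submodule.mem_bot] at h1
  rw [h1, map_zero]

theorem projective_dsum (h : ∀ b, Projective (N b)) : Projective (dsum N hN) where
  factors {E X} f g _ := by
    choose s hs using fun b => (h b).factors (dsumι hN b ≫ f) g
    obtain ⟨t, ht⟩ := exists_dsum_desc hN s
    exact ⟨t, dsum_hom_ext hN fun b => by rw [← Category.assoc, ht, hs]⟩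

/-- An injective enumeration onto an initial segment. -/
theorem exists_enumeration (B : Type) [Countable B] :
    ∃ c : B → ℕ, Function.Injective c ∧ ∀ b i, i ≤ c b → ∃ b', c b' = i := by
  cases finite_or_infinite B
  · refine ⟨fun b => (Finite.equivFin B b : ℕ), fun b b' hb => ?_, fun b i hi => ?_⟩
    · exact (Finite.equivFin B).injective (Fin.ext hb)
    · exact ⟨(Finite.equivFin B).symm ⟨i, hi.trans_lt (Fin.is_lt _)⟩, by simp⟩
  · obtain ⟨_⟩ := nonempty_denumerable B
    exact ⟨Denumerable.eqv B, (Denumerable.eqv B).injective, fun _ i _ =>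
      ⟨(Denumerable.eqv B).symm i, by simp⟩⟩

/-- A direct sum of shifts of members of `S`, generated in degrees tending to infinity, belongs to
`𝒞(S)`. -/
theorem inC_dsum [Countable B] {Λ : Type v} {S : Λ → GMod 𝒜} (hS : ∀ b, IsShiftOf S (N b))
    (hb : (dsum N hN).IsBoundedBelow)
    (hfin : ∀ n : ℤ, {b | ∃ d ≤ n, (N b).gr d ≠ ⊥}.Finite) : InC S (dsum N hN) := by
  obtain ⟨c, hc, hc'⟩ := exists_enumeration B
  -- The elements whose components numbered below `i` vanish; consecutive terms differ by one
  -- summand.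
  let F : ℕ → GSub (dsum N hN) := fun i =>
    { toSubmodule := ⨅ b, ⨅ _ : c b < i, LinearMap.ker (lin (dsumπ hN b))
      homogeneous := fun x hx d => by
        simp only [Submodule.mem_iInf, LinearMap.mem_ker] at hx ⊢
        intro b hb
        rw [lin_proj, hx b hb, map_zero] }
  have hF : ∀ i x, x ∈ (F i).toSubmodule ↔ ∀ b, c b < i → lin (dsumπ hN b) x = 0 := by
    intro i x
    simp only [F, Submodule.mem_iInf, LinearMap.mem_ker]
  refine ⟨hb, F, ?_, fun i x hx => ?_, fun i => ?_, fun n => ?_⟩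
  · refine GSub.ext (eq_top_iff.2 fun x _ => (hF 0 x).2 fun b hb => absurd hb (Nat.not_lt_zero _))
  · exact (hF i x).2 fun b hb => (hF _ x).1 hx b (hb.trans (Nat.lt_succ_self i))
  -- If `i` is not a value of `c`, every summand is numbered below `i`, since the values form an
  -- initial segment; then `F i` is zero.
  · by_cases hi : ∃ b, c b = i
    · obtain ⟨b, rfl⟩ := hi
      right
      obtain ⟨l, j, ⟨f⟩⟩ := hS b
      obtain ⟨t⟩ := nonempty_iso_of_ker_eq ((F (c b)).subquotProj (F (c b + 1)))
        ((F (c b)).incl ≫ dsumπ hN b) (GSub.subquotProj_surjective _ _) (fun y => by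
          refine ⟨(⟨lin (dsumι hN b) y, (hF _ _).2 fun b' hb' => ?_⟩ : (F (c b)).toSubmodule),
            dsumπ_ι_self hN b y⟩
          exact dsumπ_ι_of_ne hN (by rintro rfl; exact lt_irrefl _ hb') y) (fun x => by
          refine ((F (c b)).subquotProj_eq_zero _ x).trans ((hF _ _).trans ⟨fun hx =>
            hx b (Nat.lt_succ_self _), fun hx b' hb' => ?_⟩)
          rcases (Nat.lt_succ_iff.1 hb').lt_or_eq with hlt | heq
          · exact (hF _ _).1 x.2 b' hlt
          · rw [hc heq]; exact hx)
      exact ⟨l, j, ⟨t ≪≫ f⟩⟩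
    · left
      refine GSub.ext (eq_bot_iff.2 fun x hx => (Submodule.mem_bot A).2 (dsum_ext hN fun b => ?_))
      rw [map_zero]
      refine (hF i x).1 hx b ?_
      by_contra hlt
      exact hi (hc' b i (not_lt.1 hlt))
  · refine ⟨(hfin n).toFinset.sup c + 1, fun i hi d hd => (GSub.obj_gr_eq_bot _ _).2
      fun x hx hxd => dsum_ext hN fun b => ?_⟩
    rw [map_zero]
    by_cases hbd : (N b).gr d = ⊥
    · have h1 := lin_mem (dsumπ hN b) hxd
      rwa [hbd, Submodule.mem_bot] at h1
    · refine (hF i x).1 hx b (lt_of_lt_of_le (Nat.lt_succ_of_le ?_) hi)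
      exact Finset.le_sup (f := c) ((hfin n).mem_toFinset.2 ⟨d, hd, hbd⟩)

end DirectSums

end GMod

namespace IsPositivelyGraded

open GMod Abelian

variable {k A : Type u} [Field k] [Ring A] [Algebra k A]
  {𝒜 : ℤ → Submodule k A} {Λ : Type v} {e : Λ → A}
variable [GradedAlgebra 𝒜]

/-! ### Projective covers and vanishing of extensions for degree reasons -/

/-- The generator of `A⟨j⟩`. -/
def regularGen (h : IsPositivelyGraded 𝒜 e) (j : ℤ) : h.regular.shift j :=
  h.regular.sh j (show h.regular from (1 : A))

theorem exists_lift_regular (h : IsPositivelyGraded 𝒜 e) {M : GMod 𝒜} {j : ℤ} {x : M}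
    (hx : x ∈ M.gr (-j)) :
    ∃ f : h.regular.shift j ⟶ M, lin f (h.regularGen j) = x := by
  refine ⟨mkHom (M := h.regular.shift j) (LinearMap.toSpanSingleton A M x : A →ₗ[A] M) ?_,
    one_smul A x⟩
  intro i a ha
  have := M.smul_mem _ _ _ _ (show (show A from a) ∈ 𝒜 (j + i) from ha) hx
  rwa [show j + i + -j = i by ring] at this

theorem regular_gen_mem (h : IsPositivelyGraded 𝒜 e) (j : ℤ) :
    h.regularGen j ∈ (h.regular.shift j).gr (-j) := by
  rw [regularGen, sh_mem, add_neg_cancel]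
  exact SetLike.one_mem_graded 𝒜

instance projective_regular (h : IsPositivelyGraded 𝒜 e) (j : ℤ) :
    Projective (h.regular.shift j) where
  factors {E X} f g _ := by
    obtain ⟨x, hx, hxy⟩ := exists_homogeneous_preimage g (surjective_of_epi g)
      (lin_mem f (h.regular_gen_mem j))
    obtain ⟨t, ht⟩ := h.exists_lift_regular hx
    refine ⟨t, hom_ext fun a => ?_⟩
    have ha : a = (show A from a) • h.regularGen j := (mul_one (show A from a)).symm
    rw [ha, map_smul, map_smul, lin_comp_apply, ht, hxy]

/-- One shifted copy of `A` for each basis vector of each component of `X`. No minimality is needed: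
`A` is nonnegatively graded, so nothing appears below the degrees of these vectors, and
bounded-below support keeps the sum locally finite. -/
theorem exists_projective_cover (h : IsPositivelyGraded 𝒜 e) {X : GMod 𝒜} {n : ℤ}
    (hX : ∀ d ≤ n, X.gr d = ⊥) :
    ∃ (P : GMod 𝒜) (f : P ⟶ X), Projective P ∧ Function.Surjective (lin f) ∧
      ∀ d ≤ n, P.gr d = ⊥ := by
  let B : Type := Σ d : ℤ, Fin (Module.finrank k (X.gr d))
  have hB : ∀ b : B, n < b.1 := by
    rintro ⟨d, i⟩
    by_contra hd
    have h0 := hX d (not_lt.1 hd)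
    have : Module.finrank k (X.gr d) = 0 := by rw [h0]; exact finrank_bot k X
    exact absurd i.2 (by omega)
  have hgr : ∀ (b : B) d, d < b.1 → (h.regular.shift (-b.1)).gr d = ⊥ := fun b d hd =>
    h.eq_bot _ (by omega)
  have hfin : ∀ m, {b : B | b.1 ≤ m}.Finite := by
    intro m
    refine ((Set.finite_Icc n m).biUnion (t := fun d => Set.range (Sigma.mk d : _ → B))
      fun d _ => Set.finite_range _).subset ?_
    rintro ⟨d, i⟩ hd
    exact Set.mem_biUnion (x := d) ⟨(hB ⟨d, i⟩).le, hd⟩ ⟨i, rfl⟩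
  have hN : ∀ d, {b : B | (h.regular.shift (-b.1)).gr d ≠ ⊥}.Finite := fun d =>
    (hfin d).subset fun b hb => by
      by_contra hbd
      exact hb (hgr b d (not_le.1 hbd))
  let v : ∀ d, Module.Basis (Fin (Module.finrank k (X.gr d))) k (X.gr d) := fun d =>
    have := X.finite d
    Module.finBasis k (X.gr d)
  choose s hs using fun b : B => h.exists_lift_regular (M := X) (j := -b.1) (x := (v b.1 b.2).1)
    (by rw [neg_neg]; exact (v b.1 b.2).2)
  obtain ⟨f, hf⟩ := exists_dsum_desc hN s
  refine ⟨dsum _ hN, f, projective_dsum hN fun b => inferInstance, fun y => ?_, fun d hd =>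
    dsum_gr_eq_bot hN fun b => hgr b d (hd.trans_lt (hB b))⟩
  change y ∈ LinearMap.range ((lin f).restrictScalars k)
  induction y using X.induction_on with
  | hom d y hy =>
    have h1 : (⊤ : Submodule k (X.gr d)) ≤
        (LinearMap.range ((lin f).restrictScalars k)).comap (X.gr d).subtype := by
      rw [← (v d).span_eq, Submodule.span_le]
      rintro _ ⟨i, rfl⟩
      refine ⟨lin (dsumι hN ⟨d, i⟩) (h.regularGen _), ?_⟩
      change lin f _ = _
      rw [← lin_comp_apply, hf, hs]
      rfl
    exact h1 (show (⟨y, hy⟩ : X.gr d) ∈ ⊤ from trivial)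
  | zero => exact zero_mem _
  | add x y hx hy => exact add_mem hx hy

/-- Dimension shift with projectives supported in degrees above `n`: every syzygy stays above `n`,
where `Y` vanishes. -/
theorem subsingleton_ext_of_degrees (h : IsPositivelyGraded 𝒜 e) {n : ℤ} {Y : GMod 𝒜}
    (hY : ∀ d > n, Y.gr d = ⊥) (m : ℕ) {X : GMod 𝒜} (hX : ∀ d ≤ n, X.gr d = ⊥) :
    Subsingleton (Ext X Y m) := by
  induction m generalizing X with
  | zero =>
    refine subsingleton_ext_zero fun f => hom_ext fun x => ?_
    change lin f x = 0
    induction x using X.induction_on with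
    | hom d x hx =>
      rcases le_or_gt d n with hd | hd
      · rw [eq_zero_of_mem_gr hX hd hx, map_zero]
      · have := lin_mem f hx
        rwa [hY d hd, Submodule.mem_bot] at this
    | zero => exact map_zero _
    | add x y hx hy => rw [map_add, hx, hy, add_zero]
  | succ m ih =>
    obtain ⟨P, f, hP, hf, hPn⟩ := h.exists_projective_cover hX
    refine (isSES_kerSub f hf).ext_quot_left (ih fun d hd => ?_)
      (Ext.subsingleton_of_projective _ _ _)
    rw [GSub.obj_gr_eq_bot]
    exact fun x _ hx => eq_zero_of_mem_gr hPn hd hx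

end IsPositivelyGraded

namespace IsPositivelyGraded

open GMod Abelian

variable {k A : Type u} [Field k] [Ring A] [Algebra k A]
  {𝒜 : ℤ → Submodule k A} {Λ : Type v} {e : Λ → A}
variable [GradedAlgebra 𝒜] [Preorder Λ]

/-! ### Modules with a standard filtration are left orthogonal -/

/-- `M` satisfies `ext¹(M, ∇̄(λ)⟨j⟩) = 0` for all `λ` and `j`. -/
def LeftOrthogonal (h : IsPositivelyGraded 𝒜 e) (M : GMod 𝒜) : Prop :=
  ∀ (j : ℤ) (l : Λ), Subsingleton (Ext M ((h.properCostandard l).shift j) 1)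

/-- `∇̄(l)⟨j⟩` is zero above degree `-j`, so a tail supported there has no extensions by it. The
finitely many remaining layers are standard. -/
theorem subsingleton_ext_of_inC {h : IsPositivelyGraded 𝒜 e} (hs : h.IsStandardlyStratified)
    {M : GMod 𝒜} (hM : InC h.standard M) (n : ℕ) (j : ℤ) (l : Λ) :
    Subsingleton (Ext M ((h.properCostandard l).shift j) (n + 1)) := by
  obtain ⟨-, F, hF0, hF1, hF2, hF3⟩ := hM
  obtain ⟨N, hN⟩ := hF3 (-j)
  have key := filtration_induction
    (R := fun X => Subsingleton (Ext X ((h.properCostandard l).shift j) (n + 1)))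
    (fun _ _ _ _ _ hfg => hfg.ext_mid_left) F N (fun i _ => ⟨hF1 i, ?_⟩)
    (h.subsingleton_ext_of_degrees (n := -j)
      (fun d hd => (Submodule.eq_bot_iff _).2 fun _ hx => h.mem_gr_eq_zero hd hx) _ (hN N le_rfl))
  · rw [hF0] at key
    exact subsingleton_ext_of_iso_left (nonempty_top_iso M).some key
  · rcases hF2 i with hi | ⟨m, i', ⟨f⟩⟩
    · exact subsingleton_ext_of_isZero_left (isZero_of_subsingleton _ (subquot_eq_zero hi)) _
    · exact subsingleton_ext_of_iso_left f.symm
        (subsingleton_ext_standard_properCostandard hs m l i' j n)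

theorem subsingleton_ext_of_hasFiniteFiltration {h : IsPositivelyGraded 𝒜 e}
    (hs : h.IsStandardlyStratified) {M : GMod 𝒜} (hM : HasFiniteFiltration (InC h.standard) M)
    (n : ℕ) (j : ℤ) (l : Λ) :
    Subsingleton (Ext M ((h.properCostandard l).shift j) (n + 1)) :=
  hM.induction (R := fun X => Subsingleton (Ext X ((h.properCostandard l).shift j) (n + 1)))
    (fun X hX => subsingleton_ext_of_isZero_left (isZero_of_subsingleton X hX) _)
    (fun _ _ _ _ _ hfg => hfg.ext_mid_left)
    (fun _ hX => subsingleton_ext_of_inC hs hX n j l)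

/-! ### Left orthogonal modules have a standard filtration -/

/-- Finitely many vectors of `V` that form a basis of the image of `V` modulo `R`. -/
theorem exists_relative_basis {V : Type u} [AddCommGroup V] [Module k V] (W R : Submodule k V)
    [Module.Finite k W] : ∃ (n : ℕ) (b : Fin n → V), (∀ i, b i ∈ W) ∧
      W ≤ Submodule.span k (Set.range b) ⊔ R ∧
      ∀ c : Fin n → k, ∃ φ : V →ₗ[k] k, (∀ x ∈ R, φ x = 0) ∧ ∀ i, φ (b i) = c i := by
  -- Lifting a basis of the image in `V / R` gives spanning modulo `R`, and independence modulo `R`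
  -- gives functionals with prescribed values.
  let v := Module.finBasis k (W.map R.mkQ)
  choose b hbW hb using fun i => (v i).2
  refine ⟨_, b, hbW, fun x hx => ?_, fun c => ?_⟩
  · have h1 : (⊤ : Submodule k (W.map R.mkQ)) ≤
        ((Submodule.span k (Set.range b)).map R.mkQ).comap (W.map R.mkQ).subtype := by
      rw [← v.span_eq, Submodule.span_le]
      rintro _ ⟨i, rfl⟩
      exact ⟨b i, Submodule.subset_span ⟨i, rfl⟩, hb i⟩
    obtain ⟨y, hy, hyx⟩ := h1 (show (⟨R.mkQ x, x, hx, rfl⟩ : W.map R.mkQ) ∈ ⊤ from trivial)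
    have h2 : x - y ∈ R := by
      rw [← Submodule.Quotient.mk_eq_zero, Submodule.Quotient.mk_sub, sub_eq_zero]
      exact hyx.symm
    rw [← add_sub_cancel y x]
    exact Submodule.add_mem_sup hy h2
  · obtain ⟨ψ, hψ⟩ := LinearMap.exists_extend (v.constr k c)
    refine ⟨ψ ∘ₗ R.mkQ, fun x hx => ?_, fun i => ?_⟩
    · rw [LinearMap.comp_apply, Submodule.mkQ_apply, (Submodule.Quotient.mk_eq_zero R).2 hx,
        map_zero]
    · rw [LinearMap.comp_apply, hb]
      exact (congrArg (fun t => t (v i)) hψ).trans (v.constr_basis k c i)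

/-- The span of all products of elements of positive degree with elements whose weight is at least
`λ`. -/
def decomposables (𝒜 : ℤ → Submodule k A) (e : Λ → A) (M : GMod 𝒜) (l₀ : Λ) : Submodule k M :=
  Submodule.span k {x | ∃ i > 0, ∃ a ∈ 𝒜 i, ∃ m, l₀ ≤ m ∧ ∃ y : M, x = a • e m • y}

/-- A minimal system of generators for the part of `M` of weights at least `λ`. -/
structure IsGenerators (e : Λ → A) (M : GMod 𝒜) (l₀ : Λ) {B : Type} (wt : B → Λ) (deg : B → ℤ)
    (vec : B → M) : Prop where
  le : ∀ b, l₀ ≤ wt b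
  mem : ∀ b, vec b ∈ M.gr (deg b)
  idem : ∀ b, e (wt b) • vec b = vec b
  finite : ∀ n, {b | deg b ≤ n}.Finite
  exists_functional : ∀ (c : B → k) (m : Λ) (d : ℤ), ∃ φ : M →ₗ[k] k,
    (∀ x ∈ decomposables 𝒜 e M l₀, φ x = 0) ∧ ∀ b, wt b = m → deg b = d → φ (vec b) = c b
  le_span : ∀ m, l₀ ≤ m → ∀ d, ∀ x ∈ M.gr d, e m • x = x →
    x ∈ Submodule.span k (Set.range vec) ⊔ decomposables 𝒜 e M l₀

omit [GradedAlgebra 𝒜] in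
-- Generators are chosen separately for each weight and degree, as a basis modulo decomposables.
-- Functionals need prescribed values only within one weight and degree, since a morphism to
-- `∇̄(l)⟨j⟩` sees nothing else.
theorem exists_generators [Finite Λ] {M : GMod 𝒜}
    (hM : M.IsBoundedBelow) (l₀ : Λ) :
    ∃ (B : Type) (_ : Countable B) (wt : B → Λ) (deg : B → ℤ) (vec : B → M),
      IsGenerators e M l₀ wt deg vec := by
  let E := Finite.equivFin Λ
  let W : Λ → ℤ → Submodule k M := fun m d =>
    { carrier := {x | x ∈ M.gr d ∧ e m • x = x}
      zero_mem' := ⟨zero_mem _, smul_zero _⟩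
      add_mem' := fun {x y} hx hy => ⟨add_mem hx.1 hy.1, by rw [smul_add, hx.2, hy.2]⟩
      smul_mem' := fun c x hx => ⟨(M.gr d).smul_mem c hx.1, by
        rw [← algebraMap_smul A c x, smul_smul, ← Algebra.commutes, mul_smul, hx.2]⟩ }
  have hW : ∀ m d, Module.Finite k (W m d) := fun m d =>
    have := M.finite d
    Submodule.finiteDimensional_of_le (S₂ := M.gr d) fun x hx => hx.1
  choose n b hbW hspan hφ using fun m d =>
    have := hW m d
    exists_relative_basis (W m d) (decomposables 𝒜 e M l₀)
  -- Replacing `Λ` by `Fin` keeps the index set in `Type` and makes it countable.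
  let T : Type := {p : Fin (Nat.card Λ) × ℤ // l₀ ≤ E.symm p.1}
  let B : Type := Σ p : T, Fin (n (E.symm p.1.1) p.1.2)
  refine ⟨B, inferInstance, fun x => E.symm x.1.1.1, fun x => x.1.1.2, fun x => b _ _ x.2,
    fun x => x.1.2, fun x => (hbW _ _ x.2).1, fun x => (hbW _ _ x.2).2, fun N => ?_,
    fun c m d => ?_, fun m hm d x hx hmx => ?_⟩
  · obtain ⟨β, hβ⟩ := hM
    have hlow : ∀ x : B, β ≤ x.1.1.2 := by
      intro x
      by_contra hx
      have h0 : b _ _ x.2 = 0 := by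
        have := (hbW _ _ x.2).1
        rwa [hβ _ (not_le.1 hx), Submodule.mem_bot] at this
      -- A functional with value `1` on the chosen vector shows that it is nonzero, so its degree is
      -- at least the lower bound of `M`.
      obtain ⟨φ, -, hφ1⟩ := hφ (E.symm x.1.1.1) x.1.1.2 fun _ => 1
      have := hφ1 x.2
      rw [h0, map_zero] at this
      exact zero_ne_one this
    have hT : {p : T | p.1.2 ∈ Set.Icc β N}.Finite := by
      refine Set.Finite.preimage Subtype.val_injective.injOn
        (s := {p : Fin (Nat.card Λ) × ℤ | p.2 ∈ Set.Icc β N}) ?_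
      refine (Set.finite_univ.prod (Set.finite_Icc β N)).subset fun p hp => ⟨trivial, hp⟩
    refine (hT.biUnion (t := fun p => Set.range (Sigma.mk p : _ → B))
      fun p _ => Set.finite_range _).subset ?_
    rintro ⟨p, i⟩ hp
    exact Set.mem_biUnion (x := p) ⟨hlow ⟨p, i⟩, hp⟩ ⟨i, rfl⟩
  · by_cases hm : l₀ ≤ m
    · have hm' : l₀ ≤ E.symm (E m) := by rwa [E.symm_apply_apply]
      obtain ⟨φ, hφ0, hφ1⟩ := hφ (E.symm (E m)) d fun i => c ⟨⟨(E m, d), hm'⟩, i⟩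
      refine ⟨φ, hφ0, ?_⟩
      rintro ⟨⟨⟨p, d'⟩, hp⟩, i⟩ hpm hd
      obtain rfl : p = E m := by
        rw [← hpm, E.apply_symm_apply]
      obtain rfl : d' = d := hd
      exact hφ1 i
    · refine ⟨0, fun _ _ => rfl, ?_⟩
      rintro x rfl
      exact absurd x.1.2 hm
  · have hm' : l₀ ≤ E.symm (E m) := by rwa [E.symm_apply_apply]
    have hxW : x ∈ W (E.symm (E m)) d := ⟨hx, by rwa [E.symm_apply_apply]⟩
    have hle : Set.range (b (E.symm (E m)) d) ⊆ Set.range fun x : B => b _ _ x.2 := by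
      rintro _ ⟨i, rfl⟩
      exact ⟨⟨⟨(E m, d), hm'⟩, i⟩, rfl⟩
    have hle' := sup_le_sup_right (Submodule.span_mono (R := k) hle) (decomposables 𝒜 e M l₀)
    exact hle' (hspan _ _ hxW)

omit [GradedAlgebra 𝒜] in
-- For `a` of degree `i > 0`, the part of degree `d` of `a • e m • y` is `a` times a vector of the
-- lower degree `d - i`.
theorem proj_mem_of_mem_decomposables (h : IsPositivelyGraded 𝒜 e) {M : GMod 𝒜} {l₀ : Λ}
    (T : GSub M) {d : ℤ}
    (hT : ∀ d' < d, ∀ m, l₀ ≤ m → ∀ x ∈ M.gr d', e m • x ∈ T.toSubmodule) {x : M}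
    (hx : x ∈ decomposables 𝒜 e M l₀) : M.proj d x ∈ T.toSubmodule := by
  change M.proj d x ∈ T.toSubmodule.restrictScalars k
  induction hx using Submodule.span_induction with
  | mem x hx =>
    obtain ⟨i, hi, a, ha, m, hm, y, rfl⟩ := hx
    have h1 := M.proj_smul ha (d - i) (e m • y)
    rw [add_sub_cancel, h.proj_idem_smul] at h1
    rw [h1]
    exact T.toSubmodule.smul_mem a (hT _ (by omega) m hm _ (M.proj_mem _ _))
  | zero => rw [map_zero]; exact zero_mem _
  | add x y _ _ hx hy => rw [map_add]; exact add_mem hx hy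
  | smul c x _ hx => rw [map_smul]; exact Submodule.smul_mem _ c hx

omit [GradedAlgebra 𝒜] in
-- A graded Nakayama argument: modulo the generators, a vector is decomposable, hence built from
-- vectors of lower degree. The induction is on the distance to the lower bound of `M`.
theorem idem_smul_mem_of_generators (h : IsPositivelyGraded 𝒜 e) {M : GMod 𝒜}
    (hM : M.IsBoundedBelow) {l₀ : Λ} {B : Type} {wt : B → Λ} {deg : B → ℤ} {vec : B → M}
    (hB : IsGenerators e M l₀ wt deg vec) (T : GSub M) (hT : ∀ b, vec b ∈ T.toSubmodule) {m : Λ}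
    (hm : l₀ ≤ m) (x : M) : e m • x ∈ T.toSubmodule := by
  have key : ∀ (n : ℕ) (d : ℤ), (∃ β, (∀ i < β, M.gr i = ⊥) ∧ d < β + n) →
      ∀ m, l₀ ≤ m → ∀ x ∈ M.gr d, e m • x ∈ T.toSubmodule := by
    intro n
    induction n with
    | zero =>
      rintro d ⟨β, hβ, hd⟩ m - x hx
      rw [hβ d (by simpa using hd), Submodule.mem_bot] at hx
      rw [hx, smul_zero]
      exact zero_mem _
    | succ n ih =>
      rintro d ⟨β, hβ, hd⟩ m hm x hx
      have hmx := h.idem_smul_mem m hx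
      obtain ⟨s, hs, r, hr, hsr⟩ := Submodule.mem_sup.1
        (hB.le_span m hm d _ hmx (h.idem_smul_self m x))
      rw [← M.proj_of_mem hmx, ← hsr, map_add]
      refine add_mem (T.homogeneous _ ?_ d) (h.proj_mem_of_mem_decomposables T
        (fun d' hd' m hm x hx => ih d' ⟨β, hβ, by push_cast at hd; omega⟩ m hm x hx) hr)
      have hle : Submodule.span k (Set.range vec) ≤ T.toSubmodule.restrictScalars k := by
        rw [Submodule.span_le]
        rintro _ ⟨b, rfl⟩
        exact hT b
      exact hle hs
  obtain ⟨β, hβ⟩ := hM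
  induction x using M.induction_on with
  | hom d x hx => exact key (d + 1 - β).toNat d ⟨β, hβ, by omega⟩ m hm x hx
  | zero => rw [smul_zero]; exact zero_mem _
  | add x y hx hy => rw [smul_add]; exact add_mem hx hy

/-- The standard cover of the submodule generated by a maximal class of weights. -/
theorem exists_standard_cover {h : IsPositivelyGraded 𝒜 e} (hs : h.IsStandardlyStratified)
    {M : GMod 𝒜} (hM : M.IsBoundedBelow) {l₀ : Λ} (hmax : ∀ m, l₀ < m → ∀ x : M, e m • x = 0)
    {B : Type} [Countable B] {wt : B → Λ} {deg : B → ℤ} {vec : B → M}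
    (hB : IsGenerators e M l₀ wt deg vec) :
    ∃ (G : GMod 𝒜) (f : G ⟶ M), InC h.standard G ∧ (∀ b, ∃ x, lin f x = vec b) ∧
      ∀ (l : Λ) (j : ℤ) (g : G ⟶ (h.properCostandard l).shift j), ∃ g', f ≫ g' = g := by
  let N : B → GMod 𝒜 := fun b => (h.standard (wt b)).shift (-deg b)
  have hgr : ∀ b d, d < deg b → (N b).gr d = ⊥ := by
    intro b d hd
    refine (Submodule.eq_bot_iff _).2 fun y hy => ?_
    obtain ⟨x, hx, rfl⟩ := exists_homogeneous_preimage
      (shiftHom (h.toStandard (wt b)) (-deg b)) (h.toStandard_surjective _) hy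
    have hx0 : h.coeff (((h.P (wt b)).sh (-deg b)).symm x) ∈ 𝒜 (-deg b + d) := h.coeff_mem hx
    rw [h.eq_bot _ (by omega), Submodule.mem_bot] at hx0
    have : ((h.P (wt b)).sh (-deg b)).symm x = 0 := by
      rw [← h.coeff_smul_gen (((h.P (wt b)).sh (-deg b)).symm x), hx0, zero_smul]
    rw [(LinearEquiv.map_eq_zero_iff _).1 this, map_zero]
  have hfin : ∀ n : ℤ, {b | ∃ d ≤ n, (N b).gr d ≠ ⊥}.Finite := fun n =>
    (hB.finite n).subset fun b => by
      rintro ⟨d, hd, hbd⟩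
      by_contra hn
      exact hbd (hgr b d (hd.trans_lt (not_le.1 hn)))
  have hN : ∀ d, {b | (N b).gr d ≠ ⊥}.Finite := fun d =>
    (hfin d).subset fun b hb => ⟨d, le_rfl, hb⟩
  choose s hs' using fun b => h.exists_lift_standard (wt b) (j := -deg b) (vec b)
    (by rw [neg_neg]; exact hB.mem b) (hB.idem b) fun m hm => hmax m ((hB.le b).trans_lt hm)
  obtain ⟨f, hf⟩ := exists_dsum_desc hN s
  have hbdd : (dsum N hN).IsBoundedBelow := by
    obtain ⟨β, hβ⟩ := hM
    refine ⟨β, fun d hd => dsum_gr_eq_bot hN fun b => hgr b d (hd.trans_le ?_)⟩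
    by_contra hb
    have h0 := hB.mem b
    rw [hβ _ (not_le.1 hb), Submodule.mem_bot] at h0
    obtain ⟨φ, -, hφ⟩ := hB.exists_functional (fun _ => 1) (wt b) (deg b)
    have h1 := hφ b rfl rfl
    rw [h0, map_zero] at h1
    exact zero_ne_one h1
  refine ⟨dsum N hN, f, inC_dsum hN (fun b => ⟨wt b, -deg b, ⟨Iso.refl _⟩⟩) hbdd hfin,
    fun b => ⟨lin (dsumι hN b) (h.genΔ _ _), ?_⟩, fun l j g => ?_⟩
  · rw [← lin_comp_apply, hf, hs']
  -- `φ` prescribes on the generators of weight `l` and degree `-j` the socle coordinates dictated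
  -- by `g`. Vanishing on decomposables is what turns it into a morphism from `M`.
  · obtain ⟨φ, hφ0, hφ1⟩ := hB.exists_functional
      (fun b => h.ev l j (lin g (lin (dsumι hN b) (h.genΔ _ _)))) l (-j)
    have hg' : ∃ g' : M ⟶ (h.properCostandard l).shift j, l₀ ≤ l →
        ∀ x, h.ev l j (lin g' x) = φ (M.proj (-j) (e l • x)) := by
      by_cases hl : l₀ ≤ l
      · obtain ⟨g', hg'⟩ := h.exists_lift_properCostandard' l j φ (fun i hi a ha m hlm x _ => by
          refine hφ0 _ (Submodule.subset_span ⟨i, hi, e l * a, ?_, m, hl.trans hlm, x, ?_⟩)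
          · simpa using (SetLike.mul_mem_graded (h.idem_mem l) ha : e l * a ∈ 𝒜 (0 + i))
          · rw [mul_smul])
        exact ⟨g', fun _ => hg'⟩
      -- Harmless: no generator has weight `l` here, so all morphisms from the summands to this
      -- target are zero.
      · exact ⟨0, fun hl' => absurd hl' hl⟩
    obtain ⟨g', hg'⟩ := hg'
    refine ⟨g', dsum_hom_ext hN fun b => ?_⟩
    rw [← Category.assoc, hf]
    by_cases hb : wt b = l ∧ -deg b = j
    · obtain ⟨rfl, hj⟩ := hb
      refine h.hom_standard_ext (sub_eq_zero.1 (h.eq_zero_of_ev le_rfl (m := wt b) ?_ ?_))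
      · rw [smul_sub, h.hom_standard_gen_idem, h.hom_standard_gen_idem]
      · rw [map_sub, lin_comp_apply, hs', hg' (hB.le b), hB.idem, M.proj_of_mem
          (by rw [← hj, neg_neg]; exact hB.mem b), hφ1 b rfl (by omega), lin_comp_apply, sub_self]
    · have h0 : ∀ t : N b ⟶ (h.properCostandard l).shift j, t = 0 := by
        intro t
        by_contra ht
        exact hb (eq_of_hom_ne_zero hs ht)
      rw [h0 (s b ≫ g'), h0 (dsumι hN b ≫ g)]

/-- The lowest vector with weight `⪰ l`, for `l` any weight of a nonzero module, gives a nonzero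
morphism. No maximality of `l` is needed. -/
theorem eq_zero_of_hom_properCostandard_eq_zero [Finite Λ] (h : IsPositivelyGraded 𝒜 e)
    {M : GMod 𝒜} (hM : M.IsBoundedBelow)
    (h0 : ∀ (l : Λ) (j : ℤ) (f : M ⟶ (h.properCostandard l).shift j), f = 0) (x : M) : x = 0 := by
  refine h.eq_zero_of_idem_smul fun l => ?_
  by_contra hx
  obtain ⟨m, j, f, y, -, -, -, hy, -⟩ :=
    h.exists_hom_properCostandard hM (l₀ := l) ⟨l, le_rfl, x, hx⟩
  rw [h0 m j f] at hy
  exact hy (map_zero _)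

/-- The submodule `T` generated by the maximal class will turn out to be a sum of standard modules.
Its orthogonality is not known in advance: it needs `ext²` of the quotient, so the quotient must
first be filtered by induction. -/
theorem LeftOrthogonal.hasFiniteFiltration [Finite Λ] {h : IsPositivelyGraded 𝒜 e}
    (hs : h.IsStandardlyStratified) {M : GMod 𝒜} (hM : M.IsBoundedBelow)
    (hL : h.LeftOrthogonal M) : HasFiniteFiltration (InC h.standard) M := by
  revert hM hL
  refine h.weights_induction (R := fun M => M.IsBoundedBelow → h.LeftOrthogonal M →
    HasFiniteFiltration (InC h.standard) M) (fun M h0 _ _ => .of_forall_eq_zero h0)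
    (fun M l₀ hmax ih hM hL => ?_) M
  obtain ⟨B, _, wt, deg, vec, hB⟩ := exists_generators (e := e) hM l₀
  obtain ⟨G, f, hG, hvec, hfact⟩ := exists_standard_cover hs hM hmax hB
  set T := rangeSub f with hT
  let q : G ⟶ T.obj := T.lift f fun x => ⟨x, rfl⟩
  have hqf : q ≫ T.incl = f := rfl
  have hq : Function.Surjective (lin q) := by
    rintro ⟨_, x, rfl⟩
    exact ⟨x, rfl⟩
  have := epi_of_surjective q hq
  have hTm : ∀ m, l₀ ≤ m → ∀ x : M, e m • x ∈ T.toSubmodule := fun m hm x =>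
    h.idem_smul_mem_of_generators hM hB T (fun b => hvec b) hm x
  -- Pulled back to `G`, a morphism from `T` factors through `M`; surjectivity of `q` shows that
  -- this factor restricts to the original morphism.
  have hext : ∀ (l : Λ) (j : ℤ) (t : T.obj ⟶ (h.properCostandard l).shift j),
      ∃ g' : M ⟶ _, T.incl ≫ g' = t := by
    intro l j t
    obtain ⟨g', hg'⟩ := hfact l j (q ≫ t)
    refine ⟨g', ?_⟩
    rw [← cancel_epi q, ← Category.assoc, hqf, hg']
  have hQL : h.LeftOrthogonal T.quot := fun j l => T.isSES.ext_one_quot_left (hext l j) (hL j l)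
  have hQ := ih T.quot (fun l hl y => by
      obtain ⟨x, rfl⟩ := T.lin_proj_surjective y
      rw [← map_smul, hl x, map_zero]) (fun y => by
      obtain ⟨x, rfl⟩ := T.lin_proj_surjective y
      rw [← map_smul]
      exact (Submodule.Quotient.mk_eq_zero _).2 (hTm l₀ le_rfl x)) (hM.quot T) hQL
  -- The argument `1` selects `ext²` of the quotient, the next term in the long exact sequence.
  have hTL : h.LeftOrthogonal T.obj := fun j l =>
    T.isSES.ext_sub_left (hL j l) (subsingleton_ext_of_hasFiniteFiltration hs hQ 1 j l)
  have hker : ∀ x : (kerSub q).obj, x = 0 := by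
    refine h.eq_zero_of_hom_properCostandard_eq_zero (hG.1.sub _) fun l j t => ?_
    -- A morphism from the kernel extends to `G` as `ext¹(T, ∇̄) = 0`, and every morphism from `G`
    -- factors through `f`, which kills the kernel.
    obtain ⟨g, rfl⟩ := (isSES_kerSub q hq).exists_extension (hTL j l) t
    obtain ⟨g', rfl⟩ := hfact l j g
    rw [← hqf, Category.assoc, ← Category.assoc, (isSES_kerSub q hq).zero, zero_comp]
  have hqinj : Function.Injective (lin q) :=
    (injective_iff_map_eq_zero (lin q)).2 fun x hx =>
      congrArg Subtype.val (hker (⟨x, hx⟩ : (kerSub q).toSubmodule))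
  exact .of_sub_of_quot (fun X Y f => InC.of_iso f) T
    (.single (fun X Y f => InC.of_iso f) (hG.of_iso (isoOfBijective q ⟨hqinj, hq⟩))) hQ

end IsPositivelyGraded
-- The two characterizations
theorem mainTheorem5 {k A : Type u} [Field k] [IsAlgClosed k] [Ring A] [Algebra k A]
    (𝒜 : ℤ → Submodule k A) [GradedAlgebra 𝒜]
    {Λ : Type v} [Finite Λ] [Nonempty Λ] [Preorder Λ] (e : Λ → A)
    (h : IsPositivelyGraded 𝒜 e) (hs : h.IsStandardlyStratified) :
    (∀ M : GMod 𝒜, GMod.InFDown h.standard M ↔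
      M.IsBoundedBelow ∧ ∀ (j : ℤ) (i : ℕ) (l : Λ), 0 < i →
        Subsingleton (Abelian.Ext M ((h.properCostandard l).shift j) i)) ∧
    (∀ M : GMod 𝒜, GMod.InFDown h.standard M ↔
      M.IsBoundedBelow ∧ ∀ (j : ℤ) (l : Λ),
        Subsingleton (Abelian.Ext M ((h.properCostandard l).shift j) 1)) ∧
    (∀ M : GMod 𝒜, GMod.InFDown h.properCostandard M ↔
      M.IsBoundedBelow ∧ ∀ (j : ℤ) (i : ℕ) (l : Λ), 0 < i →
        Subsingleton (Abelian.Ext ((h.standard l).shift j) M i)) ∧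
    (∀ M : GMod 𝒜, GMod.InFDown h.properCostandard M ↔
      M.IsBoundedBelow ∧ ∀ (j : ℤ) (l : Λ),
        Subsingleton (Abelian.Ext ((h.standard l).shift j) M 1)) := by
  have hi : ∀ (M : GMod 𝒜), GMod.InFDown h.standard M → ∀ (j : ℤ) (i : ℕ) (l : Λ), 0 < i →
      Subsingleton (Abelian.Ext M ((h.properCostandard l).shift j) i) := by
    intro M hM j i l hi
    obtain ⟨n, rfl⟩ := Nat.exists_eq_succ_of_ne_zero hi.ne'
    exact IsPositivelyGraded.subsingleton_ext_of_hasFiniteFiltration hs hM.2 n j l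
  have hii : ∀ (M : GMod 𝒜), GMod.InFDown h.properCostandard M → ∀ (j : ℤ) (i : ℕ) (l : Λ),
      0 < i → Subsingleton (Abelian.Ext ((h.standard l).shift j) M i) := by
    intro M hM j i l hi
    obtain ⟨n, rfl⟩ := Nat.exists_eq_succ_of_ne_zero hi.ne'
    exact (IsPositivelyGraded.RightOrthogonal.of_inFDown hs hM).ext hs n j l
  have hi' : ∀ M : GMod 𝒜, M.IsBoundedBelow → h.LeftOrthogonal M →
      GMod.InFDown h.standard M := fun M hb hM => ⟨hb, hM.hasFiniteFiltration hs hb⟩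
  have hii' : ∀ M : GMod 𝒜, M.IsBoundedBelow → h.RightOrthogonal M →
      GMod.InFDown h.properCostandard M := fun M hb hM => hM.inFDown hs hb
  exact ⟨fun M => ⟨fun hM => ⟨hM.1, hi M hM⟩, fun hM => hi' M hM.1 fun j l =>
      hM.2 j 1 l Nat.one_pos⟩,
    fun M => ⟨fun hM => ⟨hM.1, fun j l => hi M hM j 1 l Nat.one_pos⟩, fun hM => hi' M hM.1 hM.2⟩,
    fun M => ⟨fun hM => ⟨hM.1, hii M hM⟩, fun hM => hii' M hM.1 fun j l =>
      hM.2 j 1 l Nat.one_pos⟩,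
    fun M => ⟨fun hM => ⟨hM.1, fun j l => hii M hM j 1 l Nat.one_pos⟩,
      fun hM => hii' M hM.1 hM.2⟩⟩
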